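/- Let $\mathcal B$ be a bicategory whose categories of 1-morphisms $\mathcal B(a,b)$ are idempotent complete. A separable Frobenius algebra on an object $a$ is a 1-morphism $A\colon a\to a$ with 2-morphisms $\mu\colon A\otimes A\to A$, $\eta\colon I_a\to A$, $\Delta\colon A\to A\otimes A$, $\varepsilon\colon A\to I_a$ such that $(A,\mu,\eta)$ is an associative unital algebra, $(A,\Delta,\varepsilon)$ is a coassociative counital coalgebra, $(1_A\otimes\mu)\circ(\Delta\otimes 1_A)=\Delta\circ\mu=(\mu\otimes 1_A)\circ(1_A\otimes\Delta)$, and $\mu\circ\Delta=1_A$. The equivariant completion $\mathcal B_{\mathrm{eq}}$ is the bicategory whose objects are pairs $(a,A)$ of an object $a\in\mathcal B$ and a separable Frobenius algebra $A$ on $a$, whose 1-morphisms $(a,A)\to(b,B)$ are the 1-morphisms $X\colon a\to b$ of $\mathcal B$ with the structure of a $B$-$A$-bimodule, and whose 2-morphisms are the bimodule maps; the composite of $X\colon(a,A)\to(b,B)$ and $Y\colon(b,B)\to(c,C)$ is the relative tensor product $Y\otimes_B X$, and the identity of $(a,A)$ is $A$. The 1-morphism categories of $\mathcal B_{\mathrm{eq}}$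 are again idempotent complete. There is a pseudofunctor $\mathcal B\to\mathcal B_{\mathrm{eq}}$, $a\mapsto(a,I_a)$, which sends a 1-morphism to itself with the trivial actions and a 2-morphism to itself. Suppose that $\mathcal B$ is moreover pivotal: every 1-morphism $X\colon a\to b$ has a chosen 1-morphism $X^\dagger\colon b\to a$ with chosen adjunctions making it both a right and a left adjoint of $X$, such that for every 2-morphism $\phi\colon X\to Z$ the two maps $Z^\dagger\to X^\dagger$ conjugate to $\phi$, formed with the right and with the left adjunctions, coincide, and so do the two canonical maps $(Y\otimes X)^\dagger\to X^\dagger\otimes Y^\dagger$ formed with the right and with the left adjunctions. A Frobenius algebra $A$ is symmetric if the two maps $A\to A^\dagger$ obtained from the pairing $\varepsilon\circ\mu$ by means of $A^\dagger$ as a right and as a left adjoint of $A$ coincide. The orbifold completion $\mathcal B_{\mathrm{orb}}$ is the full subbicategory of $\mathcal B_{\mathrm{eq}}$ on the pairs $(a,A)$ with $A$ symmetric. It contains all $(a,I_a)$. It is again pivotal: for a $B$-$A$-bimodule $X$, the adjoint is $X^\dagger$ with the actions dual to those on $X$, and the adjunction maps are those of $\mathcal B$ composed with the induced actions and coactions of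 $A$ and $B$, viewed on tensor products over $A$ and $B$. Then the following hold, where an equivalence of bicategories is a pseudofunctor that is an equivalence on every category of 1-morphisms and is essentially surjective, i.e. every object of the target is equivalent to one in the image. 1. The embedding $\mathcal B_{\mathrm{eq}}\to(\mathcal B_{\mathrm{eq}})_{\mathrm{eq}}$, $(a,A)\mapsto((a,A),I_{(a,A)})$, is full (an equivalence on every category of 1-morphisms) and essentially surjective; hence it is an equivalence of bicategories $\mathcal B_{\mathrm{eq}}\cong(\mathcal B_{\mathrm{eq}})_{\mathrm{eq}}$. 2. If $\mathcal B$ is pivotal, the embedding $\mathcal B_{\mathrm{orb}}\to(\mathcal B_{\mathrm{orb}})_{\mathrm{orb}}$, $(a,A)\mapsto((a,A),I_{(a,A)})$, is full and essentially surjective in the same sense; hence it is an equivalence of bicategories $\mathcal B_{\mathrm{orb}}\cong(\mathcal B_{\mathrm{orb}})_{\mathrm{orb}}$. -/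

import Mathlib

open CategoryTheory Bicategory

universe w v u

namespace OrbifoldCompletion

section Algebras

variable {B : Type u} [Bicategory.{w, v} B]

/-- A separable Frobenius algebra on the object `a`: a 1-endomorphism `X` of `a` with an associative
unital multiplication, a coassociative counital comultiplication, the Frobenius relations, and
separability in the strict form "comultiplication followed by multiplication is the identity".

Composition of 1-morphisms is written in Mathlib's diagrammatic order: `f ≫ g` is "first `f`". -/
structure SepFrobAlg (a : B) where
  X : a ⟶ a
  mul : X ≫ X ⟶ X
  one : 𝟙 a ⟶ X
  comul : X ⟶ X ≫ X
  counit : X ⟶ 𝟙 a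
  mul_assoc : mul ▷ X ≫ mul = (α_ X X X).hom ≫ X ◁ mul ≫ mul
  one_mul : one ▷ X ≫ mul = (λ_ X).hom
  mul_one : X ◁ one ≫ mul = (ρ_ X).hom
  comul_assoc : comul ≫ comul ▷ X ≫ (α_ X X X).hom = comul ≫ X ◁ comul
  counit_comul : comul ≫ counit ▷ X = (λ_ X).inv
  comul_counit : comul ≫ X ◁ counit = (ρ_ X).inv
  frob_left : X ◁ comul ≫ (α_ X X X).inv ≫ mul ▷ X = mul ≫ comul
  frob_right : comul ▷ X ≫ (α_ X X X).hom ≫ X ◁ mul = mul ≫ comul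
  separable : comul ≫ mul = 𝟙 X

attribute [simp] SepFrobAlg.one_mul SepFrobAlg.mul_one SepFrobAlg.separable

/-- A 1-morphism from `(a, A)` to `(b, C)`: a 1-morphism `X : a ⟶ b` with commuting unital
associative actions of `A` and of `C`. In the diagrammatic order of composition `A` acts on the
left and `C` on the right, so that this is the same as a `C`-`A`-bimodule when composition of
1-morphisms is written in the order `g ⊗ f`. -/
structure Bimodule {a b : B} (A : SepFrobAlg a) (C : SepFrobAlg b) where
  X : a ⟶ b
  l : A.X ≫ X ⟶ X
  r : X ≫ C.X ⟶ X
  l_assoc : A.mul ▷ X ≫ l = (α_ A.X A.X X).hom ≫ A.X ◁ l ≫ l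
  one_l : A.one ▷ X ≫ l = (λ_ X).hom
  r_assoc : X ◁ C.mul ≫ r = (α_ X C.X C.X).inv ≫ r ▷ C.X ≫ r
  r_one : X ◁ C.one ≫ r = (ρ_ X).hom
  l_r : l ▷ C.X ≫ r = (α_ A.X X C.X).hom ≫ A.X ◁ r ≫ l

attribute [simp] Bimodule.one_l Bimodule.r_one

namespace Bimodule
variable {a b : B} {A : SepFrobAlg a} {C : SepFrobAlg b} (M : Bimodule A C)

/-- The coaction of `C` on `X` induced by its action: create `C ≫ C` by the unit followed by the
comultiplication, then act with the first factor. -/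
def coact : M.X ⟶ M.X ≫ C.X :=
  (ρ_ M.X).inv ≫ M.X ◁ (C.one ≫ C.comul) ≫ (α_ M.X C.X C.X).inv ≫ M.r ▷ C.X

@[simp]
lemma coact_r : M.coact ≫ M.r = 𝟙 M.X := by
  have h : (M.X ◁ C.comul ≫ (α_ M.X C.X C.X).inv ≫ M.r ▷ C.X) ≫ M.r = M.r := by
    rw [Category.assoc, Category.assoc, ← M.r_assoc, ← whiskerLeft_comp_assoc, C.separable]
    simp
  simp only [Category.assoc] at h
  simp only [coact, Category.assoc, whiskerLeft_comp]
  rw [h]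
  simp

lemma r_coact_aux : M.r ≫ M.coact = M.X ◁ C.comul ≫ (α_ M.X C.X C.X).inv ≫ M.r ▷ C.X := by
  calc _ = 𝟙 _ ⊗≫ (M.r ▷ 𝟙 b ≫ M.X ◁ (C.one ≫ C.comul)) ⊗≫ M.r ▷ C.X := by
          simp only [coact]; bicategory
    _ = 𝟙 _ ⊗≫ M.X ◁ C.X ◁ (C.one ≫ C.comul) ⊗≫ ((α_ _ _ _).inv ≫ M.r ▷ C.X ≫ M.r) ▷ C.X  := by
          rw [← whisker_exchange]; bicategory
    _ = 𝟙 _ ⊗≫ M.X ◁ (C.X ◁ C.one ≫ (C.X ◁ C.comul ≫ (α_ _ _ _).inv ≫ C.mul ▷ C.X)) ⊗≫ M.r ▷ C.X  := by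
          rw [← M.r_assoc]; bicategory
    _ = 𝟙 _ ⊗≫ M.X ◁ ((C.X ◁ C.one ≫ C.mul) ≫ C.comul) ⊗≫ M.r ▷ C.X  := by
          rw [C.frob_left]; bicategory
    _ = _ := by
          rw [C.mul_one]; bicategory

lemma r_coact : M.r ≫ M.coact = M.coact ▷ C.X ≫ (α_ _ _ _).hom ≫ M.X ◁ C.mul := by
  rw [r_coact_aux]
  symm
  calc _ = 𝟙 _ ⊗≫ M.X ◁ (C.one ≫ C.comul) ▷ C.X ⊗≫ (M.r ▷ (C.X ≫ C.X) ≫ M.X ◁ C.mul) := by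
          simp only [coact]; bicategory
    _ = 𝟙 _ ⊗≫ M.X ◁ (C.one ▷ C.X ≫ (C.comul ▷ C.X ≫ (α_ _ _ _).hom ≫ C.X ◁ C.mul))
          ⊗≫ M.r ▷ C.X := by
          rw [← whisker_exchange]; bicategory
    _ = 𝟙 _ ⊗≫ M.X ◁ ((C.one ▷ C.X ≫ C.mul) ≫ C.comul) ⊗≫ M.r ▷ C.X := by
          rw [C.frob_right]; bicategory
    _ = _ := by
          rw [C.one_mul]; bicategory

lemma l_coact : M.l ≫ M.coact = A.X ◁ M.coact ≫ (α_ _ _ _).inv ≫ M.l ▷ C.X := by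
  calc _ = 𝟙 _ ⊗≫ (M.l ▷ 𝟙 b ≫ M.X ◁ (C.one ≫ C.comul)) ⊗≫ M.r ▷ C.X := by
          simp only [coact]; bicategory
    _ = 𝟙 _ ⊗≫ (A.X ≫ M.X) ◁ (C.one ≫ C.comul) ⊗≫ (M.l ▷ C.X ≫ M.r) ▷ C.X := by
          rw [← whisker_exchange]; bicategory
    _ = _ := by
          rw [M.l_r]; simp only [coact]; bicategory

/-- Bimodule maps. -/
@[ext]
structure Hom (M N : Bimodule A C) where
  hom : M.X ⟶ N.X
  l_hom : A.X ◁ hom ≫ N.l = M.l ≫ hom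
  r_hom : hom ▷ C.X ≫ N.r = M.r ≫ hom


@[simps]
instance : Category (Bimodule A C) where
  Hom M N := Hom M N
  id M := { hom := 𝟙 M.X, l_hom := by simp, r_hom := by simp }
  comp f g :=
    { hom := f.hom ≫ g.hom
      l_hom := by rw [whiskerLeft_comp, Category.assoc, g.l_hom, reassoc_of% f.l_hom]
      r_hom := by rw [comp_whiskerRight, Category.assoc, g.r_hom, reassoc_of% f.r_hom] }

@[ext]
lemma hom_ext {M N : Bimodule A C} {f g : M ⟶ N} (h : f.hom = g.hom) : f = g := Hom.ext h

@[simp]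
lemma comp_hom' {M N P : Bimodule A C} (f : M ⟶ N) (g : N ⟶ P) :
    (f ≫ g).hom = f.hom ≫ g.hom := rfl

@[simp]
lemma id_hom' (M : Bimodule A C) : Hom.hom (𝟙 M) = 𝟙 M.X := rfl

/-- A bimodule map with a two-sided inverse 2-morphism is an isomorphism of bimodules. -/
@[simps]
def isoOfHom {M N : Bimodule A C} (f : M ⟶ N) (g : N.X ⟶ M.X) (h₁ : f.hom ≫ g = 𝟙 _)
    (h₂ : g ≫ f.hom = 𝟙 _) : M ≅ N where
  hom := f
  inv :=
    { hom := g
      l_hom := by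
        have : M.l = A.X ◁ f.hom ≫ N.l ≫ g := by rw [reassoc_of% f.l_hom, h₁, Category.comp_id]
        rw [this, ← whiskerLeft_comp_assoc, h₂]
        simp
      r_hom := by
        have : M.r = f.hom ▷ C.X ≫ N.r ≫ g := by rw [reassoc_of% f.r_hom, h₁, Category.comp_id]
        rw [this, ← comp_whiskerRight_assoc, h₂]
        simp }

lemma coact_hom {M N : Bimodule A C} (f : M ⟶ N) : M.coact ≫ f.hom ▷ C.X = f.hom ≫ N.coact := by
  have h := f.r_hom
  calc _ = 𝟙 _ ⊗≫ M.X ◁ (C.one ≫ C.comul) ⊗≫ (M.r ≫ f.hom) ▷ C.X := by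
          simp only [coact]; bicategory
    _ = 𝟙 _ ⊗≫ (M.X ◁ (C.one ≫ C.comul) ≫ f.hom ▷ _) ⊗≫ N.r ▷ C.X := by
          rw [← h]; bicategory
    _ = _ := by
          rw [whisker_exchange]; simp only [coact]; bicategory
end Bimodule
end Algebras

section Tensor

variable {B : Type u} [Bicategory.{w, v} B]

instance isSplitEpi_whiskerLeft {a b c : B} (f : a ⟶ b) {g h : b ⟶ c} (η : g ⟶ h)
    [IsSplitEpi η] : IsSplitEpi (f ◁ η) :=
  ⟨⟨f ◁ section_ η, by rw [← whiskerLeft_comp]; simp⟩⟩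

instance isSplitEpi_whiskerRight {a b c : B} {f g : a ⟶ b} (η : f ⟶ g) (h : b ⟶ c)
    [IsSplitEpi η] : IsSplitEpi (η ▷ h) :=
  ⟨⟨section_ η ▷ h, by rw [← comp_whiskerRight]; simp⟩⟩

/-- All categories of 1-morphisms are idempotent complete. -/
class LocallyIdempotentComplete (B : Type u) [Bicategory.{w, v} B] : Prop where
  idem (a b : B) : IsIdempotentComplete (a ⟶ b)

namespace Bimodule

variable {a b c d e : B} {A : SepFrobAlg a} {C : SepFrobAlg b} {E : SepFrobAlg c}
  {G : SepFrobAlg d} {K : SepFrobAlg e}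
  (M : Bimodule A C) (N : Bimodule C E) (P : Bimodule E G) (Q : Bimodule G K)

/-- A 2-morphism out of `M.X ≫ N.X` coequalises the two actions of the algebra in the middle. -/
abbrev Balanced {Z : a ⟶ c} (f : M.X ≫ N.X ⟶ Z) : Prop :=
  M.r ▷ N.X ≫ f = (α_ _ _ _).hom ≫ M.X ◁ N.l ≫ f

/-- The idempotent on `M.X ≫ N.X` whose image is the tensor product over the algebra in the
middle. -/
def proj : M.X ≫ N.X ⟶ M.X ≫ N.X :=
  M.coact ▷ N.X ≫ (α_ _ _ _).hom ≫ M.X ◁ N.l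

lemma proj_comp {Z : a ⟶ c} (f : M.X ≫ N.X ⟶ Z) (hf : M.Balanced N f) : M.proj N ≫ f = f := by
  simp only [proj, Category.assoc, ← (show _ = _ from hf)]
  rw [← comp_whiskerRight_assoc]
  simp

lemma proj_balanced : M.Balanced N (M.proj N) := by
  unfold Balanced
  calc _ = 𝟙 _ ⊗≫ (M.r ≫ M.coact) ▷ N.X ⊗≫ M.X ◁ N.l := by
          simp only [proj]; bicategory
    _ = 𝟙 _ ⊗≫ M.coact ▷ C.X ▷ N.X ⊗≫ M.X ◁ (C.mul ▷ N.X ≫ N.l) := by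
          rw [r_coact]; bicategory
    _ = 𝟙 _ ⊗≫ (M.coact ▷ (C.X ≫ N.X) ≫ (M.X ≫ C.X) ◁ N.l) ⊗≫ M.X ◁ N.l := by
          rw [N.l_assoc]; bicategory
    _ = _ := by
          rw [← whisker_exchange]; simp only [proj]; bicategory

lemma proj_idem : M.proj N ≫ M.proj N = M.proj N := M.proj_comp N _ (M.proj_balanced N)

lemma l_proj : A.X ◁ M.proj N ≫ (α_ _ _ _).inv ≫ M.l ▷ N.X =
    (α_ _ _ _).inv ≫ M.l ▷ N.X ≫ M.proj N := by
  symm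
  calc _ = 𝟙 _ ⊗≫ (M.l ≫ M.coact) ▷ N.X ⊗≫ M.X ◁ N.l := by
          simp only [proj]; bicategory
    _ = 𝟙 _ ⊗≫ A.X ◁ M.coact ▷ N.X ⊗≫ (M.l ▷ (C.X ≫ N.X) ≫ M.X ◁ N.l) := by
          rw [l_coact]; bicategory
    _ = _ := by
          rw [← whisker_exchange]; simp only [proj]; bicategory

lemma r_proj : M.proj N ▷ E.X ≫ (α_ _ _ _).hom ≫ M.X ◁ N.r =
    (α_ _ _ _).hom ≫ M.X ◁ N.r ≫ M.proj N := by
  calc _ = 𝟙 _ ⊗≫ M.coact ▷ N.X ▷ E.X ⊗≫ M.X ◁ (N.l ▷ E.X ≫ N.r) := by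
          simp only [proj]; bicategory
    _ = 𝟙 _ ⊗≫ (M.coact ▷ (N.X ≫ E.X) ≫ (M.X ≫ C.X) ◁ N.r) ⊗≫ M.X ◁ N.l := by
          rw [N.l_r]; bicategory
    _ = _ := by
          rw [← whisker_exchange]; simp only [proj]; bicategory

variable [LocallyIdempotentComplete B]

lemma exists_split : ∃ (Y : a ⟶ c) (i : Y ⟶ M.X ≫ N.X) (q : M.X ≫ N.X ⟶ Y),
    i ≫ q = 𝟙 Y ∧ q ≫ i = M.proj N :=
  (LocallyIdempotentComplete.idem a c).idempotents_split _ _ (M.proj_idem N)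

/-- The 1-morphism underlying the tensor product over `C`: the image of the idempotent `proj`. -/
noncomputable def tensorX : a ⟶ c := (M.exists_split N).choose

/-- The inclusion of the image of the idempotent `proj`. -/
noncomputable def ξ₀ : M.tensorX N ⟶ M.X ≫ N.X := (M.exists_split N).choose_spec.choose

/-- The projection to the image of the idempotent `proj`. -/
noncomputable def ϑ₀ : M.X ≫ N.X ⟶ M.tensorX N :=
  (M.exists_split N).choose_spec.choose_spec.choose

@[simp]
lemma ξ₀_ϑ₀ : M.ξ₀ N ≫ M.ϑ₀ N = 𝟙 _ := (M.exists_split N).choose_spec.choose_spec.choose_spec.1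

lemma ϑ₀_ξ₀ : M.ϑ₀ N ≫ M.ξ₀ N = M.proj N :=
  (M.exists_split N).choose_spec.choose_spec.choose_spec.2

@[simp]
lemma proj_ϑ₀ : M.proj N ≫ M.ϑ₀ N = M.ϑ₀ N := by rw [← ϑ₀_ξ₀]; simp

lemma ϑ₀_balanced : M.r ▷ N.X ≫ M.ϑ₀ N = (α_ _ _ _).hom ≫ M.X ◁ N.l ≫ M.ϑ₀ N := by
  have := M.proj_balanced N
  unfold Balanced at this
  rw [← M.proj_ϑ₀ N, reassoc_of% this]

instance : IsSplitEpi (M.ϑ₀ N) := ⟨⟨M.ξ₀ N, by simp⟩⟩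

/-- The left action on the tensor product, induced by the left action on the first factor. -/
noncomputable def tensorL : A.X ≫ M.tensorX N ⟶ M.tensorX N :=
  A.X ◁ M.ξ₀ N ≫ (α_ _ _ _).inv ≫ M.l ▷ N.X ≫ M.ϑ₀ N

/-- The right action on the tensor product, induced by the right action on the second factor. -/
noncomputable def tensorR : M.tensorX N ≫ E.X ⟶ M.tensorX N :=
  M.ξ₀ N ▷ E.X ≫ (α_ _ _ _).hom ≫ M.X ◁ N.r ≫ M.ϑ₀ N

lemma ϑ₀_tensorL : A.X ◁ M.ϑ₀ N ≫ M.tensorL N = (α_ _ _ _).inv ≫ M.l ▷ N.X ≫ M.ϑ₀ N := by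
  rw [tensorL, ← whiskerLeft_comp_assoc, ϑ₀_ξ₀, reassoc_of% M.l_proj N, proj_ϑ₀]

lemma ϑ₀_tensorR : M.ϑ₀ N ▷ E.X ≫ M.tensorR N = (α_ _ _ _).hom ≫ M.X ◁ N.r ≫ M.ϑ₀ N := by
  rw [tensorR, ← comp_whiskerRight_assoc, ϑ₀_ξ₀, reassoc_of% M.r_proj N, proj_ϑ₀]

/-- The relative tensor product over the algebra `C`, which is the composition of bimodules. By
`ϑ_balanced` and `ϑ_desc` the projection `ϑ : M.X ≫ N.X ⟶ (M.tensor N).X` is the (split)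
coequaliser of the two actions of `C`. -/
noncomputable def tensor : Bimodule A E where
  X := M.tensorX N
  l := M.tensorL N
  r := M.tensorR N
  l_assoc := by
    rw [← cancel_epi ((A.X ≫ A.X) ◁ M.ϑ₀ N), whisker_exchange_assoc, ϑ₀_tensorL]
    calc _ = 𝟙 _ ⊗≫ (A.mul ▷ M.X ≫ M.l) ▷ N.X ⊗≫ M.ϑ₀ N := by bicategory
      _ = 𝟙 _ ⊗≫ A.X ◁ M.l ▷ N.X ⊗≫ ((α_ _ _ _).inv ≫ M.l ▷ N.X ≫ M.ϑ₀ N) := by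
        rw [M.l_assoc]; bicategory
      _ = 𝟙 _ ⊗≫ A.X ◁ M.l ▷ N.X ⊗≫ A.X ◁ M.ϑ₀ N ⊗≫ M.tensorL N := by
        rw [← ϑ₀_tensorL]; bicategory
      _ = 𝟙 _ ⊗≫ A.X ◁ ((α_ _ _ _).inv ≫ M.l ▷ N.X ≫ M.ϑ₀ N) ⊗≫ M.tensorL N := by
        bicategory
      _ = _ := by
        rw [← ϑ₀_tensorL]; bicategory
  one_l := by
    rw [← cancel_epi (𝟙 a ◁ M.ϑ₀ N), whisker_exchange_assoc, ϑ₀_tensorL]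
    calc _ = 𝟙 _ ⊗≫ (A.one ▷ M.X ≫ M.l) ▷ N.X ⊗≫ M.ϑ₀ N := by bicategory
      _ = _ := by rw [M.one_l]; bicategory
  r_assoc := by
    rw [← cancel_epi (M.ϑ₀ N ▷ (E.X ≫ E.X)), ← whisker_exchange_assoc, ϑ₀_tensorR]
    calc _ = 𝟙 _ ⊗≫ M.X ◁ (N.X ◁ E.mul ≫ N.r) ⊗≫ M.ϑ₀ N := by bicategory
      _ = 𝟙 _ ⊗≫ M.X ◁ N.r ▷ E.X ⊗≫ ((α_ _ _ _).hom ≫ M.X ◁ N.r ≫ M.ϑ₀ N) := by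
        rw [N.r_assoc]; bicategory
      _ = 𝟙 _ ⊗≫ M.X ◁ N.r ▷ E.X ⊗≫ M.ϑ₀ N ▷ E.X ⊗≫ M.tensorR N := by
        rw [← ϑ₀_tensorR]; bicategory
      _ = 𝟙 _ ⊗≫ ((α_ _ _ _).hom ≫ M.X ◁ N.r ≫ M.ϑ₀ N) ▷ E.X ⊗≫ M.tensorR N := by
        bicategory
      _ = _ := by
        rw [← ϑ₀_tensorR]; bicategory
  r_one := by
    rw [← cancel_epi (M.ϑ₀ N ▷ 𝟙 c), ← whisker_exchange_assoc, ϑ₀_tensorR]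
    calc _ = 𝟙 _ ⊗≫ M.X ◁ (N.X ◁ E.one ≫ N.r) ⊗≫ M.ϑ₀ N := by bicategory
      _ = _ := by rw [N.r_one]; bicategory
  l_r := by
    rw [← cancel_epi ((A.X ◁ M.ϑ₀ N) ▷ E.X)]
    calc _ = (A.X ◁ M.ϑ₀ N ≫ M.tensorL N) ▷ E.X ≫ M.tensorR N := by bicategory
      _ = 𝟙 _ ⊗≫ M.l ▷ N.X ▷ E.X ⊗≫ (M.ϑ₀ N ▷ E.X ≫ M.tensorR N) := by
        rw [ϑ₀_tensorL]; bicategory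
      _ = 𝟙 _ ⊗≫ (M.l ▷ (N.X ≫ E.X) ≫ M.X ◁ N.r) ⊗≫ M.ϑ₀ N := by
        rw [ϑ₀_tensorR]; bicategory
      _ = 𝟙 _ ⊗≫ A.X ◁ M.X ◁ N.r ⊗≫ ((α_ _ _ _).inv ≫ M.l ▷ N.X ≫ M.ϑ₀ N) := by
        rw [← whisker_exchange]; bicategory
      _ = 𝟙 _ ⊗≫ A.X ◁ ((α_ _ _ _).hom ≫ M.X ◁ N.r ≫ M.ϑ₀ N) ⊗≫ M.tensorL N := by
        rw [← ϑ₀_tensorL]; bicategory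
      _ = _ := by
        rw [← ϑ₀_tensorR]; bicategory


/-- The projection to the tensor product. -/
noncomputable def ϑ : M.X ≫ N.X ⟶ (M.tensor N).X := M.ϑ₀ N

/-- The section of the projection to the tensor product. -/
noncomputable def ξ : (M.tensor N).X ⟶ M.X ≫ N.X := M.ξ₀ N

@[simp]
lemma ξ_ϑ : M.ξ N ≫ M.ϑ N = 𝟙 _ := M.ξ₀_ϑ₀ N

@[simp]
lemma ξ_ϑ_assoc {Z : a ⟶ c} (h : (M.tensor N).X ⟶ Z) : M.ξ N ≫ M.ϑ N ≫ h = h := by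
  rw [reassoc_of% M.ξ_ϑ N]

lemma ϑ_ξ : M.ϑ N ≫ M.ξ N = M.proj N := M.ϑ₀_ξ₀ N

lemma ϑ_balanced : M.r ▷ N.X ≫ M.ϑ N = (α_ _ _ _).hom ≫ M.X ◁ N.l ≫ M.ϑ N :=
  M.ϑ₀_balanced N

lemma ϑ_balanced' : M.X ◁ N.l ≫ M.ϑ N = (α_ _ _ _).inv ≫ M.r ▷ N.X ≫ M.ϑ N := by
  simp [ϑ_balanced]

instance : IsSplitEpi (M.ϑ N) := ⟨⟨M.ξ N, by simp⟩⟩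

lemma ϑ_l : A.X ◁ M.ϑ N ≫ (M.tensor N).l = (α_ _ _ _).inv ≫ M.l ▷ N.X ≫ M.ϑ N :=
  M.ϑ₀_tensorL N

lemma ϑ_r : M.ϑ N ▷ E.X ≫ (M.tensor N).r = (α_ _ _ _).hom ≫ M.X ◁ N.r ≫ M.ϑ N :=
  M.ϑ₀_tensorR N

lemma ϑ_l' : M.l ▷ N.X ≫ M.ϑ N = (α_ _ _ _).hom ≫ A.X ◁ M.ϑ N ≫ (M.tensor N).l := by
  rw [ϑ_l, Iso.hom_inv_id_assoc]

lemma ϑ_r' : M.X ◁ N.r ≫ M.ϑ N = (α_ _ _ _).inv ≫ M.ϑ N ▷ E.X ≫ (M.tensor N).r := by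
  rw [ϑ_r, Iso.inv_hom_id_assoc]

/-- Factorisation of a balanced 2-morphism through the tensor product. -/
noncomputable def desc {Z : a ⟶ c} (f : M.X ≫ N.X ⟶ Z) : (M.tensor N).X ⟶ Z := M.ξ N ≫ f

lemma ϑ_desc {Z : a ⟶ c} (f : M.X ≫ N.X ⟶ Z) (hf : M.Balanced N f) :
    M.ϑ N ≫ M.desc N f = f := by
  rw [desc, reassoc_of% M.ϑ_ξ N, M.proj_comp N f hf]

variable {M N P Q} {M' M'' : Bimodule A C} {N' N'' : Bimodule C E}

/-- A balanced map that is compatible with the outer actions induces a bimodule map out of the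
tensor product. -/
noncomputable def descHom {T : Bimodule A E} (f : M.X ≫ N.X ⟶ T.X) (hf : M.Balanced N f)
    (hl : A.X ◁ f ≫ T.l = (α_ _ _ _).inv ≫ M.l ▷ N.X ≫ f)
    (hr : f ▷ E.X ≫ T.r = (α_ _ _ _).hom ≫ M.X ◁ N.r ≫ f) : M.tensor N ⟶ T where
  hom := M.desc N f
  l_hom := by
    rw [← cancel_epi (A.X ◁ M.ϑ N), ← whiskerLeft_comp_assoc, M.ϑ_desc N f hf, hl,
      reassoc_of% M.ϑ_l N, M.ϑ_desc N f hf]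
  r_hom := by
    rw [← cancel_epi (M.ϑ N ▷ E.X), ← comp_whiskerRight_assoc, M.ϑ_desc N f hf, hr,
      reassoc_of% M.ϑ_r N, M.ϑ_desc N f hf]

@[simp]
lemma ϑ_descHom {T : Bimodule A E} (f : M.X ≫ N.X ⟶ T.X) (hf : M.Balanced N f)
    (hl : A.X ◁ f ≫ T.l = (α_ _ _ _).inv ≫ M.l ▷ N.X ≫ f)
    (hr : f ▷ E.X ≫ T.r = (α_ _ _ _).hom ≫ M.X ◁ N.r ≫ f) :
    M.ϑ N ≫ (descHom f hf hl hr).hom = f := M.ϑ_desc N f hf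

lemma tensor_hom_ext {T : Bimodule A E} {f g : M.tensor N ⟶ T}
    (h : M.ϑ N ≫ f.hom = M.ϑ N ≫ g.hom) : f = g :=
  hom_ext ((cancel_epi (M.ϑ N)).1 h)

/-- Tensor product of the identity of `M` with a bimodule map. -/
noncomputable def whiskerL (M : Bimodule A C) {N N' : Bimodule C E} (f : N ⟶ N') :
    M.tensor N ⟶ M.tensor N' :=
  descHom (M.X ◁ f.hom ≫ M.ϑ N')
    (by
      unfold Balanced
      rw [← whisker_exchange_assoc, ϑ_balanced, ← whiskerLeft_comp_assoc, ← f.l_hom]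
      bicategory)
    (by
      rw [whiskerLeft_comp_assoc, ϑ_l, ← whisker_exchange_assoc]
      bicategory)
    (by
      rw [comp_whiskerRight_assoc, ϑ_r, ← whiskerLeft_comp_assoc, ← f.r_hom]
      bicategory)

/-- Tensor product of a bimodule map with the identity of `N`. -/
noncomputable def whiskerR {M M' : Bimodule A C} (f : M ⟶ M') (N : Bimodule C E) :
    M.tensor N ⟶ M'.tensor N :=
  descHom (f.hom ▷ N.X ≫ M'.ϑ N)
    (by
      unfold Balanced
      rw [whisker_exchange_assoc, ← comp_whiskerRight_assoc, ← f.r_hom, comp_whiskerRight_assoc,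
        ϑ_balanced]
      bicategory)
    (by
      rw [whiskerLeft_comp_assoc, ϑ_l, ← comp_whiskerRight_assoc, ← f.l_hom]
      bicategory)
    (by
      rw [comp_whiskerRight_assoc, ϑ_r, whisker_exchange_assoc]
      bicategory)

@[simp]
lemma ϑ_whiskerL (M : Bimodule A C) {N N' : Bimodule C E} (f : N ⟶ N') :
    M.ϑ N ≫ (M.whiskerL f).hom = M.X ◁ f.hom ≫ M.ϑ N' := ϑ_descHom _ _ _ _

@[simp]
lemma ϑ_whiskerR {M M' : Bimodule A C} (f : M ⟶ M') (N : Bimodule C E) :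
    M.ϑ N ≫ (whiskerR f N).hom = f.hom ▷ N.X ≫ M'.ϑ N := ϑ_descHom _ _ _ _

/-- The algebra as a bimodule over itself; this is the identity 1-morphism. -/
@[reducible]
def unit (A : SepFrobAlg a) : Bimodule A A where
  X := A.X
  l := A.mul
  r := A.mul
  l_assoc := A.mul_assoc
  one_l := A.one_mul
  r_assoc := by rw [A.mul_assoc]; simp
  r_one := A.mul_one
  l_r := A.mul_assoc

section
variable (M N P)

/-- The left unitor is induced by the left action. -/
noncomputable def leftUnitorHom : (unit A).tensor M ⟶ M :=
  descHom (T := M) M.l M.l_assoc (by simp only [M.l_assoc, Iso.inv_hom_id_assoc]) M.l_r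

lemma ϑ_leftUnitorHom : (unit A).ϑ M ≫ (leftUnitorHom M).hom = M.l := ϑ_descHom _ _ _ _

/-- The left unitor of bimodules. -/
noncomputable def leftUnitor : (unit A).tensor M ≅ M :=
  isoOfHom (leftUnitorHom M) ((λ_ M.X).inv ≫ A.one ▷ M.X ≫ (unit A).ϑ M)
    (by
      rw [← cancel_epi ((unit A).ϑ M), reassoc_of% ϑ_leftUnitorHom M]
      calc _ = (λ_ _).inv ≫ (𝟙 a ◁ M.l ≫ A.one ▷ M.X) ≫ (unit A).ϑ M := by bicategory
        _ = (λ_ _).inv ≫ A.one ▷ (A.X ≫ M.X) ≫ (unit A).X ◁ M.l ≫ (unit A).ϑ M := by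
          rw [whisker_exchange]; simp only [Category.assoc]
        _ = 𝟙 _ ⊗≫ (A.one ▷ A.X ≫ A.mul) ▷ M.X ≫ (unit A).ϑ M := by
          rw [ϑ_balanced']; bicategory
        _ = _ := by rw [A.one_mul]; bicategory)
    (by
      rw [Category.assoc, Category.assoc, ϑ_leftUnitorHom, M.one_l]; simp)

@[simp]
lemma ϑ_leftUnitor : (unit A).ϑ M ≫ (leftUnitor M).hom.hom = M.l := ϑ_leftUnitorHom M

/-- The right unitor is induced by the right action. -/
noncomputable def rightUnitorHom : M.tensor (unit C) ⟶ M :=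
  descHom (T := M) M.r (by rw [Balanced, M.r_assoc, Iso.hom_inv_id_assoc])
    (by rw [M.l_r, Iso.inv_hom_id_assoc]) (by rw [M.r_assoc, Iso.hom_inv_id_assoc])

lemma ϑ_rightUnitorHom : M.ϑ (unit C) ≫ (rightUnitorHom M).hom = M.r := ϑ_descHom _ _ _ _

/-- The right unitor of bimodules. -/
noncomputable def rightUnitor : M.tensor (unit C) ≅ M :=
  isoOfHom (rightUnitorHom M) ((ρ_ M.X).inv ≫ M.X ◁ C.one ≫ M.ϑ (unit C))
    (by
      rw [← cancel_epi (M.ϑ (unit C)), reassoc_of% ϑ_rightUnitorHom M]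
      calc _ = (ρ_ _).inv ≫ (M.r ▷ 𝟙 b ≫ M.X ◁ C.one) ≫ M.ϑ (unit C) := by bicategory
        _ = (ρ_ _).inv ≫ (M.X ≫ C.X) ◁ C.one ≫ M.r ▷ (unit C).X ≫ M.ϑ (unit C) := by
          rw [← whisker_exchange]; simp only [Category.assoc]
        _ = 𝟙 _ ⊗≫ M.X ◁ (C.X ◁ C.one ≫ C.mul) ≫ M.ϑ (unit C) := by
          rw [ϑ_balanced]; bicategory
        _ = _ := by rw [C.mul_one]; bicategory)
    (by
      rw [Category.assoc, Category.assoc, ϑ_rightUnitorHom, M.r_one]; simp)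

@[simp]
lemma ϑ_rightUnitor : M.ϑ (unit C) ≫ (rightUnitor M).hom.hom = M.r := ϑ_rightUnitorHom M

/-- The 2-morphism that induces the associator. -/
noncomputable def assocAux : (M.tensor N).X ≫ P.X ⟶ (M.tensor (N.tensor P)).X :=
  M.ξ N ▷ P.X ≫ (α_ _ _ _).hom ≫ M.X ◁ N.ϑ P ≫ M.ϑ (N.tensor P)

lemma ϑ_assocAux : M.ϑ N ▷ P.X ≫ assocAux M N P =
    (α_ _ _ _).hom ≫ M.X ◁ N.ϑ P ≫ M.ϑ (N.tensor P) := by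
  rw [assocAux, ← comp_whiskerRight_assoc, ϑ_ξ]
  calc _ = 𝟙 _ ⊗≫ M.coact ▷ N.X ▷ P.X ⊗≫ M.X ◁ (N.l ▷ P.X ≫ N.ϑ P) ≫ M.ϑ (N.tensor P) := by
        rw [proj]; bicategory
    _ = 𝟙 _ ⊗≫ M.coact ▷ N.X ▷ P.X ⊗≫ M.X ◁ (C.X ◁ N.ϑ P) ≫
          M.X ◁ (N.tensor P).l ≫ M.ϑ (N.tensor P) := by
        rw [ϑ_l']; bicategory
    _ = 𝟙 _ ⊗≫ (M.coact ▷ (N.X ≫ P.X) ≫ (M.X ≫ C.X) ◁ N.ϑ P) ≫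
          M.r ▷ (N.tensor P).X ≫ M.ϑ (N.tensor P) := by
        rw [ϑ_balanced']; bicategory
    _ = 𝟙 _ ⊗≫ M.X ◁ N.ϑ P ≫ (M.coact ≫ M.r) ▷ (N.tensor P).X ≫ M.ϑ (N.tensor P) := by
        rw [← whisker_exchange]; bicategory
    _ = _ := by
        rw [coact_r]; bicategory

/-- The associator as a bimodule map. -/
noncomputable def assocHom : (M.tensor N).tensor P ⟶ M.tensor (N.tensor P) :=
  descHom (T := M.tensor (N.tensor P)) (assocAux M N P)
    (by
      rw [Balanced, ← cancel_epi (M.ϑ N ▷ E.X ▷ P.X)]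
      calc _ = (M.ϑ N ▷ E.X ≫ (M.tensor N).r) ▷ P.X ≫ assocAux M N P := by bicategory
        _ = 𝟙 _ ⊗≫ M.X ◁ N.r ▷ P.X ⊗≫ (M.ϑ N ▷ P.X ≫ assocAux M N P) := by
          rw [ϑ_r]; bicategory
        _ = 𝟙 _ ⊗≫ M.X ◁ (N.r ▷ P.X ≫ N.ϑ P) ≫ M.ϑ (N.tensor P) := by
          rw [ϑ_assocAux]; bicategory
        _ = 𝟙 _ ⊗≫ M.X ◁ N.X ◁ P.l ⊗≫
            ((α_ _ _ _).hom ≫ M.X ◁ N.ϑ P ≫ M.ϑ (N.tensor P)) := by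
          rw [ϑ_balanced]; bicategory
        _ = 𝟙 _ ⊗≫ ((M.X ≫ N.X) ◁ P.l ≫ M.ϑ N ▷ P.X) ≫ assocAux M N P := by
          rw [← ϑ_assocAux]; bicategory
        _ = _ := by rw [whisker_exchange]; bicategory)
    (by
      rw [← cancel_epi (A.X ◁ (M.ϑ N ▷ P.X))]
      calc _ = A.X ◁ (M.ϑ N ▷ P.X ≫ assocAux M N P) ≫ (M.tensor (N.tensor P)).l := by bicategory
        _ = 𝟙 _ ⊗≫ A.X ◁ M.X ◁ N.ϑ P ≫
            (A.X ◁ M.ϑ (N.tensor P) ≫ (M.tensor (N.tensor P)).l) := by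
          rw [ϑ_assocAux]; bicategory
        _ = 𝟙 _ ⊗≫ ((A.X ≫ M.X) ◁ N.ϑ P ≫ M.l ▷ (N.tensor P).X) ≫ M.ϑ (N.tensor P) := by
          rw [ϑ_l]; bicategory
        _ = 𝟙 _ ⊗≫ M.l ▷ N.X ▷ P.X ⊗≫
            ((α_ _ _ _).hom ≫ M.X ◁ N.ϑ P ≫ M.ϑ (N.tensor P)) := by
          rw [whisker_exchange]; bicategory
        _ = 𝟙 _ ⊗≫ (M.l ▷ N.X ≫ M.ϑ N) ▷ P.X ≫ assocAux M N P := by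
          rw [← ϑ_assocAux]; bicategory
        _ = _ := by rw [ϑ_l']; bicategory)
    (by
      rw [← cancel_epi (M.ϑ N ▷ P.X ▷ G.X)]
      calc _ = (M.ϑ N ▷ P.X ≫ assocAux M N P) ▷ G.X ≫ (M.tensor (N.tensor P)).r := by bicategory
        _ = 𝟙 _ ⊗≫ (M.X ◁ N.ϑ P) ▷ G.X ⊗≫
            (M.ϑ (N.tensor P) ▷ G.X ≫ (M.tensor (N.tensor P)).r) := by
          rw [ϑ_assocAux]; bicategory
        _ = 𝟙 _ ⊗≫ M.X ◁ (N.ϑ P ▷ G.X ≫ (N.tensor P).r) ≫ M.ϑ (N.tensor P) := by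
          rw [ϑ_r]; bicategory
        _ = 𝟙 _ ⊗≫ M.X ◁ N.X ◁ P.r ⊗≫
            ((α_ _ _ _).hom ≫ M.X ◁ N.ϑ P ≫ M.ϑ (N.tensor P)) := by
          rw [ϑ_r N P]; bicategory
        _ = 𝟙 _ ⊗≫ ((M.X ≫ N.X) ◁ P.r ≫ M.ϑ N ▷ P.X) ≫ assocAux M N P := by
          rw [← ϑ_assocAux]; bicategory
        _ = _ := by rw [whisker_exchange]; bicategory)

lemma ϑ_assocHom : (M.tensor N).ϑ P ≫ (assocHom M N P).hom = assocAux M N P := ϑ_descHom _ _ _ _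

/-- The 2-morphism that induces the inverse of the associator. -/
noncomputable def assocInvAux : M.X ≫ (N.tensor P).X ⟶ ((M.tensor N).tensor P).X :=
  M.X ◁ N.ξ P ≫ (α_ _ _ _).inv ≫ M.ϑ N ▷ P.X ≫ (M.tensor N).ϑ P

lemma ϑ_assocInvAux : M.X ◁ N.ϑ P ≫ assocInvAux M N P =
    (α_ _ _ _).inv ≫ M.ϑ N ▷ P.X ≫ (M.tensor N).ϑ P := by
  rw [assocInvAux, ← whiskerLeft_comp_assoc, ϑ_ξ]
  calc _ = 𝟙 _ ⊗≫ M.X ◁ N.coact ▷ P.X ⊗≫ ((M.X ≫ N.X) ◁ P.l ≫ M.ϑ N ▷ P.X) ≫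
            (M.tensor N).ϑ P := by
        rw [proj]; bicategory
    _ = 𝟙 _ ⊗≫ M.X ◁ N.coact ▷ P.X ⊗≫ M.ϑ N ▷ (E.X ≫ P.X) ≫
          ((M.tensor N).X ◁ P.l ≫ (M.tensor N).ϑ P) := by
        rw [whisker_exchange]; bicategory
    _ = 𝟙 _ ⊗≫ M.X ◁ N.coact ▷ P.X ⊗≫ (M.ϑ N ▷ E.X ≫ (M.tensor N).r) ▷ P.X ≫
          (M.tensor N).ϑ P := by
        rw [ϑ_balanced']; bicategory
    _ = 𝟙 _ ⊗≫ M.X ◁ (N.coact ≫ N.r) ▷ P.X ⊗≫ M.ϑ N ▷ P.X ≫ (M.tensor N).ϑ P := by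
        rw [ϑ_r]; bicategory
    _ = _ := by
        rw [coact_r]; bicategory

lemma assocInvAux_balanced : M.Balanced (N.tensor P) (assocInvAux M N P) := by
  rw [Balanced, ← cancel_epi ((M.X ≫ C.X) ◁ N.ϑ P)]
  calc _ = ((M.X ≫ C.X) ◁ N.ϑ P ≫ M.r ▷ (N.tensor P).X) ≫ assocInvAux M N P := by bicategory
    _ = M.r ▷ (N.X ≫ P.X) ≫ (M.X ◁ N.ϑ P ≫ assocInvAux M N P) := by
      rw [whisker_exchange]; bicategory
    _ = 𝟙 _ ⊗≫ (M.r ▷ N.X ≫ M.ϑ N) ▷ P.X ≫ (M.tensor N).ϑ P := by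
      rw [ϑ_assocInvAux]; bicategory
    _ = 𝟙 _ ⊗≫ M.X ◁ N.l ▷ P.X ⊗≫ ((α_ _ _ _).inv ≫ M.ϑ N ▷ P.X ≫ (M.tensor N).ϑ P) := by
      rw [ϑ_balanced]; bicategory
    _ = 𝟙 _ ⊗≫ M.X ◁ (N.l ▷ P.X ≫ N.ϑ P) ≫ assocInvAux M N P := by
      rw [← ϑ_assocInvAux]; bicategory
    _ = _ := by
      rw [ϑ_l']; bicategory

/-- The associator of bimodules, induced by the associator of the bicategory. -/
noncomputable def associator : (M.tensor N).tensor P ≅ M.tensor (N.tensor P) :=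
  isoOfHom (assocHom M N P) (M.desc (N.tensor P) (assocInvAux M N P))
    (by
      rw [← cancel_epi ((M.tensor N).ϑ P), reassoc_of% ϑ_assocHom M N P,
        ← cancel_epi (M.ϑ N ▷ P.X), reassoc_of% ϑ_assocAux M N P,
        M.ϑ_desc _ _ (assocInvAux_balanced M N P), ϑ_assocInvAux]
      simp)
    (by
      rw [← cancel_epi (M.ϑ (N.tensor P)), reassoc_of% M.ϑ_desc _ _ (assocInvAux_balanced M N P),
        ← cancel_epi (M.X ◁ N.ϑ P), reassoc_of% ϑ_assocInvAux M N P, ϑ_assocHom, ϑ_assocAux]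
      simp)

lemma ϑ_associator : M.ϑ N ▷ P.X ≫ (M.tensor N).ϑ P ≫ (associator M N P).hom.hom =
    (α_ _ _ _).hom ≫ M.X ◁ N.ϑ P ≫ M.ϑ (N.tensor P) := by
  rw [← ϑ_assocAux, ← ϑ_assocHom]; rfl

lemma ϑ_associator_inv : M.X ◁ N.ϑ P ≫ M.ϑ (N.tensor P) ≫ (associator M N P).inv.hom =
    (α_ _ _ _).inv ≫ M.ϑ N ▷ P.X ≫ (M.tensor N).ϑ P := by
  rw [← ϑ_assocInvAux, ← M.ϑ_desc _ _ (assocInvAux_balanced M N P)]; rfl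

end
end Bimodule
end Tensor

section Tensor

variable {B : Type u} [Bicategory.{w, v} B]

namespace Bimodule

variable {a b c d e : B} {A : SepFrobAlg a} {C : SepFrobAlg b} {E : SepFrobAlg c}
  {G : SepFrobAlg d} {K : SepFrobAlg e}
  {M : Bimodule A C} {N : Bimodule C E} {P : Bimodule E G} {Q : Bimodule G K}
  {M' M'' : Bimodule A C} {N' N'' : Bimodule C E}

variable [LocallyIdempotentComplete B]

section Axioms

@[simp]
lemma ϑ_whiskerL_assoc (M : Bimodule A C) {N N' : Bimodule C E} (f : N ⟶ N') {Z : a ⟶ c}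
    (h : (M.tensor N').X ⟶ Z) :
    M.ϑ N ≫ (M.whiskerL f).hom ≫ h = M.X ◁ f.hom ≫ M.ϑ N' ≫ h := by
  rw [reassoc_of% ϑ_whiskerL M f]

@[simp]
lemma ϑ_whiskerR_assoc {M M' : Bimodule A C} (f : M ⟶ M') (N : Bimodule C E) {Z : a ⟶ c}
    (h : (M'.tensor N).X ⟶ Z) :
    M.ϑ N ≫ (whiskerR f N).hom ≫ h = f.hom ▷ N.X ≫ M'.ϑ N ≫ h := by
  rw [reassoc_of% ϑ_whiskerR f N]

variable (M N P) in
lemma ϑ_associator_assoc {Z : a ⟶ d} (h : (M.tensor (N.tensor P)).X ⟶ Z) :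
    M.ϑ N ▷ P.X ≫ (M.tensor N).ϑ P ≫ (associator M N P).hom.hom ≫ h =
    (α_ _ _ _).hom ≫ M.X ◁ N.ϑ P ≫ M.ϑ (N.tensor P) ≫ h := by
  rw [reassoc_of% ϑ_associator M N P]

variable (M N P) in
lemma ϑ_associator_inv_assoc {Z : a ⟶ d} (h : ((M.tensor N).tensor P).X ⟶ Z) :
    M.X ◁ N.ϑ P ≫ M.ϑ (N.tensor P) ≫ (associator M N P).inv.hom ≫ h =
    (α_ _ _ _).inv ≫ M.ϑ N ▷ P.X ≫ (M.tensor N).ϑ P ≫ h := by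
  rw [reassoc_of% ϑ_associator_inv M N P]

lemma tensor_hom_ext₁ {T : Bimodule A G} {f g : (M.tensor N).tensor P ⟶ T}
    (h : M.ϑ N ▷ P.X ≫ (M.tensor N).ϑ P ≫ f.hom = M.ϑ N ▷ P.X ≫ (M.tensor N).ϑ P ≫ g.hom) :
    f = g :=
  tensor_hom_ext ((cancel_epi (M.ϑ N ▷ P.X)).1 h)

lemma tensor_hom_ext₂ {T : Bimodule A G} {f g : M.tensor (N.tensor P) ⟶ T}
    (h : M.X ◁ N.ϑ P ≫ M.ϑ (N.tensor P) ≫ f.hom = M.X ◁ N.ϑ P ≫ M.ϑ (N.tensor P) ≫ g.hom) :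
    f = g :=
  tensor_hom_ext ((cancel_epi (M.X ◁ N.ϑ P)).1 h)

variable (M N P Q)

lemma whiskerL_id : M.whiskerL (𝟙 N) = 𝟙 _ := tensor_hom_ext (by simp)

lemma id_whiskerR : whiskerR (𝟙 M) N = 𝟙 _ := tensor_hom_ext (by simp)

variable {N} in
lemma whiskerL_comp (f : N ⟶ N') (g : N' ⟶ N'') :
    M.whiskerL (f ≫ g) = M.whiskerL f ≫ M.whiskerL g := tensor_hom_ext (by simp)

variable {M} in
lemma comp_whiskerR (f : M ⟶ M') (g : M' ⟶ M'') :
    whiskerR (f ≫ g) N = whiskerR f N ≫ whiskerR g N := tensor_hom_ext (by simp)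

lemma id_whiskerL (f : M ⟶ M') :
    (unit A).whiskerL f = (leftUnitor M).hom ≫ f ≫ (leftUnitor M').inv := by
  rw [← Category.assoc, Iso.eq_comp_inv]
  exact tensor_hom_ext (by simp [f.l_hom, reassoc_of% ϑ_leftUnitor M])

lemma whiskerR_id (f : M ⟶ M') :
    whiskerR f (unit C) = (rightUnitor M).hom ≫ f ≫ (rightUnitor M').inv := by
  rw [← Category.assoc, Iso.eq_comp_inv]
  exact tensor_hom_ext (by simp [f.r_hom, reassoc_of% ϑ_rightUnitor M])

variable {P} {P' : Bimodule E G} in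
lemma tensor_whiskerL (f : P ⟶ P') :
    (M.tensor N).whiskerL f =
      (associator M N P).hom ≫ M.whiskerL (N.whiskerL f) ≫ (associator M N P').inv := by
  rw [← Category.assoc, Iso.eq_comp_inv]
  apply tensor_hom_ext₁
  simp only [comp_hom', ϑ_whiskerL_assoc, ϑ_associator_assoc, ϑ_whiskerL]
  rw [← whisker_exchange_assoc, ϑ_associator, ← whiskerLeft_comp_assoc, ϑ_whiskerL]
  bicategory

variable {M} in
lemma whiskerR_tensor (f : M ⟶ M') :
    whiskerR f (N.tensor P) =
      (associator M N P).inv ≫ whiskerR (whiskerR f N) P ≫ (associator M' N P).hom := by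
  rw [Iso.eq_inv_comp]
  apply tensor_hom_ext₁
  simp only [comp_hom', ϑ_whiskerR_assoc, ϑ_associator_assoc, ϑ_whiskerR]
  rw [← comp_whiskerRight_assoc, ϑ_whiskerR, comp_whiskerRight_assoc, ϑ_associator,
    whisker_exchange_assoc]
  bicategory

variable {N} in
lemma whisker_assoc' (f : N ⟶ N') :
    whiskerR (M.whiskerL f) P =
      (associator M N P).hom ≫ M.whiskerL (whiskerR f P) ≫ (associator M N' P).inv := by
  rw [← Category.assoc, Iso.eq_comp_inv]
  apply tensor_hom_ext₁
  simp only [comp_hom', ϑ_whiskerR_assoc, ϑ_associator_assoc, ϑ_whiskerL]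
  rw [← comp_whiskerRight_assoc, ϑ_whiskerL, comp_whiskerRight_assoc, ϑ_associator,
    ← whiskerLeft_comp_assoc, ϑ_whiskerR]
  bicategory

variable {M N} in
lemma whisker_exchange' (f : M ⟶ M') (g : N ⟶ N') :
    M.whiskerL g ≫ whiskerR f N' = whiskerR f N ≫ M'.whiskerL g := by
  apply tensor_hom_ext
  simp only [comp_hom', ϑ_whiskerL_assoc, ϑ_whiskerR_assoc, ϑ_whiskerL, ϑ_whiskerR]
  rw [whisker_exchange_assoc]

lemma triangle' : (associator M (unit C) N).hom ≫ M.whiskerL (leftUnitor N).hom =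
    whiskerR (rightUnitor M).hom N := by
  apply tensor_hom_ext₁
  simp only [comp_hom', ϑ_associator_assoc, ϑ_whiskerL, ϑ_whiskerR]
  rw [← whiskerLeft_comp_assoc, ϑ_leftUnitor, ← comp_whiskerRight_assoc, ϑ_rightUnitor,
    ϑ_balanced]

lemma pentagon' : whiskerR (associator M N P).hom Q ≫ (associator M (N.tensor P) Q).hom ≫
    M.whiskerL (associator N P Q).hom =
      (associator (M.tensor N) P Q).hom ≫ (associator M N (P.tensor Q)).hom := by
  apply tensor_hom_ext₁
  rw [← cancel_epi (M.ϑ N ▷ P.X ▷ Q.X)]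
  simp only [comp_hom', ϑ_associator_assoc, ϑ_whiskerR_assoc]
  calc _ = (M.ϑ N ▷ P.X ≫ (M.tensor N).ϑ P ≫ (associator M N P).hom.hom) ▷ Q.X ≫
          (M.tensor (N.tensor P)).ϑ Q ≫ (associator M (N.tensor P) Q).hom.hom ≫
            (M.whiskerL (associator N P Q).hom).hom := by bicategory
    _ = 𝟙 _ ⊗≫ M.X ◁ (N.ϑ P ▷ Q.X) ⊗≫ (M.ϑ (N.tensor P) ▷ Q.X ≫
          (M.tensor (N.tensor P)).ϑ Q ≫ (associator M (N.tensor P) Q).hom.hom) ≫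
            (M.whiskerL (associator N P Q).hom).hom := by rw [ϑ_associator]; bicategory
    _ = 𝟙 _ ⊗≫ M.X ◁ (N.ϑ P ▷ Q.X ≫ (N.tensor P).ϑ Q) ≫ (M.ϑ ((N.tensor P).tensor Q) ≫
            (M.whiskerL (associator N P Q).hom).hom) := by
      rw [ϑ_associator]; bicategory
    _ = 𝟙 _ ⊗≫ M.X ◁ (N.ϑ P ▷ Q.X ≫ (N.tensor P).ϑ Q ≫ (associator N P Q).hom.hom) ≫
          M.ϑ (N.tensor (P.tensor Q)) := by
      rw [ϑ_whiskerL]; bicategory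
    _ = 𝟙 _ ⊗≫ M.X ◁ N.X ◁ P.ϑ Q ⊗≫ ((α_ _ _ _).hom ≫ M.X ◁ (N.ϑ (P.tensor Q)) ≫
          M.ϑ (N.tensor (P.tensor Q))) := by
      rw [ϑ_associator]; bicategory
    _ = 𝟙 _ ⊗≫ ((M.X ≫ N.X) ◁ P.ϑ Q ≫ M.ϑ N ▷ (P.tensor Q).X) ≫
          (M.tensor N).ϑ (P.tensor Q) ≫ (associator M N (P.tensor Q)).hom.hom := by
      rw [← ϑ_associator]; bicategory
    _ = _ := by
      rw [whisker_exchange]; bicategory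

end Axioms

end Bimodule
end Tensor

section Eq

/-- The equivariant completion: objects are pairs of an object and a separable Frobenius algebra on
it, 1-morphisms are bimodules, 2-morphisms are bimodule maps, and composition is the relative
tensor product (see the two instances below). -/
structure EqCompletion (B : Type u) [Bicategory.{w, v} B] where
  pt : B
  alg : SepFrobAlg pt

variable {B : Type u} [Bicategory.{w, v} B] [LocallyIdempotentComplete B]

open Bimodule

noncomputable instance : CategoryStruct (EqCompletion B) where
  Hom x y := Bimodule x.alg y.alg
  id x := unit x.alg
  comp M N := M.tensor N

noncomputable instance : Bicategory (EqCompletion B) where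
  homCategory x y := inferInstanceAs (Category (Bimodule x.alg y.alg))
  whiskerLeft M _ _ f := Bimodule.whiskerL M f
  whiskerRight f N := Bimodule.whiskerR f N
  associator M N P := Bimodule.associator M N P
  leftUnitor M := Bimodule.leftUnitor M
  rightUnitor M := Bimodule.rightUnitor M
  whiskerLeft_id M N := Bimodule.whiskerL_id M N
  whiskerLeft_comp M _ _ _ f g := Bimodule.whiskerL_comp M f g
  id_whiskerLeft f := Bimodule.id_whiskerL _ f
  comp_whiskerLeft M N _ _ f := Bimodule.tensor_whiskerL M N f
  id_whiskerRight M N := Bimodule.id_whiskerR M N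
  comp_whiskerRight f g N := Bimodule.comp_whiskerR N f g
  whiskerRight_id f := Bimodule.whiskerR_id _ f
  whiskerRight_comp f N P := Bimodule.whiskerR_tensor N P f
  whisker_assoc M _ _ f P := Bimodule.whisker_assoc' M P f
  whisker_exchange f g := Bimodule.whisker_exchange' f g
  pentagon M N P Q := Bimodule.pentagon' M N P Q
  triangle M N := Bimodule.triangle' M N

section Idem

variable {a b : B} {A : SepFrobAlg a} {C : SepFrobAlg b}

/-- The bimodule structure on the image of an idempotent bimodule map. -/
def Bimodule.retract (M : Bimodule A C) {Y : a ⟶ b} (i : Y ⟶ M.X) (q : M.X ⟶ Y)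
    (hiq : i ≫ q = 𝟙 Y) (hl : A.X ◁ (q ≫ i) ≫ M.l = M.l ≫ q ≫ i)
    (hr : (q ≫ i) ▷ C.X ≫ M.r = M.r ≫ q ≫ i) : Bimodule A C :=
  have : IsSplitMono i := ⟨⟨q, hiq⟩⟩
  have hl' : (A.X ◁ i ≫ M.l ≫ q) ≫ i = A.X ◁ i ≫ M.l := by
    rw [Category.assoc, Category.assoc, ← hl, ← whiskerLeft_comp_assoc, reassoc_of% hiq]
  have hr' : (i ▷ C.X ≫ M.r ≫ q) ≫ i = i ▷ C.X ≫ M.r := by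
    rw [Category.assoc, Category.assoc, ← hr, ← comp_whiskerRight_assoc, reassoc_of% hiq]
  { X := Y
    l := A.X ◁ i ≫ M.l ≫ q
    r := i ▷ C.X ≫ M.r ≫ q
    l_assoc := by
      rw [← cancel_mono i]
      generalize A.X ◁ i ≫ M.l ≫ q = L at hl'
      simp only [Category.assoc, hl']
      rw [← whisker_exchange_assoc, M.l_assoc, ← whiskerLeft_comp_assoc, hl']
      bicategory
    one_l := by
      rw [← cancel_mono i]
      generalize A.X ◁ i ≫ M.l ≫ q = L at hl'
      simp only [Category.assoc, hl']
      rw [← whisker_exchange_assoc, M.one_l]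
      bicategory
    r_assoc := by
      rw [← cancel_mono i]
      generalize i ▷ C.X ≫ M.r ≫ q = R at hr'
      simp only [Category.assoc, hr']
      rw [whisker_exchange_assoc, M.r_assoc, ← comp_whiskerRight_assoc, hr']
      bicategory
    r_one := by
      rw [← cancel_mono i]
      generalize i ▷ C.X ≫ M.r ≫ q = R at hr'
      simp only [Category.assoc, hr']
      rw [whisker_exchange_assoc, M.r_one]
      bicategory
    l_r := by
      rw [← cancel_mono i]
      generalize i ▷ C.X ≫ M.r ≫ q = R at hr'
      generalize A.X ◁ i ≫ M.l ≫ q = L at hl'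
      simp only [Category.assoc, hr', hl']
      rw [← comp_whiskerRight_assoc, hl', ← whiskerLeft_comp_assoc, hr', comp_whiskerRight_assoc,
        M.l_r]
      bicategory }

instance : LocallyIdempotentComplete (EqCompletion B) where
  idem x y := ⟨fun (M : Bimodule x.alg y.alg) p hp => by
    have hp' : p.hom ≫ p.hom = p.hom := congrArg Bimodule.Hom.hom hp
    obtain ⟨Y, i, q, hiq, hqi⟩ :=
      (LocallyIdempotentComplete.idem x.pt y.pt).idempotents_split _ _ hp'
    have hl : x.alg.X ◁ (q ≫ i) ≫ M.l = M.l ≫ q ≫ i := by rw [hqi]; exact p.l_hom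
    have hr : (q ≫ i) ▷ y.alg.X ≫ M.r = M.r ≫ q ≫ i := by rw [hqi]; exact p.r_hom
    refine ⟨M.retract i q hiq hl hr, ⟨i, ?_, ?_⟩, ⟨q, ?_, ?_⟩, ?_, ?_⟩
    · dsimp [Bimodule.retract]
      rw [Category.assoc, Category.assoc, ← hl, ← whiskerLeft_comp_assoc, reassoc_of% hiq]
    · dsimp [Bimodule.retract]
      rw [Category.assoc, Category.assoc, ← hr, ← comp_whiskerRight_assoc, reassoc_of% hiq]
    · dsimp [Bimodule.retract]
      rw [← whiskerLeft_comp_assoc, reassoc_of% hl, hiq, Category.comp_id]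
    · dsimp [Bimodule.retract]
      rw [← comp_whiskerRight_assoc, reassoc_of% hr, hiq, Category.comp_id]
    · exact Bimodule.hom_ext hiq
    · exact Bimodule.hom_ext hqi⟩

end Idem

section Embedding

/-- The unit 1-morphism as a separable Frobenius algebra. -/
@[reducible]
def unitAlg {B : Type u} [Bicategory.{w, v} B] (a : B) : SepFrobAlg a where
  X := 𝟙 a
  mul := (λ_ _).hom
  one := 𝟙 _
  comul := (λ_ _).inv
  counit := 𝟙 _
  mul_assoc := by bicategory
  one_mul := by bicategory
  mul_one := by bicategory
  comul_assoc := by bicategory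
  counit_comul := by bicategory
  comul_counit := by bicategory
  frob_left := by bicategory
  frob_right := by bicategory
  separable := by bicategory

/-- Every 1-morphism is a bimodule over the unit algebras. -/
@[reducible]
def unitBimodule {a b : B} (f : a ⟶ b) : Bimodule (unitAlg a) (unitAlg b) where
  X := f
  l := (λ_ _).hom
  r := (ρ_ _).hom
  l_assoc := by bicategory
  one_l := by bicategory
  r_assoc := by bicategory
  r_one := by bicategory
  l_r := by bicategory

/-- Every 2-morphism is a bimodule map over the unit algebras. -/
@[reducible]
def unitBimoduleMap {a b : B} {f g : a ⟶ b} (η : f ⟶ g) : unitBimodule f ⟶ unitBimodule g where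
  hom := η
  l_hom := by bicategory
  r_hom := by bicategory

/-- The tensor product over a unit algebra is the composition of 1-morphisms: the bimodule map. -/
noncomputable def unitBimoduleComp {a b c : B} (f : a ⟶ b) (g : b ⟶ c) :
    (unitBimodule f).tensor (unitBimodule g) ⟶ unitBimodule (f ≫ g) :=
  Bimodule.descHom (M := unitBimodule f) (N := unitBimodule g) (T := unitBimodule (f ≫ g))
    (𝟙 _) (by bicategory) (by bicategory) (by bicategory)

lemma ϑ_unitBimoduleComp {a b c : B} (f : a ⟶ b) (g : b ⟶ c) :
    Bimodule.ϑ (unitBimodule f) (unitBimodule g) ≫ (unitBimoduleComp f g).hom = 𝟙 _ :=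
  Bimodule.ϑ_descHom _ _ _ _

/-- The tensor product over a unit algebra is the composition of 1-morphisms. -/
noncomputable def unitBimoduleCompIso {a b c : B} (f : a ⟶ b) (g : b ⟶ c) :
    (unitBimodule f).tensor (unitBimodule g) ≅ unitBimodule (f ≫ g) :=
  Bimodule.isoOfHom (unitBimoduleComp f g) (Bimodule.ϑ (unitBimodule f) (unitBimodule g))
    (by
      rw [← cancel_epi (Bimodule.ϑ (unitBimodule f) (unitBimodule g)),
        reassoc_of% ϑ_unitBimoduleComp f g, Category.comp_id])
    (ϑ_unitBimoduleComp f g)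

/-- The identity 1-morphism as a bimodule is the unit algebra as a bimodule. -/
def unitBimoduleId (a : B) : unitBimodule (𝟙 a) ≅ Bimodule.unit (unitAlg a) :=
  Bimodule.isoOfHom
    { hom := 𝟙 (𝟙 a)
      l_hom := by bicategory
      r_hom := by bicategory } (𝟙 (𝟙 a)) (Category.comp_id _) (Category.comp_id _)

lemma unitBimoduleComp_map_whiskerL {a b c : B} (f : a ⟶ b) {g h : b ⟶ c} (η : g ⟶ h) :
    unitBimoduleMap (f ◁ η) = (unitBimoduleCompIso f g).inv ≫
      (unitBimodule f).whiskerL (unitBimoduleMap η) ≫ (unitBimoduleCompIso f h).hom := by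
  apply Bimodule.hom_ext
  change _ = Bimodule.ϑ (unitBimodule f) (unitBimodule g) ≫
    ((unitBimodule f).whiskerL (unitBimoduleMap η)).hom ≫ (unitBimoduleComp f h).hom
  rw [Bimodule.ϑ_whiskerL_assoc, ϑ_unitBimoduleComp, Category.comp_id]

lemma unitBimoduleComp_map_whiskerR {a b c : B} {f g : a ⟶ b} (η : f ⟶ g) (h : b ⟶ c) :
    unitBimoduleMap (η ▷ h) = (unitBimoduleCompIso f h).inv ≫
      Bimodule.whiskerR (unitBimoduleMap η) (unitBimodule h) ≫ (unitBimoduleCompIso g h).hom := by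
  apply Bimodule.hom_ext
  change _ = Bimodule.ϑ (unitBimodule f) (unitBimodule h) ≫
    (Bimodule.whiskerR (unitBimoduleMap η) (unitBimodule h)).hom ≫ (unitBimoduleComp g h).hom
  rw [Bimodule.ϑ_whiskerR_assoc, ϑ_unitBimoduleComp, Category.comp_id]

lemma unitBimoduleComp_associator {a b c d : B} (f : a ⟶ b) (g : b ⟶ c) (h : c ⟶ d) :
    unitBimoduleMap (α_ f g h).hom = (unitBimoduleCompIso (f ≫ g) h).inv ≫
      Bimodule.whiskerR (unitBimoduleCompIso f g).inv (unitBimodule h) ≫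
      (Bimodule.associator (unitBimodule f) (unitBimodule g) (unitBimodule h)).hom ≫
      (unitBimodule f).whiskerL (unitBimoduleCompIso g h).hom ≫
      (unitBimoduleCompIso f (g ≫ h)).hom := by
  apply Bimodule.hom_ext
  change _ = Bimodule.ϑ (unitBimodule (f ≫ g)) (unitBimodule h) ≫
    (Bimodule.whiskerR (unitBimoduleCompIso f g).inv (unitBimodule h)).hom ≫
    (Bimodule.associator (unitBimodule f) (unitBimodule g) (unitBimodule h)).hom.hom ≫
    ((unitBimodule f).whiskerL (unitBimoduleCompIso g h).hom).hom ≫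
    (unitBimoduleComp f (g ≫ h)).hom
  rw [Bimodule.ϑ_whiskerR_assoc]
  refine Eq.trans ?_ (Bimodule.ϑ_associator_assoc (unitBimodule f) (unitBimodule g)
    (unitBimodule h) _).symm
  rw [Bimodule.ϑ_whiskerL_assoc, ϑ_unitBimoduleComp, Category.comp_id]
  change _ = _ ≫ f ◁ Bimodule.ϑ (unitBimodule g) (unitBimodule h) ≫
    f ◁ (unitBimoduleComp g h).hom
  rw [← whiskerLeft_comp, ϑ_unitBimoduleComp]
  simp

lemma unitBimoduleComp_leftUnitor {a b : B} (f : a ⟶ b) :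
    unitBimoduleMap (λ_ f).hom = (unitBimoduleCompIso (𝟙 a) f).inv ≫
      Bimodule.whiskerR (unitBimoduleId a).hom (unitBimodule f) ≫
        (Bimodule.leftUnitor (unitBimodule f)).hom := by
  apply Bimodule.hom_ext
  change _ = Bimodule.ϑ (unitBimodule (𝟙 a)) (unitBimodule f) ≫
    (Bimodule.whiskerR (unitBimoduleId a).hom (unitBimodule f)).hom ≫
      (Bimodule.leftUnitor (unitBimodule f)).hom.hom
  rw [Bimodule.ϑ_whiskerR_assoc, Bimodule.ϑ_leftUnitor]
  change _ = 𝟙 _ ▷ f ≫ (λ_ f).hom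
  simp

lemma unitBimoduleComp_rightUnitor {a b : B} (f : a ⟶ b) :
    unitBimoduleMap (ρ_ f).hom = (unitBimoduleCompIso f (𝟙 b)).inv ≫
      (unitBimodule f).whiskerL (unitBimoduleId b).hom ≫
        (Bimodule.rightUnitor (unitBimodule f)).hom := by
  apply Bimodule.hom_ext
  change _ = Bimodule.ϑ (unitBimodule f) (unitBimodule (𝟙 b)) ≫
    ((unitBimodule f).whiskerL (unitBimoduleId b).hom).hom ≫
      (Bimodule.rightUnitor (unitBimodule f)).hom.hom
  rw [Bimodule.ϑ_whiskerL_assoc, Bimodule.ϑ_rightUnitor]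
  change _ = f ◁ 𝟙 _ ≫ (ρ_ f).hom
  simp

/-- The embedding of `B` in its equivariant completion: `a` is sent to `(a, 𝟙 a)`. -/
noncomputable def EqCompletion.embedding (B : Type u) [Bicategory.{w, v} B]
    [LocallyIdempotentComplete B] : B ⥤ᵖ EqCompletion B where
  obj a := ⟨a, unitAlg a⟩
  map f := unitBimodule f
  map₂ η := unitBimoduleMap η
  map₂_id _ := rfl
  map₂_comp _ _ := rfl
  mapId a := unitBimoduleId a
  mapComp f g := (unitBimoduleCompIso f g).symm
  map₂_whisker_left f _ _ η := unitBimoduleComp_map_whiskerL f η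
  map₂_whisker_right η h := unitBimoduleComp_map_whiskerR η h
  map₂_associator f g h := unitBimoduleComp_associator f g h
  map₂_left_unitor f := unitBimoduleComp_leftUnitor f
  map₂_right_unitor f := unitBimoduleComp_rightUnitor f

end Embedding
end Eq

section Mates

variable {B : Type u} [Bicategory.{w, v} B] {a b : B}

section
variable {l₁ l₂ : a ⟶ b} {r₁ r₂ : b ⟶ a} (adj₁ : l₁ ⊣ r₁) (adj₂ : l₂ ⊣ r₂)

lemma conj_counit (φ : l₂ ⟶ l₁) :
    conjugateEquiv adj₁ adj₂ φ ▷ l₂ ≫ adj₂.counit = r₁ ◁ φ ≫ adj₁.counit := by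
  rw [conjugateEquiv_apply']
  calc _ = 𝟙 _ ⊗≫ r₁ ◁ adj₂.unit ▷ l₂ ⊗≫ r₁ ◁ (φ ▷ (r₂ ≫ l₂)) ⊗≫
        (adj₁.counit ▷ (r₂ ≫ l₂) ≫ 𝟙 _ ◁ adj₂.counit) ⊗≫ 𝟙 _ := by bicategory
    _ = 𝟙 _ ⊗≫ r₁ ◁ adj₂.unit ▷ l₂ ⊗≫ r₁ ◁ (φ ▷ (r₂ ≫ l₂) ≫ l₁ ◁ adj₂.counit) ⊗≫
        adj₁.counit ⊗≫ 𝟙 _ := by rw [← whisker_exchange]; bicategory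
    _ = 𝟙 _ ⊗≫ r₁ ◁ leftZigzag adj₂.unit adj₂.counit ⊗≫ r₁ ◁ φ ⊗≫ adj₁.counit := by
      rw [← whisker_exchange]; bicategory
    _ = _ := by rw [adj₂.left_triangle]; bicategory

lemma conj_unit (φ : l₂ ⟶ l₁) :
    adj₁.unit ≫ l₁ ◁ conjugateEquiv adj₁ adj₂ φ = adj₂.unit ≫ φ ▷ r₂ := by
  rw [conjugateEquiv_apply']
  calc _ = 𝟙 _ ⊗≫ (adj₁.unit ▷ 𝟙 _ ≫ (l₁ ≫ r₁) ◁ (adj₂.unit ≫ φ ▷ r₂)) ⊗≫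
        l₁ ◁ adj₁.counit ▷ r₂ ⊗≫ 𝟙 _ := by bicategory
    _ = adj₂.unit ≫ φ ▷ r₂ ⊗≫ leftZigzag adj₁.unit adj₁.counit ▷ r₂ ⊗≫ 𝟙 _ := by
      rw [← whisker_exchange]; bicategory
    _ = _ := by rw [adj₁.left_triangle]; bicategory

lemma conj_symm_counit (ψ : r₁ ⟶ r₂) :
    ψ ▷ l₂ ≫ adj₂.counit = r₁ ◁ (conjugateEquiv adj₁ adj₂).symm ψ ≫ adj₁.counit := by
  rw [← conj_counit, Equiv.apply_symm_apply]

lemma conj_symm_unit (ψ : r₁ ⟶ r₂) :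
    adj₁.unit ≫ l₁ ◁ ψ = adj₂.unit ≫ (conjugateEquiv adj₁ adj₂).symm ψ ▷ r₂ := by
  rw [← conj_unit, Equiv.apply_symm_apply]
end

section
variable {l : a ⟶ b} {r : b ⟶ a} (adj : l ⊣ r)

lemma eq_of_counit_right {f : b ⟶ a} (φ : f ⟶ r) :
    (ρ_ f).inv ≫ f ◁ adj.unit ≫ (α_ _ _ _).inv ≫ (φ ▷ l ≫ adj.counit) ▷ r ≫ (λ_ r).hom = φ := by
  calc _ = 𝟙 _ ⊗≫ (f ◁ adj.unit ≫ φ ▷ (l ≫ r)) ⊗≫ adj.counit ▷ r ⊗≫ 𝟙 _ := by bicategory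
    _ = 𝟙 _ ⊗≫ φ ⊗≫ rightZigzag adj.unit adj.counit ⊗≫ 𝟙 _ := by
      rw [whisker_exchange]; bicategory
    _ = _ := by rw [adj.right_triangle]; bicategory

lemma eq_of_counit_left {f : a ⟶ b} (φ : f ⟶ l) :
    (λ_ f).inv ≫ adj.unit ▷ f ≫ (α_ _ _ _).hom ≫ l ◁ (r ◁ φ ≫ adj.counit) ≫ (ρ_ l).hom = φ := by
  calc _ = 𝟙 _ ⊗≫ (adj.unit ▷ f ≫ (l ≫ r) ◁ φ) ⊗≫ l ◁ adj.counit ⊗≫ 𝟙 _ := by bicategory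
    _ = 𝟙 _ ⊗≫ φ ⊗≫ leftZigzag adj.unit adj.counit ⊗≫ 𝟙 _ := by
      rw [← whisker_exchange]; bicategory
    _ = _ := by rw [adj.left_triangle]; bicategory

/-- 2-morphisms into a right adjoint are determined by their composite with the counit. -/
lemma ext_counit_right {f : b ⟶ a} {φ ψ : f ⟶ r}
    (h : φ ▷ l ≫ adj.counit = ψ ▷ l ≫ adj.counit) : φ = ψ := by
  rw [← eq_of_counit_right adj φ, h, eq_of_counit_right adj ψ]

/-- 2-morphisms into a left adjoint are determined by their composite with the counit. -/
lemma ext_counit_left {f : a ⟶ b} {φ ψ : f ⟶ l}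
    (h : r ◁ φ ≫ adj.counit = r ◁ ψ ≫ adj.counit) : φ = ψ := by
  rw [← eq_of_counit_left adj φ, h, eq_of_counit_left adj ψ]

lemma zigzag_left {f : a ⟶ b} (φ : r ≫ f ⟶ 𝟙 b) :
    r ◁ ((λ_ f).inv ≫ adj.unit ▷ f ≫ (α_ _ _ _).hom ≫ l ◁ φ ≫ (ρ_ l).hom) ≫ adj.counit = φ := by
  calc _ = 𝟙 _ ⊗≫ r ◁ adj.unit ▷ f ⊗≫ ((r ≫ l) ◁ φ ≫ adj.counit ▷ 𝟙 b) ⊗≫ 𝟙 _ := by bicategory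
    _ = 𝟙 _ ⊗≫ rightZigzag adj.unit adj.counit ▷ f ⊗≫ φ := by
      rw [whisker_exchange]; bicategory
    _ = _ := by rw [adj.right_triangle]; bicategory

lemma zigzag_right {f : b ⟶ a} (φ : f ≫ l ⟶ 𝟙 b) :
    ((ρ_ f).inv ≫ f ◁ adj.unit ≫ (α_ _ _ _).inv ≫ φ ▷ r ≫ (λ_ r).hom) ▷ l ≫ adj.counit = φ := by
  calc _ = 𝟙 _ ⊗≫ f ◁ adj.unit ▷ l ⊗≫ (φ ▷ (r ≫ l) ≫ 𝟙 b ◁ adj.counit) ⊗≫ 𝟙 _ := by bicategory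
    _ = 𝟙 _ ⊗≫ f ◁ leftZigzag adj.unit adj.counit ⊗≫ φ := by
      rw [← whisker_exchange]; bicategory
    _ = _ := by rw [adj.left_triangle]; bicategory

lemma compCounit_eq {c : B} {f₁ : a ⟶ b} {g₁ : b ⟶ a} {f₂ : b ⟶ c} {g₂ : c ⟶ b}
    (adj₁ : f₁ ⊣ g₁) (adj₂ : f₂ ⊣ g₂) : (adj₁.comp adj₂).counit =
    (α_ g₂ g₁ (f₁ ≫ f₂)).hom ≫ g₂ ◁ ((α_ g₁ f₁ f₂).inv ≫ adj₁.counit ▷ f₂ ≫ (λ_ f₂).hom) ≫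
      adj₂.counit := by
  rw [Bicategory.Adjunction.comp_counit, Bicategory.Adjunction.compCounit]
  bicategory
end

end Mates

section PivotalDef

/-- A pivotal structure: for every 1-morphism `f` a 1-morphism `dag f` which is at the same time a
right adjoint (`radj`) and a left adjoint (`ladj`) of `f`, such that the chosen adjunctions satisfy:
* `dag_map`: the two conjugates `dag g ⟶ dag f` of every 2-morphism `φ : f ⟶ g`, taken with the
  right and with the left adjunctions, coincide;
* `dag_comp`: the two canonical 2-morphisms `dag (f ≫ g) ⟶ dag g ≫ dag f`, formed with the right
  and with the left adjunctions, coincide. -/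
class Pivotal (B : Type u) [Bicategory.{w, v} B] where
  dag {a b : B} (f : a ⟶ b) : b ⟶ a
  radj {a b : B} (f : a ⟶ b) : f ⊣ dag f
  ladj {a b : B} (f : a ⟶ b) : dag f ⊣ f
  dag_map {a b : B} {f g : a ⟶ b} (φ : f ⟶ g) :
    conjugateEquiv (radj g) (radj f) φ = (conjugateEquiv (ladj f) (ladj g)).symm φ
  dag_comp {a b c : B} (f : a ⟶ b) (g : b ⟶ c) :
    conjugateEquiv (radj (f ≫ g)) ((radj f).comp (radj g)) (𝟙 (f ≫ g)) =
      (conjugateEquiv ((ladj g).comp (ladj f)) (ladj (f ≫ g))).symm (𝟙 (f ≫ g))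

open Pivotal

variable {B : Type u} [Bicategory.{w, v} B] [Pivotal B] {a b c : B}

lemma dag_map_comp (f : a ⟶ b) (g : b ⟶ c) {h : a ⟶ c} (φ : f ≫ g ⟶ h) :
    conjugateEquiv (radj h) ((radj f).comp (radj g)) φ =
      (conjugateEquiv ((ladj g).comp (ladj f)) (ladj h)).symm φ := by
  have h₁ := conjugateEquiv_comp (radj h) (radj (f ≫ g)) ((radj f).comp (radj g)) φ (𝟙 _)
  have h₂ := conjugateEquiv_symm_comp ((ladj g).comp (ladj f)) (ladj (f ≫ g)) (ladj h)
    (𝟙 _) φ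
  rw [Category.id_comp] at h₁ h₂
  rw [← h₁, ← h₂, dag_map, dag_comp]

namespace SepFrobAlg

variable (A : SepFrobAlg a)

/-- The pairing "multiply, then apply the counit". -/
def pairing : A.X ≫ A.X ⟶ 𝟙 a := A.mul ≫ A.counit

/-- The copairing "unit, then comultiply". -/
def copairing : 𝟙 a ⟶ A.X ≫ A.X := A.one ≫ A.comul

/-- The map `A ⟶ A†` obtained from the pairing by means of `A†` as a right adjoint of `A`. -/
def toDagRight : A.X ⟶ dag A.X :=
  (ρ_ A.X).inv ≫ A.X ◁ (radj A.X).unit ≫ (α_ _ _ _).inv ≫ A.pairing ▷ dag A.X ≫ (λ_ _).hom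

/-- The map `A ⟶ A†` obtained from the pairing by means of `A†` as a left adjoint of `A`. -/
def toDagLeft : A.X ⟶ dag A.X :=
  (λ_ A.X).inv ≫ (ladj A.X).unit ▷ A.X ≫ (α_ _ _ _).hom ≫ dag A.X ◁ A.pairing ≫ (ρ_ _).hom

/-- A Frobenius algebra is symmetric if the two maps `A ⟶ A†` induced by the pairing agree. -/
def IsSymmetric : Prop := A.toDagRight = A.toDagLeft

end SepFrobAlg

section UnitSymm

variable (a)

lemma unitAlg_isSymmetric : (unitAlg a).IsSymmetric := by
  set u : 𝟙 a ⟶ dag (𝟙 a) := (radj (𝟙 a)).unit ≫ (λ_ _).hom with hu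
  set v : 𝟙 a ⟶ dag (𝟙 a) := (ladj (𝟙 a)).unit ≫ (ρ_ _).hom with hv
  have hu1 : (radj (𝟙 a)).unit = u ≫ (λ_ _).inv := by simp [hu]
  have hv1 : (ladj (𝟙 a)).unit = v ≫ (ρ_ _).inv := by simp [hv]
  have e₁ : (unitAlg a).toDagRight = u := by
    simp only [SepFrobAlg.toDagRight, SepFrobAlg.pairing, hu1]; bicategory
  have e₂ : (unitAlg a).toDagLeft = v := by
    simp only [SepFrobAlg.toDagLeft, SepFrobAlg.pairing, hv1]; bicategory
  rw [SepFrobAlg.IsSymmetric, e₁, e₂]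
  -- both are invertible
  have uiso : IsIso u := by
    have h1 := (radj (𝟙 a)).left_triangle
    have h2 := (radj (𝟙 a)).right_triangle
    refine ⟨(ρ_ _).inv ≫ (radj (𝟙 a)).counit, ?_, ?_⟩
    · calc _ = 𝟙 _ ⊗≫ leftZigzag (radj (𝟙 a)).unit (radj (𝟙 a)).counit ⊗≫ 𝟙 _ := by
            rw [hu]; bicategory
        _ = _ := by rw [h1]; bicategory
    · calc _ = 𝟙 _ ⊗≫ ((radj (𝟙 a)).counit ▷ 𝟙 _ ≫ 𝟙 _ ◁ (radj (𝟙 a)).unit) ⊗≫ 𝟙 _ := by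
            rw [hu]; bicategory
        _ = 𝟙 _ ⊗≫ rightZigzag (radj (𝟙 a)).unit (radj (𝟙 a)).counit ⊗≫ 𝟙 _ := by
            rw [← whisker_exchange]; bicategory
        _ = _ := by rw [h2]; bicategory
  have viso : IsIso v := by
    have h1 := (ladj (𝟙 a)).left_triangle
    have h2 := (ladj (𝟙 a)).right_triangle
    refine ⟨(λ_ _).inv ≫ (ladj (𝟙 a)).counit, ?_, ?_⟩
    · calc _ = 𝟙 _ ⊗≫ rightZigzag (ladj (𝟙 a)).unit (ladj (𝟙 a)).counit ⊗≫ 𝟙 _ := by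
            rw [hv]; bicategory
        _ = _ := by rw [h2]; bicategory
    · calc _ = 𝟙 _ ⊗≫ (𝟙 _ ◁ (ladj (𝟙 a)).counit ≫ (ladj (𝟙 a)).unit ▷ 𝟙 _) ⊗≫ 𝟙 _ := by
            rw [hv]; bicategory
        _ = 𝟙 _ ⊗≫ leftZigzag (ladj (𝟙 a)).unit (ladj (𝟙 a)).counit ⊗≫ 𝟙 _ := by
            rw [whisker_exchange]; bicategory
        _ = _ := by rw [h1]; bicategory
  have hm := dag_map_comp (𝟙 a) (𝟙 a) (λ_ (𝟙 a)).hom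
  have k₁ := conj_unit (radj (𝟙 a)) ((radj (𝟙 a)).comp (radj (𝟙 a))) (λ_ (𝟙 a)).hom
  have k₂ := conj_symm_unit ((ladj (𝟙 a)).comp (ladj (𝟙 a))) (ladj (𝟙 a)) (λ_ (𝟙 a)).hom
  rw [← hm] at k₂
  generalize conjugateEquiv (radj (𝟙 a)) ((radj (𝟙 a)).comp (radj (𝟙 a))) (λ_ (𝟙 a)).hom = m
    at k₁ k₂
  rw [Bicategory.Adjunction.comp_unit, Bicategory.Adjunction.compUnit, hu1] at k₁
  rw [Bicategory.Adjunction.comp_unit, Bicategory.Adjunction.compUnit, hv1] at k₂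
  have hum : u ≫ m = u ≫ (λ_ _).inv ≫ u ▷ _ := by
    calc _ = ((u ≫ (λ_ _).inv) ≫ 𝟙 a ◁ m) ≫ (λ_ _).hom := by bicategory
      _ = _ := by rw [k₁]; bicategory
  have hvm : v ≫ m = v ≫ (λ_ _).inv ≫ v ▷ _ := by
    calc _ = ((v ≫ (ρ_ _).inv) ≫ m ▷ 𝟙 a) ≫ (ρ_ _).hom := by bicategory
      _ = v ≫ (ρ_ _).inv ≫ dag (𝟙 a) ◁ v := by rw [← k₂]; bicategory
      _ = (λ_ _).inv ≫ (v ▷ 𝟙 a ≫ dag (𝟙 a) ◁ v) := by bicategory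
      _ = _ := by rw [← whisker_exchange]; bicategory
  have key : v ▷ dag (𝟙 a) = u ▷ dag (𝟙 a) := by
    have : u ≫ (λ_ _).inv ≫ v ▷ dag (𝟙 a) = u ≫ (λ_ _).inv ≫ u ▷ dag (𝟙 a) := by
      rw [← hum]
      have : u = (u ≫ inv v) ≫ v := by simp
      rw [this, Category.assoc _ v, Category.assoc _ v, hvm]
    exact (cancel_epi (λ_ (dag (𝟙 a))).inv).1 ((cancel_epi u).1 this)
  have key' : u ▷ 𝟙 a ≫ dag (𝟙 a) ◁ v = v ▷ 𝟙 a ≫ dag (𝟙 a) ◁ v := by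
    rw [← whisker_exchange, ← key, whisker_exchange]
  have key'' : u ▷ 𝟙 a = v ▷ 𝟙 a := (cancel_mono (dag (𝟙 a) ◁ v)).1 key'
  simpa using key''

end UnitSymm

end PivotalDef

section Dual

open Pivotal

variable {B : Type u} [Bicategory.{w, v} B]

namespace SepFrobAlg

variable {a : B} (A : SepFrobAlg a)

lemma mul_pairing : A.mul ▷ A.X ≫ A.pairing = (α_ _ _ _).hom ≫ A.X ◁ A.mul ≫ A.pairing := by
  rw [pairing, reassoc_of% A.mul_assoc]

lemma copairing_mul_left : (λ_ A.X).inv ≫ A.copairing ▷ A.X ≫ (α_ _ _ _).hom ≫ A.X ◁ A.mul =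
    A.comul := by
  calc _ = 𝟙 _ ⊗≫ A.one ▷ A.X ⊗≫ (A.comul ▷ A.X ≫ (α_ _ _ _).hom ≫ A.X ◁ A.mul) := by
        rw [copairing]; bicategory
    _ = 𝟙 _ ⊗≫ (A.one ▷ A.X ≫ A.mul) ≫ A.comul := by rw [A.frob_right]; bicategory
    _ = _ := by rw [A.one_mul]; bicategory

lemma copairing_mul_right : (ρ_ A.X).inv ≫ A.X ◁ A.copairing ≫ (α_ _ _ _).inv ≫ A.mul ▷ A.X =
    A.comul := by
  calc _ = 𝟙 _ ⊗≫ A.X ◁ A.one ⊗≫ (A.X ◁ A.comul ≫ (α_ _ _ _).inv ≫ A.mul ▷ A.X) := by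
        rw [copairing]; bicategory
    _ = 𝟙 _ ⊗≫ (A.X ◁ A.one ≫ A.mul) ≫ A.comul := by rw [A.frob_left]; bicategory
    _ = _ := by rw [A.mul_one]; bicategory

lemma pairing_zigzag_left :
    (λ_ A.X).inv ≫ A.copairing ▷ A.X ≫ (α_ _ _ _).hom ≫ A.X ◁ A.pairing ≫ (ρ_ A.X).hom = 𝟙 _ := by
  calc _ = ((λ_ A.X).inv ≫ A.copairing ▷ A.X ≫ (α_ _ _ _).hom ≫ A.X ◁ A.mul) ≫
          A.X ◁ A.counit ≫ (ρ_ A.X).hom := by rw [pairing]; bicategory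
    _ = (A.comul ≫ A.X ◁ A.counit) ≫ (ρ_ A.X).hom := by rw [copairing_mul_left]; simp
    _ = _ := by rw [A.comul_counit]; simp

lemma pairing_zigzag_right :
    (ρ_ A.X).inv ≫ A.X ◁ A.copairing ≫ (α_ _ _ _).inv ≫ A.pairing ▷ A.X ≫ (λ_ A.X).hom = 𝟙 _ := by
  calc _ = ((ρ_ A.X).inv ≫ A.X ◁ A.copairing ≫ (α_ _ _ _).inv ≫ A.mul ▷ A.X) ≫
          A.counit ▷ A.X ≫ (λ_ A.X).hom := by rw [pairing]; bicategory
    _ = (A.comul ≫ A.counit ▷ A.X) ≫ (λ_ A.X).hom := by rw [copairing_mul_right]; simp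
    _ = _ := by rw [A.counit_comul]; simp

variable [Pivotal B]

lemma toDagRight_counit : A.toDagRight ▷ A.X ≫ (radj A.X).counit = A.pairing :=
  zigzag_right _ _

lemma toDagLeft_counit : A.X ◁ A.toDagLeft ≫ (ladj A.X).counit = A.pairing :=
  zigzag_left _ _

lemma radj_unit : (radj A.X).unit = A.copairing ≫ A.X ◁ A.toDagRight := by
  symm
  calc _ = 𝟙 _ ⊗≫ (A.copairing ▷ 𝟙 _ ≫ (A.X ≫ A.X) ◁ (radj A.X).unit) ⊗≫
          A.X ◁ A.pairing ▷ dag A.X ⊗≫ 𝟙 _ := by rw [toDagRight]; bicategory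
    _ = (radj A.X).unit ≫ ((λ_ A.X).inv ≫ A.copairing ▷ A.X ≫ (α_ _ _ _).hom ≫
          A.X ◁ A.pairing ≫ (ρ_ A.X).hom) ▷ _ := by rw [← whisker_exchange]; bicategory
    _ = _ := by rw [pairing_zigzag_left]; simp

lemma ladj_unit : (ladj A.X).unit = A.copairing ≫ A.toDagLeft ▷ A.X := by
  symm
  calc _ = 𝟙 _ ⊗≫ (𝟙 _ ◁ A.copairing ≫ (ladj A.X).unit ▷ (A.X ≫ A.X)) ⊗≫
          dag A.X ◁ A.pairing ▷ A.X ⊗≫ 𝟙 _ := by rw [toDagLeft]; bicategory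
    _ = (ladj A.X).unit ≫ _ ◁ ((ρ_ A.X).inv ≫ A.X ◁ A.copairing ≫ (α_ _ _ _).inv ≫
          A.pairing ▷ A.X ≫ (λ_ A.X).hom) := by rw [whisker_exchange]; bicategory
    _ = _ := by rw [pairing_zigzag_right]; simp

end SepFrobAlg

namespace Bimodule

variable [Pivotal B] {a b : B} {A : SepFrobAlg a} {C : SepFrobAlg b} (M : Bimodule A C)

/-- The left action of `C` on `X†`, dual to the right action of `C` on `X` (by means of `X†` as a
left adjoint of `X`). -/
def dagL : C.X ≫ dag M.X ⟶ dag M.X :=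
  (λ_ _).inv ≫ (ladj M.X).unit ▷ (C.X ≫ dag M.X) ≫ (α_ _ _ _).hom ≫
    dag M.X ◁ ((α_ _ _ _).inv ≫ M.r ▷ dag M.X ≫ (ladj M.X).counit) ≫ (ρ_ _).hom

/-- The right action of `A` on `X†`, dual to the left action of `A` on `X` (by means of `X†` as a
right adjoint of `X`). -/
def dagR : dag M.X ≫ A.X ⟶ dag M.X :=
  (ρ_ _).inv ≫ (dag M.X ≫ A.X) ◁ (radj M.X).unit ≫ (α_ _ _ _).inv ≫
    ((α_ _ _ _).hom ≫ dag M.X ◁ M.l ≫ (radj M.X).counit) ▷ dag M.X ≫ (λ_ _).hom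

lemma dagL_counit : M.X ◁ M.dagL ≫ (ladj M.X).counit =
    (α_ _ _ _).inv ≫ M.r ▷ dag M.X ≫ (ladj M.X).counit := zigzag_left _ _

lemma dagR_counit : M.dagR ▷ M.X ≫ (radj M.X).counit =
    (α_ _ _ _).hom ≫ dag M.X ◁ M.l ≫ (radj M.X).counit := zigzag_right _ _

lemma conj_r : (conjugateEquiv ((ladj C.X).comp (ladj M.X)) (ladj M.X)).symm M.r =
    (λ_ _).inv ≫ (ladj C.X).unit ▷ dag M.X ≫ (α_ _ _ _).hom ≫ dag C.X ◁ M.dagL := by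
  apply ext_counit_left ((ladj C.X).comp (ladj M.X))
  rw [← conj_symm_counit, compCounit_eq]
  symm
  calc _ = 𝟙 _ ⊗≫ M.X ◁ C.X ◁ (ladj C.X).unit ▷ dag M.X ⊗≫
          M.X ◁ ((C.X ≫ dag C.X) ◁ M.dagL ≫ (ladj C.X).counit ▷ dag M.X) ⊗≫
          (ladj M.X).counit := by bicategory
    _ = 𝟙 _ ⊗≫ M.X ◁ rightZigzag (ladj C.X).unit (ladj C.X).counit ▷ dag M.X ⊗≫
          (M.X ◁ M.dagL ≫ (ladj M.X).counit) := by rw [whisker_exchange]; bicategory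
    _ = _ := by rw [dagL_counit, (ladj C.X).right_triangle]; bicategory

lemma conj_l : conjugateEquiv (radj M.X) ((radj A.X).comp (radj M.X)) M.l =
    (ρ_ _).inv ≫ dag M.X ◁ (radj A.X).unit ≫ (α_ _ _ _).inv ≫ M.dagR ▷ dag A.X := by
  apply ext_counit_right ((radj A.X).comp (radj M.X))
  rw [conj_counit, compCounit_eq]
  symm
  calc _ = 𝟙 _ ⊗≫ dag M.X ◁ (radj A.X).unit ▷ A.X ▷ M.X ⊗≫
          (M.dagR ▷ (dag A.X ≫ A.X) ≫ dag M.X ◁ (radj A.X).counit) ▷ M.X ⊗≫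
          (radj M.X).counit := by bicategory
    _ = 𝟙 _ ⊗≫ dag M.X ◁ leftZigzag (radj A.X).unit (radj A.X).counit ▷ M.X ⊗≫
          (M.dagR ▷ M.X ≫ (radj M.X).counit) := by rw [← whisker_exchange]; bicategory
    _ = _ := by rw [dagR_counit, (radj A.X).left_triangle]; bicategory

/-- The evaluation `X† ≫ X ⟶ C` of bimodules before passing to the tensor product. -/
def evR : dag M.X ≫ M.X ⟶ C.X :=
  (λ_ _).inv ≫ C.copairing ▷ (dag M.X ≫ M.X) ≫ (α_ _ _ _).hom ≫
    C.X ◁ ((α_ _ _ _).inv ≫ M.dagL ▷ M.X ≫ (radj M.X).counit) ≫ (ρ_ _).hom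

/-- The evaluation `X ≫ X† ⟶ A` of bimodules before passing to the tensor product. -/
def evL : M.X ≫ dag M.X ⟶ A.X :=
  (ρ_ _).inv ≫ (M.X ≫ dag M.X) ◁ A.copairing ≫ (α_ _ _ _).inv ≫
    ((α_ _ _ _).hom ≫ M.X ◁ M.dagR ≫ (ladj M.X).counit) ▷ A.X ≫ (λ_ _).hom

lemma r_counit (hC : C.IsSymmetric) : dag M.X ◁ M.r ≫ (radj M.X).counit =
    (α_ _ _ _).inv ≫ M.evR ▷ C.X ≫ C.pairing := by
  rw [← conj_counit (radj M.X) ((radj M.X).comp (radj C.X)), dag_map_comp, conj_r, compCounit_eq,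
    C.ladj_unit, show C.toDagLeft = C.toDagRight from (show _ = _ from hC).symm]
  calc _ = 𝟙 _ ⊗≫ C.copairing ▷ dag M.X ▷ M.X ▷ C.X ⊗≫
          (C.toDagRight ▷ (C.X ≫ dag M.X) ≫ dag C.X ◁ M.dagL) ▷ M.X ▷ C.X ⊗≫
            dag C.X ◁ (radj M.X).counit ▷ C.X ⊗≫ (radj C.X).counit := by bicategory
    _ = 𝟙 _ ⊗≫ C.copairing ▷ dag M.X ▷ M.X ▷ C.X ⊗≫
          (C.X ◁ M.dagL) ▷ M.X ▷ C.X ⊗≫ (C.toDagRight ▷ (dag M.X ≫ M.X) ≫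
            dag C.X ◁ (radj M.X).counit) ▷ C.X ⊗≫ (radj C.X).counit := by
        rw [← whisker_exchange]; bicategory
    _ = 𝟙 _ ⊗≫ C.copairing ▷ dag M.X ▷ M.X ▷ C.X ⊗≫
          (C.X ◁ M.dagL) ▷ M.X ▷ C.X ⊗≫ C.X ◁ (radj M.X).counit ▷ C.X ⊗≫
            (C.toDagRight ▷ C.X ≫ (radj C.X).counit) := by
        rw [← whisker_exchange]; bicategory
    _ = _ := by rw [C.toDagRight_counit, evR]; bicategory

lemma l_counit (hA : A.IsSymmetric) : M.l ▷ dag M.X ≫ (ladj M.X).counit =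
    (α_ _ _ _).hom ≫ A.X ◁ M.evL ≫ A.pairing := by
  rw [conj_symm_counit ((ladj M.X).comp (ladj A.X)) (ladj M.X), ← dag_map_comp, conj_l,
    compCounit_eq, A.radj_unit, show A.toDagRight = A.toDagLeft from hA]
  calc _ = 𝟙 _ ⊗≫ A.X ◁ M.X ◁ dag M.X ◁ A.copairing ⊗≫
          A.X ◁ M.X ◁ ((dag M.X ≫ A.X) ◁ A.toDagLeft ≫ M.dagR ▷ dag A.X) ⊗≫
            A.X ◁ (ladj M.X).counit ▷ dag A.X ⊗≫ (ladj A.X).counit := by bicategory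
    _ = 𝟙 _ ⊗≫ A.X ◁ M.X ◁ dag M.X ◁ A.copairing ⊗≫
          A.X ◁ M.X ◁ (M.dagR ▷ A.X) ⊗≫ A.X ◁ ((M.X ≫ dag M.X) ◁ A.toDagLeft ≫
            (ladj M.X).counit ▷ dag A.X) ⊗≫ (ladj A.X).counit := by
        rw [whisker_exchange]; bicategory
    _ = 𝟙 _ ⊗≫ A.X ◁ M.X ◁ dag M.X ◁ A.copairing ⊗≫
          A.X ◁ M.X ◁ (M.dagR ▷ A.X) ⊗≫ A.X ◁ (ladj M.X).counit ▷ A.X ⊗≫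
            (A.X ◁ A.toDagLeft ≫ (ladj A.X).counit) := by
        rw [whisker_exchange]; bicategory
    _ = _ := by rw [A.toDagLeft_counit, evL]; bicategory

lemma coact_counit (hC : C.IsSymmetric) : dag M.X ◁ M.coact ≫ (α_ _ _ _).inv ≫
    (radj M.X).counit ▷ C.X ≫ (λ_ _).hom = M.evR := by
  calc _ = 𝟙 _ ⊗≫ dag M.X ◁ M.X ◁ C.copairing ⊗≫
          (dag M.X ◁ M.r ≫ (radj M.X).counit) ▷ C.X ⊗≫ 𝟙 _ := by
        rw [coact, SepFrobAlg.copairing]; bicategory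
    _ = 𝟙 _ ⊗≫ ((dag M.X ≫ M.X) ◁ C.copairing ≫ M.evR ▷ (C.X ≫ C.X)) ⊗≫
          C.pairing ▷ C.X ⊗≫ 𝟙 _ := by
        rw [r_counit M hC]; bicategory
    _ = M.evR ≫ ((ρ_ C.X).inv ≫ C.X ◁ C.copairing ≫ (α_ _ _ _).inv ≫ C.pairing ▷ C.X ≫
          (λ_ C.X).hom) := by
        rw [whisker_exchange]; bicategory
    _ = _ := by rw [C.pairing_zigzag_right, Category.comp_id]

lemma evL_eq (hA : A.IsSymmetric) : M.evL =
    (λ_ _).inv ≫ A.copairing ▷ (M.X ≫ dag M.X) ≫ (α_ _ _ _).hom ≫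
    A.X ◁ ((α_ _ _ _).inv ≫ M.l ▷ dag M.X ≫ (ladj M.X).counit) ≫ (ρ_ _).hom := by
  symm
  rw [l_counit M hA]
  calc _ = 𝟙 _ ⊗≫ (A.copairing ▷ (M.X ≫ dag M.X) ≫ (A.X ≫ A.X) ◁ M.evL) ⊗≫
          A.X ◁ A.pairing ⊗≫ 𝟙 _ := by bicategory
    _ = M.evL ≫ ((λ_ A.X).inv ≫ A.copairing ▷ A.X ≫ (α_ _ _ _).hom ≫ A.X ◁ A.pairing ≫
          (ρ_ A.X).hom) := by
        rw [← whisker_exchange]; bicategory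
    _ = _ := by rw [A.pairing_zigzag_left, Category.comp_id]

lemma dagL_evR : M.dagL ▷ M.X ≫ (radj M.X).counit =
    (α_ _ _ _).hom ≫ C.X ◁ M.evR ≫ C.pairing := by
  symm
  calc _ = 𝟙 _ ⊗≫ C.X ◁ C.copairing ▷ dag M.X ▷ M.X ⊗≫
          ((C.X ≫ C.X) ◁ (M.dagL ▷ M.X ≫ (radj M.X).counit) ≫ C.pairing ▷ 𝟙 _) ⊗≫ 𝟙 _ := by
        rw [evR]; bicategory
    _ = 𝟙 _ ⊗≫ ((ρ_ C.X).inv ≫ C.X ◁ C.copairing ≫ (α_ _ _ _).inv ≫ C.pairing ▷ C.X ≫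
          (λ_ C.X).hom) ▷ dag M.X ▷ M.X ⊗≫ (M.dagL ▷ M.X ≫ (radj M.X).counit) := by
        rw [whisker_exchange]; bicategory
    _ = _ := by rw [C.pairing_zigzag_right]; bicategory

lemma dagR_evR (hC : C.IsSymmetric) : M.dagR ▷ M.X ≫ M.evR =
    (α_ _ _ _).hom ≫ dag M.X ◁ M.l ≫ M.evR := by
  rw [← coact_counit M hC]
  symm
  calc _ = 𝟙 _ ⊗≫ dag M.X ◁ (M.l ≫ M.coact) ⊗≫ (radj M.X).counit ▷ C.X ⊗≫ 𝟙 _ := by bicategory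
    _ = 𝟙 _ ⊗≫ dag M.X ◁ A.X ◁ M.coact ⊗≫
          ((α_ _ _ _).hom ≫ dag M.X ◁ M.l ≫ (radj M.X).counit) ▷ C.X ⊗≫ 𝟙 _ := by
        rw [l_coact]; bicategory
    _ = 𝟙 _ ⊗≫ ((dag M.X ≫ A.X) ◁ M.coact ≫ M.dagR ▷ (M.X ≫ C.X)) ⊗≫
          (radj M.X).counit ▷ C.X ⊗≫ 𝟙 _ := by
        rw [← dagR_counit]; bicategory
    _ = _ := by rw [whisker_exchange]; bicategory

/-- The bimodule `X†` with the actions dual to those on `X`. -/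
def dual (hC : C.IsSymmetric) : Bimodule C A where
  X := dag M.X
  l := M.dagL
  r := M.dagR
  l_assoc := by
    apply ext_counit_left (ladj M.X)
    calc _ = M.X ◁ C.mul ▷ dag M.X ≫ (M.X ◁ M.dagL ≫ (ladj M.X).counit) := by bicategory
      _ = 𝟙 _ ⊗≫ (M.X ◁ C.mul ≫ M.r) ▷ dag M.X ≫ (ladj M.X).counit := by
        rw [dagL_counit]; bicategory
      _ = 𝟙 _ ⊗≫ M.r ▷ C.X ▷ dag M.X ⊗≫
            ((α_ _ _ _).inv ≫ M.r ▷ dag M.X ≫ (ladj M.X).counit) := by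
        rw [M.r_assoc]; bicategory
      _ = 𝟙 _ ⊗≫ (M.r ▷ (C.X ≫ dag M.X) ≫ M.X ◁ M.dagL) ≫ (ladj M.X).counit := by
        rw [← dagL_counit]; bicategory
      _ = 𝟙 _ ⊗≫ M.X ◁ C.X ◁ M.dagL ⊗≫
            ((α_ _ _ _).inv ≫ M.r ▷ dag M.X ≫ (ladj M.X).counit) := by
        rw [← whisker_exchange]; bicategory
      _ = _ := by rw [← dagL_counit]; bicategory
  one_l := by
    apply ext_counit_left (ladj M.X)
    calc _ = M.X ◁ C.one ▷ dag M.X ≫ (M.X ◁ M.dagL ≫ (ladj M.X).counit) := by bicategory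
      _ = 𝟙 _ ⊗≫ (M.X ◁ C.one ≫ M.r) ▷ dag M.X ≫ (ladj M.X).counit := by
        rw [dagL_counit]; bicategory
      _ = _ := by rw [M.r_one]; bicategory
  r_assoc := by
    apply ext_counit_right (radj M.X)
    calc _ = (dag M.X ◁ A.mul) ▷ M.X ≫ (M.dagR ▷ M.X ≫ (radj M.X).counit) := by bicategory
      _ = 𝟙 _ ⊗≫ dag M.X ◁ (A.mul ▷ M.X ≫ M.l) ≫ (radj M.X).counit := by
        rw [dagR_counit]; bicategory
      _ = 𝟙 _ ⊗≫ dag M.X ◁ A.X ◁ M.l ⊗≫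
            ((α_ _ _ _).hom ≫ dag M.X ◁ M.l ≫ (radj M.X).counit) := by
        rw [M.l_assoc]; bicategory
      _ = 𝟙 _ ⊗≫ ((dag M.X ≫ A.X) ◁ M.l ≫ M.dagR ▷ M.X) ≫ (radj M.X).counit := by
        rw [← dagR_counit]; bicategory
      _ = 𝟙 _ ⊗≫ M.dagR ▷ A.X ▷ M.X ⊗≫
            ((α_ _ _ _).hom ≫ dag M.X ◁ M.l ≫ (radj M.X).counit) := by
        rw [whisker_exchange]; bicategory
      _ = _ := by rw [← dagR_counit]; bicategory
  r_one := by
    apply ext_counit_right (radj M.X)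
    calc _ = (dag M.X ◁ A.one) ▷ M.X ≫ (M.dagR ▷ M.X ≫ (radj M.X).counit) := by bicategory
      _ = 𝟙 _ ⊗≫ dag M.X ◁ (A.one ▷ M.X ≫ M.l) ≫ (radj M.X).counit := by
        rw [dagR_counit]; bicategory
      _ = _ := by rw [M.one_l]; bicategory
  l_r := by
    apply ext_counit_right (radj M.X)
    calc _ = M.dagL ▷ A.X ▷ M.X ≫ (M.dagR ▷ M.X ≫ (radj M.X).counit) := by bicategory
      _ = 𝟙 _ ⊗≫ (M.dagL ▷ (A.X ≫ M.X) ≫ dag M.X ◁ M.l) ≫ (radj M.X).counit := by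
        rw [dagR_counit]; bicategory
      _ = 𝟙 _ ⊗≫ C.X ◁ dag M.X ◁ M.l ⊗≫ (M.dagL ▷ M.X ≫ (radj M.X).counit) := by
        rw [← whisker_exchange]; bicategory
      _ = 𝟙 _ ⊗≫ C.X ◁ ((α_ _ _ _).hom ≫ dag M.X ◁ M.l ≫ M.evR) ⊗≫ C.pairing := by
        rw [dagL_evR]; bicategory
      _ = 𝟙 _ ⊗≫ C.X ◁ M.dagR ▷ M.X ⊗≫ ((α_ _ _ _).hom ≫ C.X ◁ M.evR ≫ C.pairing) := by
        rw [← dagR_evR M hC]; bicategory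
      _ = _ := by rw [← dagL_evR]; bicategory

end Bimodule
end Dual

section DualPairs

variable {B : Type u} [Bicategory.{w, v} B]

open Bimodule

/-- An adjunction between the underlying 1-morphisms of two bimodules whose counit is compatible with
the actions. Such data induce an adjunction of bimodules. -/
structure DualPair {a b : B} {A : SepFrobAlg a} {C : SepFrobAlg b} (M : Bimodule A C)
    (N : Bimodule C A) where
  adj : M.X ⊣ N.X
  counit_l : N.r ▷ M.X ≫ adj.counit = (α_ _ _ _).hom ≫ N.X ◁ M.l ≫ adj.counit
  counit_r : N.X ◁ M.coact ≫ (α_ _ _ _).inv ≫ adj.counit ▷ C.X ≫ (λ_ _).hom =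
    (λ_ _).inv ≫ C.copairing ▷ (N.X ≫ M.X) ≫ (α_ _ _ _).hom ≫
      C.X ◁ ((α_ _ _ _).inv ≫ N.l ▷ M.X ≫ adj.counit) ≫ (ρ_ _).hom

namespace DualPair

variable {a b c : B} {A : SepFrobAlg a} {C : SepFrobAlg b} {E : SepFrobAlg c}
  {M : Bimodule A C} {N : Bimodule C A} (d : DualPair M N)

/-- The counit with values in `C`: coact on `M` with `C`, then apply the counit in `B`. -/
def ev : N.X ≫ M.X ⟶ C.X := N.X ◁ M.coact ≫ (α_ _ _ _).inv ≫ d.adj.counit ▷ C.X ≫ (λ_ _).hom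

/-- The unit with source `A`: apply the unit in `B`, then act with `A`. -/
def coev : A.X ⟶ M.X ≫ N.X :=
  (ρ_ _).inv ≫ A.X ◁ d.adj.unit ≫ (α_ _ _ _).inv ≫ M.l ▷ N.X

lemma ev_eq : d.ev = (λ_ _).inv ≫ C.copairing ▷ (N.X ≫ M.X) ≫ (α_ _ _ _).hom ≫
      C.X ◁ ((α_ _ _ _).inv ≫ N.l ▷ M.X ≫ d.adj.counit) ≫ (ρ_ _).hom := d.counit_r

lemma coev_eq : d.coev = (λ_ _).inv ≫ d.adj.unit ▷ A.X ≫ (α_ _ _ _).hom ≫ M.X ◁ N.r := by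
  calc _ = 𝟙 _ ⊗≫ (𝟙 a ◁ (A.X ◁ d.adj.unit ≫ (α_ _ _ _).inv ≫ M.l ▷ N.X)) ⊗≫
          (λ_ M.X).hom ▷ N.X := by rw [coev]; bicategory
    _ = 𝟙 _ ⊗≫ A.X ◁ d.adj.unit ⊗≫ M.l ▷ N.X ⊗≫
          (leftZigzag d.adj.unit d.adj.counit ▷ N.X) ⊗≫ 𝟙 _ := by
        rw [d.adj.left_triangle]; bicategory
    _ = 𝟙 _ ⊗≫ (𝟙 a ◁ (A.X ◁ d.adj.unit ≫ (α_ _ _ _).inv ≫ M.l ▷ N.X) ≫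
          d.adj.unit ▷ (M.X ≫ N.X)) ⊗≫ M.X ◁ d.adj.counit ▷ N.X ⊗≫ 𝟙 _ := by
        bicategory
    _ = 𝟙 _ ⊗≫ d.adj.unit ▷ A.X ⊗≫ (M.X ≫ N.X) ◁ (A.X ◁ d.adj.unit) ⊗≫
          M.X ◁ ((α_ _ _ _).hom ≫ N.X ◁ M.l ≫ d.adj.counit) ▷ N.X ⊗≫ 𝟙 _ := by
        rw [whisker_exchange]; bicategory
    _ = 𝟙 _ ⊗≫ d.adj.unit ▷ A.X ⊗≫ M.X ◁ ((N.X ≫ A.X) ◁ d.adj.unit ≫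
          N.r ▷ (M.X ≫ N.X)) ⊗≫ M.X ◁ d.adj.counit ▷ N.X ⊗≫ 𝟙 _ := by
        rw [← d.counit_l]; bicategory
    _ = 𝟙 _ ⊗≫ d.adj.unit ▷ A.X ⊗≫ M.X ◁ N.r ⊗≫ M.X ◁ rightZigzag d.adj.unit d.adj.counit ⊗≫
          𝟙 _ := by
        rw [whisker_exchange]; bicategory
    _ = _ := by rw [d.adj.right_triangle]; bicategory

lemma _root_.OrbifoldCompletion.Bimodule.coact_counit' (M : Bimodule A C) :
    M.coact ≫ M.X ◁ C.counit = (ρ_ _).inv := by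
  calc _ = 𝟙 _ ⊗≫ M.X ◁ C.one ⊗≫ M.X ◁ C.comul ⊗≫ (M.r ▷ C.X ≫ M.X ◁ C.counit) := by
        rw [coact]; bicategory
    _ = 𝟙 _ ⊗≫ M.X ◁ C.one ⊗≫ M.X ◁ (C.comul ≫ C.X ◁ C.counit) ⊗≫ M.r ▷ 𝟙 b := by
        rw [← whisker_exchange]; bicategory
    _ = (ρ_ _).inv ≫ (M.X ◁ C.one ≫ M.r) ⊗≫ 𝟙 _ := by rw [C.comul_counit]; bicategory
    _ = _ := by rw [M.r_one]; bicategory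

lemma ev_counit : d.ev ≫ C.counit = d.adj.counit := by
  calc _ = N.X ◁ M.coact ⊗≫ (d.adj.counit ▷ C.X ≫ 𝟙 b ◁ C.counit) ⊗≫ 𝟙 _ := by
        rw [ev]; bicategory
    _ = N.X ◁ (M.coact ≫ M.X ◁ C.counit) ⊗≫ d.adj.counit ⊗≫ 𝟙 _ := by
        rw [← whisker_exchange]; bicategory
    _ = N.X ◁ (ρ_ _).inv ⊗≫ d.adj.counit ⊗≫ 𝟙 _ := by rw [coact_counit']
    _ = _ := by bicategory

lemma ev_balanced : N.Balanced M d.ev := by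
  unfold Bimodule.Balanced
  calc _ = 𝟙 _ ⊗≫ (N.r ▷ M.X ≫ N.X ◁ M.coact) ⊗≫ d.adj.counit ▷ C.X ⊗≫ 𝟙 _ := by
        rw [ev]; bicategory
    _ = 𝟙 _ ⊗≫ N.X ◁ A.X ◁ M.coact ⊗≫ (N.r ▷ M.X ≫ d.adj.counit) ▷ C.X ⊗≫ 𝟙 _ := by
        rw [← whisker_exchange]; bicategory
    _ = 𝟙 _ ⊗≫ N.X ◁ (A.X ◁ M.coact ≫ (α_ _ _ _).inv ≫ M.l ▷ C.X) ⊗≫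
          d.adj.counit ▷ C.X ⊗≫ 𝟙 _ := by
        rw [d.counit_l]; bicategory
    _ = _ := by rw [← l_coact, ev]; bicategory

lemma ev_l : C.X ◁ d.ev ≫ C.mul = (α_ _ _ _).inv ≫ N.l ▷ M.X ≫ d.ev := by
  symm
  calc _ = 𝟙 _ ⊗≫ (𝟙 b ◁ (N.l ▷ M.X) ≫ C.copairing ▷ (N.X ≫ M.X)) ⊗≫
          C.X ◁ (N.l ▷ M.X ≫ d.adj.counit) ⊗≫ 𝟙 _ := by
        rw [ev_eq]; bicategory
    _ = 𝟙 _ ⊗≫ C.copairing ▷ C.X ▷ N.X ▷ M.X ⊗≫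
          C.X ◁ ((α_ _ _ _).hom ≫ C.X ◁ N.l ≫ N.l) ▷ M.X ⊗≫ C.X ◁ d.adj.counit ⊗≫ 𝟙 _ := by
        rw [whisker_exchange]; bicategory
    _ = 𝟙 _ ⊗≫ ((λ_ C.X).inv ≫ C.copairing ▷ C.X ≫ (α_ _ _ _).hom ≫ C.X ◁ C.mul) ▷ N.X ▷ M.X ⊗≫
          C.X ◁ (N.l ▷ M.X ≫ d.adj.counit) ⊗≫ 𝟙 _ := by
        rw [← N.l_assoc]; bicategory
    _ = 𝟙 _ ⊗≫ ((ρ_ C.X).inv ≫ C.X ◁ C.copairing ≫ (α_ _ _ _).inv ≫ C.mul ▷ C.X) ▷ N.X ▷ M.X ⊗≫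
          C.X ◁ (N.l ▷ M.X ≫ d.adj.counit) ⊗≫ 𝟙 _ := by
        rw [C.copairing_mul_left, C.copairing_mul_right]
    _ = 𝟙 _ ⊗≫ C.X ◁ C.copairing ▷ N.X ▷ M.X ⊗≫ (C.mul ▷ (C.X ≫ N.X ≫ M.X) ≫
          C.X ◁ ((α_ _ _ _).inv ≫ N.l ▷ M.X ≫ d.adj.counit)) ⊗≫ 𝟙 _ := by
        bicategory
    _ = _ := by rw [← whisker_exchange, ev_eq]; bicategory

lemma ev_r : d.ev ▷ C.X ≫ C.mul = (α_ _ _ _).hom ≫ N.X ◁ M.r ≫ d.ev := by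
  symm
  calc _ = 𝟙 _ ⊗≫ N.X ◁ (M.r ≫ M.coact) ⊗≫ d.adj.counit ▷ C.X ⊗≫ 𝟙 _ := by
        rw [ev]; bicategory
    _ = 𝟙 _ ⊗≫ N.X ◁ M.coact ▷ C.X ⊗≫ ((N.X ≫ M.X) ◁ C.mul ≫ d.adj.counit ▷ C.X) ⊗≫ 𝟙 _ := by
        rw [r_coact]; bicategory
    _ = _ := by rw [whisker_exchange, ev]; bicategory

lemma coev_l : A.X ◁ d.coev ≫ (α_ _ _ _).inv ≫ M.l ▷ N.X = A.mul ≫ d.coev := by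
  calc _ = 𝟙 _ ⊗≫ A.X ◁ A.X ◁ d.adj.unit ⊗≫ ((α_ _ _ _).hom ≫ A.X ◁ M.l ≫ M.l) ▷ N.X := by
        rw [coev]; bicategory
    _ = 𝟙 _ ⊗≫ ((A.X ≫ A.X) ◁ d.adj.unit ≫ A.mul ▷ (M.X ≫ N.X)) ⊗≫ M.l ▷ N.X := by
        rw [← M.l_assoc]; bicategory
    _ = _ := by rw [whisker_exchange, coev]; bicategory

lemma coev_r : d.coev ▷ A.X ≫ (α_ _ _ _).hom ≫ M.X ◁ N.r = A.mul ≫ d.coev := by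
  calc _ = 𝟙 _ ⊗≫ d.adj.unit ▷ A.X ▷ A.X ⊗≫ M.X ◁ ((α_ _ _ _).inv ≫ N.r ▷ A.X ≫ N.r) := by
        rw [coev_eq]; bicategory
    _ = 𝟙 _ ⊗≫ (d.adj.unit ▷ (A.X ≫ A.X) ≫ (M.X ≫ N.X) ◁ A.mul) ⊗≫ M.X ◁ N.r := by
        rw [← N.r_assoc]; bicategory
    _ = _ := by rw [← whisker_exchange, coev_eq]; bicategory

lemma zigzag₁ : d.coev ▷ M.X ≫ (α_ _ _ _).hom ≫ M.X ◁ d.ev ≫ M.r = M.l := by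
  calc _ = 𝟙 _ ⊗≫ A.X ◁ d.adj.unit ▷ M.X ⊗≫ (M.l ▷ (N.X ≫ M.X) ≫
          M.X ◁ (N.X ◁ M.coact ≫ (α_ _ _ _).inv ≫ d.adj.counit ▷ C.X)) ⊗≫ M.r := by
        rw [coev, ev]; bicategory
    _ = 𝟙 _ ⊗≫ A.X ◁ (d.adj.unit ▷ M.X ≫ (M.X ≫ N.X) ◁ M.coact) ⊗≫
          A.X ◁ M.X ◁ d.adj.counit ▷ C.X ⊗≫ M.l ▷ C.X ⊗≫ M.r := by
        rw [← whisker_exchange]; bicategory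
    _ = 𝟙 _ ⊗≫ A.X ◁ M.coact ⊗≫ A.X ◁ leftZigzag d.adj.unit d.adj.counit ▷ C.X ⊗≫
          M.l ▷ C.X ⊗≫ M.r := by
        rw [← whisker_exchange]; bicategory
    _ = (A.X ◁ M.coact ≫ (α_ _ _ _).inv ≫ M.l ▷ C.X) ≫ M.r := by
        rw [d.adj.left_triangle]; bicategory
    _ = _ := by rw [← l_coact, Category.assoc, coact_r, Category.comp_id]

lemma zigzag₂ : N.X ◁ d.coev ≫ (α_ _ _ _).inv ≫ d.ev ▷ N.X ≫ N.l = N.r := by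
  calc _ = 𝟙 _ ⊗≫ (𝟙 b ◁ (N.X ◁ d.coev) ≫ C.copairing ▷ (N.X ≫ M.X ≫ N.X)) ⊗≫
          ((C.X ◁ ((α_ _ _ _).inv ≫ N.l ▷ M.X ≫ d.adj.counit)) ▷ N.X) ⊗≫ N.l := by
        rw [ev_eq]; bicategory
    _ = 𝟙 _ ⊗≫ C.copairing ▷ N.X ▷ A.X ⊗≫
          (C.X ◁ ((C.X ≫ N.X) ◁ (d.adj.unit ▷ A.X ⊗≫ M.X ◁ N.r) ≫ N.l ▷ (M.X ≫ N.X))) ⊗≫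
          (C.X ◁ d.adj.counit ▷ N.X) ⊗≫ N.l := by
        rw [whisker_exchange, coev_eq]; bicategory
    _ = 𝟙 _ ⊗≫ C.copairing ▷ N.X ▷ A.X ⊗≫ C.X ◁ N.l ▷ A.X ⊗≫
          C.X ◁ (N.X ◁ d.adj.unit ▷ A.X ⊗≫ ((N.X ≫ M.X) ◁ N.r ≫ d.adj.counit ▷ N.X)) ⊗≫
          N.l := by
        rw [whisker_exchange]; bicategory
    _ = 𝟙 _ ⊗≫ C.copairing ▷ N.X ▷ A.X ⊗≫ C.X ◁ N.l ▷ A.X ⊗≫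
          C.X ◁ (rightZigzag d.adj.unit d.adj.counit ▷ A.X ⊗≫ N.r) ⊗≫
          N.l := by
        rw [whisker_exchange]; bicategory
    _ = 𝟙 _ ⊗≫ C.copairing ▷ N.X ▷ A.X ⊗≫ C.X ◁ (N.l ▷ A.X ≫ N.r) ⊗≫ N.l := by
        rw [d.adj.right_triangle]; bicategory
    _ = 𝟙 _ ⊗≫ (C.copairing ▷ (N.X ≫ A.X) ≫ (C.X ≫ C.X) ◁ N.r) ⊗≫
          ((α_ _ _ _).hom ≫ C.X ◁ N.l ≫ N.l) := by
        rw [N.l_r]; bicategory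
    _ = 𝟙 _ ⊗≫ N.r ⊗≫ (C.one ≫ C.comul ≫ C.mul) ▷ N.X ⊗≫ N.l := by
        rw [← whisker_exchange, ← N.l_assoc, SepFrobAlg.copairing]; bicategory
    _ = 𝟙 _ ⊗≫ N.r ⊗≫ (C.one ▷ N.X ≫ N.l) := by
        rw [C.separable]; bicategory
    _ = _ := by rw [N.one_l]; bicategory

section
variable [LocallyIdempotentComplete B]

/-- The counit of the induced adjunction of bimodules. -/
noncomputable def counitHom : N.tensor M ⟶ Bimodule.unit C :=
  descHom (M := N) (N := M) (T := Bimodule.unit C) d.ev d.ev_balanced d.ev_l d.ev_r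

lemma ϑ_counitHom : N.ϑ M ≫ d.counitHom.hom = d.ev := ϑ_descHom _ _ _ _

/-- The unit of the induced adjunction of bimodules. -/
noncomputable def unitHom : Bimodule.unit A ⟶ M.tensor N where
  hom := d.coev ≫ M.ϑ N
  l_hom := by
    rw [whiskerLeft_comp, Category.assoc, ϑ_l, reassoc_of% d.coev_l]
  r_hom := by
    rw [comp_whiskerRight, Category.assoc, ϑ_r, reassoc_of% d.coev_r]

lemma left_triangle : whiskerR d.unitHom M ≫ (associator M N M).hom ≫ M.whiskerL d.counitHom ≫
    (rightUnitor M).hom = (leftUnitor M).hom := by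
  apply tensor_hom_ext
  simp only [comp_hom', ϑ_whiskerR_assoc, ϑ_leftUnitor]
  change (d.coev ≫ M.ϑ N) ▷ M.X ≫ _ = _
  rw [comp_whiskerRight, Category.assoc, ϑ_associator_assoc, ϑ_whiskerL_assoc,
    ← whiskerLeft_comp_assoc, ϑ_counitHom, ϑ_rightUnitor, zigzag₁]

lemma right_triangle : N.whiskerL d.unitHom ≫ (associator N M N).inv ≫ whiskerR d.counitHom N ≫
    (leftUnitor N).hom = (rightUnitor N).hom := by
  apply tensor_hom_ext
  simp only [comp_hom', ϑ_whiskerL_assoc, ϑ_rightUnitor]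
  change N.X ◁ (d.coev ≫ M.ϑ N) ≫ _ = _
  rw [whiskerLeft_comp, Category.assoc, ϑ_associator_inv_assoc, ϑ_whiskerR_assoc,
    ← comp_whiskerRight_assoc, ϑ_counitHom, ϑ_leftUnitor, zigzag₂]

end

section comp
variable {M' : Bimodule C E} {N' : Bimodule E C} (d' : DualPair M' N')

lemma proj_compCounit_left : N'.proj N ▷ (M.X ≫ M'.X) ≫ (d.adj.comp d'.adj).counit =
    (α_ _ _ _).hom ≫ N'.X ◁ ((α_ _ _ _).inv ≫ d.ev ▷ M'.X ≫ M'.l) ≫ d'.adj.counit := by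
  symm
  calc _ = 𝟙 _ ⊗≫ N'.X ◁ ((C.copairing ▷ N.X) ▷ M.X ⊗≫ C.X ◁ (N.l ▷ M.X ≫ d.adj.counit)) ▷ M'.X ⊗≫
            ((α_ _ _ _).hom ≫ N'.X ◁ M'.l ≫ d'.adj.counit) := by
        rw [ev_eq]; bicategory
    _ = 𝟙 _ ⊗≫ N'.X ◁ C.copairing ▷ N.X ▷ M.X ▷ M'.X ⊗≫
          ((N'.X ≫ C.X) ◁ (N.l ▷ M.X ≫ d.adj.counit) ≫ N'.r ▷ 𝟙 b) ▷ M'.X ⊗≫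
            d'.adj.counit := by
        rw [← d'.counit_l]; bicategory
    _ = _ := by
        rw [whisker_exchange, compCounit_eq, proj, coact, ← SepFrobAlg.copairing]; bicategory

lemma proj_compCounit_right : (N'.X ≫ N.X) ◁ M.proj M' ≫ (d.adj.comp d'.adj).counit =
    (α_ _ _ _).hom ≫ N'.X ◁ ((α_ _ _ _).inv ≫ d.ev ▷ M'.X ≫ M'.l) ≫ d'.adj.counit := by
  rw [compCounit_eq]
  calc _ = 𝟙 _ ⊗≫ N'.X ◁ N.X ◁ M.coact ▷ M'.X ⊗≫
            N'.X ◁ ((N.X ≫ M.X) ◁ M'.l ≫ d.adj.counit ▷ M'.X) ⊗≫ d'.adj.counit := by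
        rw [proj]; bicategory
    _ = _ := by
        rw [whisker_exchange, ev]; bicategory

end comp

end DualPair
end DualPairs

section Orb

open Bimodule Pivotal

lemma leftZigzag_eq {B : Type u} [Bicategory.{w, v} B] {a b : B} {f : a ⟶ b} {g : b ⟶ a}
    (η : 𝟙 a ⟶ f ≫ g) (θ : g ≫ f ⟶ 𝟙 b)
    (h : η ▷ f ≫ (α_ f g f).hom ≫ f ◁ θ ≫ (ρ_ f).hom = (λ_ f).hom) :
    leftZigzag η θ = (λ_ _).hom ≫ (ρ_ _).inv := by
  rw [← h]; bicategory

lemma rightZigzag_eq {B : Type u} [Bicategory.{w, v} B] {a b : B} {f : a ⟶ b} {g : b ⟶ a}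
    (η : 𝟙 a ⟶ f ≫ g) (θ : g ≫ f ⟶ 𝟙 b)
    (h : g ◁ η ≫ (α_ g f g).inv ≫ θ ▷ g ≫ (λ_ g).hom = (ρ_ g).hom) :
    rightZigzag η θ = (ρ_ _).hom ≫ (λ_ _).inv := by
  rw [← h]; bicategory

lemma conj_comp_right {B : Type u} [Bicategory.{w, v} B] {a b c : B} {f₁ : a ⟶ b} {g₁ : b ⟶ a}
    {f₂ : b ⟶ c} {g₂ : c ⟶ b} {r : c ⟶ a} (adj : f₁ ≫ f₂ ⊣ r) (adj₁ : f₁ ⊣ g₁) (adj₂ : f₂ ⊣ g₂) :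
    conjugateEquiv adj (adj₁.comp adj₂) (𝟙 _) ▷ (f₁ ≫ f₂) ≫ (α_ g₂ g₁ (f₁ ≫ f₂)).hom ≫
      g₂ ◁ ((α_ g₁ f₁ f₂).inv ≫ adj₁.counit ▷ f₂ ≫ (λ_ f₂).hom) ≫ adj₂.counit = adj.counit := by
  rw [← compCounit_eq, conj_counit, whiskerLeft_id, Category.id_comp]

lemma conj_comp_left {B : Type u} [Bicategory.{w, v} B] {a b c : B} {f₁ : a ⟶ b} {g₁ : b ⟶ a}
    {f₂ : b ⟶ c} {g₂ : c ⟶ b} {l : a ⟶ c} (adj : l ⊣ g₂ ≫ g₁) (adj₁ : f₁ ⊣ g₁) (adj₂ : f₂ ⊣ g₂) :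
    (g₂ ≫ g₁) ◁ (conjugateEquiv (adj₁.comp adj₂) adj).symm (𝟙 _) ≫ (α_ g₂ g₁ (f₁ ≫ f₂)).hom ≫
      g₂ ◁ ((α_ g₁ f₁ f₂).inv ≫ adj₁.counit ▷ f₂ ≫ (λ_ f₂).hom) ≫ adj₂.counit = adj.counit := by
  rw [← compCounit_eq, ← conj_symm_counit, id_whiskerRight, Category.id_comp]

/-- The orbifold completion: the full subbicategory of the equivariant completion on the pairs
whose algebra is symmetric (see the two instances below). -/
structure OrbCompletion (B : Type u) [Bicategory.{w, v} B] [Pivotal B] where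
  pt : B
  alg : SepFrobAlg pt
  symm : alg.IsSymmetric

variable {B : Type u} [Bicategory.{w, v} B] [Pivotal B] [LocallyIdempotentComplete B]

noncomputable instance : CategoryStruct (OrbCompletion B) where
  Hom x y := Bimodule x.alg y.alg
  id x := unit x.alg
  comp M N := M.tensor N

noncomputable instance : Bicategory (OrbCompletion B) where
  homCategory x y := inferInstanceAs (Category (Bimodule x.alg y.alg))
  whiskerLeft M _ _ f := Bimodule.whiskerL M f
  whiskerRight f N := Bimodule.whiskerR f N
  associator M N P := Bimodule.associator M N P
  leftUnitor M := Bimodule.leftUnitor M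
  rightUnitor M := Bimodule.rightUnitor M
  whiskerLeft_id M N := Bimodule.whiskerL_id M N
  whiskerLeft_comp M _ _ _ f g := Bimodule.whiskerL_comp M f g
  id_whiskerLeft f := Bimodule.id_whiskerL _ f
  comp_whiskerLeft M N _ _ f := Bimodule.tensor_whiskerL M N f
  id_whiskerRight M N := Bimodule.id_whiskerR M N
  comp_whiskerRight f g N := Bimodule.comp_whiskerR N f g
  whiskerRight_id f := Bimodule.whiskerR_id _ f
  whiskerRight_comp f N P := Bimodule.whiskerR_tensor N P f
  whisker_assoc M _ _ f P := Bimodule.whisker_assoc' M P f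
  whisker_exchange f g := Bimodule.whisker_exchange' f g
  pentagon M N P Q := Bimodule.pentagon' M N P Q
  triangle M N := Bimodule.triangle' M N

instance : LocallyIdempotentComplete (OrbCompletion B) where
  idem x y := LocallyIdempotentComplete.idem (B := EqCompletion B) ⟨x.pt, x.alg⟩ ⟨y.pt, y.alg⟩

/-- The embedding of `B` in its orbifold completion: `a` is sent to `(a, 𝟙 a)`. -/
noncomputable def OrbCompletion.embedding (B : Type u) [Bicategory.{w, v} B] [Pivotal B]
    [LocallyIdempotentComplete B] : B ⥤ᵖ OrbCompletion B where
  obj a := ⟨a, unitAlg a, unitAlg_isSymmetric a⟩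
  map f := unitBimodule f
  map₂ η := unitBimoduleMap η
  map₂_id _ := rfl
  map₂_comp _ _ := rfl
  mapId a := unitBimoduleId a
  mapComp f g := (unitBimoduleCompIso f g).symm
  map₂_whisker_left f _ _ η := unitBimoduleComp_map_whiskerL f η
  map₂_whisker_right η h := unitBimoduleComp_map_whiskerR η h
  map₂_associator f g h := unitBimoduleComp_associator f g h
  map₂_left_unitor f := unitBimoduleComp_leftUnitor f
  map₂_right_unitor f := unitBimoduleComp_rightUnitor f

section Pairs

variable {a b : B} {A : SepFrobAlg a} {C : SepFrobAlg b} (M : Bimodule A C)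

/-- `X†` is a right dual of `X`. -/
def dualPairRight (hC : C.IsSymmetric) : DualPair M (M.dual hC) where
  adj := radj M.X
  counit_l := M.dagR_counit
  counit_r := M.coact_counit hC

/-- `X†` is a left dual of `X`. -/
def dualPairLeft (hA : A.IsSymmetric) (hC : C.IsSymmetric) : DualPair (M.dual hC) M where
  adj := ladj M.X
  counit_l := by
    change M.r ▷ dag M.X ≫ _ = _ ≫ M.X ◁ M.dagL ≫ _
    rw [dagL_counit]; exact (Iso.hom_inv_id_assoc _ _).symm
  counit_r := by
    refine Eq.trans ?_ (M.evL_eq hA)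
    rw [evL]
    change M.X ◁ ((ρ_ _).inv ≫ dag M.X ◁ (A.one ≫ A.comul) ≫ (α_ _ _ _).inv ≫ M.dagR ▷ A.X) ≫
      (α_ M.X (dag M.X) A.X).inv ≫ (ladj M.X).counit ▷ A.X ≫ (λ_ _).hom = _
    rw [SepFrobAlg.copairing]
    bicategory

end Pairs

/-- A dual pair of bimodules is an adjunction. -/
noncomputable def DualPair.toAdj {x y : OrbCompletion B} {M : Bimodule x.alg y.alg}
    {N : Bimodule y.alg x.alg} (d : DualPair M N) :
    Bicategory.Adjunction (B := OrbCompletion B) (a := x) (b := y) M N where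
  unit := d.unitHom
  counit := d.counitHom
  left_triangle := leftZigzag_eq (B := OrbCompletion B) (a := x) (b := y) (f := M) (g := N) _ _
    d.left_triangle
  right_triangle := rightZigzag_eq (B := OrbCompletion B) (a := x) (b := y) (f := M) (g := N) _ _
    d.right_triangle

lemma DualPair.conj_hom {a b : B} {A : SepFrobAlg a} {C : SepFrobAlg b}
    {M M' : Bimodule A C} {N N' : Bimodule C A} (d : DualPair M N) (d' : DualPair M' N')
    (φ : M' ⟶ M) (ψ : N ⟶ N') (h : whiskerR ψ M' ≫ d'.counitHom = N.whiskerL φ ≫ d.counitHom) :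
    ψ.hom ▷ M'.X ≫ d'.adj.counit = N.X ◁ φ.hom ≫ d.adj.counit := by
  have h₁ := congrArg (fun k => N.ϑ M' ≫ Bimodule.Hom.hom k ≫ C.counit) h
  simp only [comp_hom', Category.assoc, ϑ_whiskerR_assoc, ϑ_whiskerL_assoc,
    reassoc_of% DualPair.ϑ_counitHom, DualPair.ev_counit] at h₁
  exact h₁

section CompPairs

variable {a b c : B} {A : SepFrobAlg a} {C : SepFrobAlg b} {E : SepFrobAlg c}
  {M : Bimodule A C} {N : Bimodule C A} {M' : Bimodule C E} {N' : Bimodule E C}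
  (d : DualPair M N) (d' : DualPair M' N')

namespace DualPair

/-- The counit of the composite of two adjunctions of bimodules. -/
noncomputable def compCounitHom : (N'.tensor N).tensor (M.tensor M') ⟶ unit E :=
  (associator N' N (M.tensor M')).hom ≫ N'.whiskerL ((associator N M M').inv ≫
    whiskerR d.counitHom M' ≫ (leftUnitor M').hom) ≫ d'.counitHom

lemma ϑ_compCounitHom : (N'.X ≫ N.X) ◁ M.ϑ M' ≫ N'.ϑ N ▷ (M.tensor M').X ≫
    (N'.tensor N).ϑ (M.tensor M') ≫ (compCounitHom d d').hom =
      (α_ _ _ _).hom ≫ N'.X ◁ ((α_ _ _ _).inv ≫ d.ev ▷ M'.X ≫ M'.l) ≫ d'.ev := by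
  simp only [compCounitHom, comp_hom', ϑ_associator_assoc, ϑ_whiskerL_assoc, ϑ_counitHom]
  have h : N.X ◁ M.ϑ M' ≫ N.ϑ (M.tensor M') ≫ (associator N M M').inv.hom ≫
      (whiskerR d.counitHom M').hom ≫ (leftUnitor M').hom.hom =
        (α_ _ _ _).inv ≫ d.ev ▷ M'.X ≫ M'.l := by
    rw [ϑ_associator_inv_assoc, ϑ_whiskerR_assoc, ϑ_leftUnitor, ← comp_whiskerRight_assoc,
      ϑ_counitHom]
  rw [← h]
  bicategory

lemma comp_right (Z : Bimodule E A) (dZ : DualPair (M.tensor M') Z) (κ : Z ⟶ N'.tensor N)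
    (h : whiskerR κ (M.tensor M') ≫ compCounitHom d d' = dZ.counitHom) :
    (κ.hom ≫ N'.ξ N) ▷ (M.X ≫ M'.X) ≫ (d.adj.comp d'.adj).counit =
      Z.X ◁ M.ϑ M' ≫ dZ.adj.counit := by
  have h₁ := congrArg (fun k => Z.X ◁ M.ϑ M' ≫ Z.ϑ (M.tensor M') ≫ Bimodule.Hom.hom k ≫ E.counit) h
  simp only [comp_hom', Category.assoc, ϑ_whiskerR_assoc,
    reassoc_of% DualPair.ϑ_counitHom, DualPair.ev_counit] at h₁
  rw [← h₁]
  have h₂ : κ.hom ≫ N'.ξ N = (κ.hom ≫ N'.ξ N) ≫ N'.proj N := by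
    rw [← ϑ_ξ]; simp
  rw [h₂, comp_whiskerRight, Category.assoc, proj_compCounit_left, ← d'.ev_counit]
  have h₃ := ϑ_compCounitHom d d'
  calc _ = (κ.hom ≫ N'.ξ N) ▷ (M.X ≫ M'.X) ≫ ((α_ _ _ _).hom ≫
          N'.X ◁ ((α_ _ _ _).inv ≫ d.ev ▷ M'.X ≫ M'.l) ≫ d'.ev) ≫ E.counit := by
        simp only [Category.assoc]
    _ = ((κ.hom ≫ N'.ξ N) ▷ (M.X ≫ M'.X) ≫ (N'.X ≫ N.X) ◁ M.ϑ M') ≫ N'.ϑ N ▷ (M.tensor M').X ≫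
          (N'.tensor N).ϑ (M.tensor M') ≫ (compCounitHom d d').hom ≫ E.counit := by
        rw [← h₃]; simp only [Category.assoc]
    _ = Z.X ◁ M.ϑ M' ≫ (κ.hom ≫ N'.ξ N ≫ N'.ϑ N) ▷ (M.tensor M').X ≫
          (N'.tensor N).ϑ (M.tensor M') ≫ (compCounitHom d d').hom ≫ E.counit := by
        rw [← whisker_exchange]; simp only [Category.assoc, comp_whiskerRight]
    _ = _ := by rw [ξ_ϑ, Category.comp_id]

lemma comp_left (Z : Bimodule A E) (dZ : DualPair Z (N'.tensor N)) (κ : Z ⟶ M.tensor M')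
    (h : (N'.tensor N).whiskerL κ ≫ compCounitHom d d' = dZ.counitHom) :
    (N'.X ≫ N.X) ◁ (κ.hom ≫ M.ξ M') ≫ (d.adj.comp d'.adj).counit =
      N'.ϑ N ▷ Z.X ≫ dZ.adj.counit := by
  have h₁ := congrArg (fun k => N'.ϑ N ▷ Z.X ≫ (N'.tensor N).ϑ Z ≫
    Bimodule.Hom.hom k ≫ E.counit) h
  simp only [comp_hom', Category.assoc, ϑ_whiskerL_assoc,
    reassoc_of% DualPair.ϑ_counitHom, DualPair.ev_counit] at h₁
  rw [← h₁]
  have h₂ : κ.hom ≫ M.ξ M' = (κ.hom ≫ M.ξ M') ≫ M.proj M' := by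
    rw [← ϑ_ξ]; simp
  rw [h₂, whiskerLeft_comp, Category.assoc, proj_compCounit_right, ← d'.ev_counit]
  have h₃ := ϑ_compCounitHom d d'
  calc _ = (N'.X ≫ N.X) ◁ (κ.hom ≫ M.ξ M') ≫ ((α_ _ _ _).hom ≫
          N'.X ◁ ((α_ _ _ _).inv ≫ d.ev ▷ M'.X ≫ M'.l) ≫ d'.ev) ≫ E.counit := by
        simp only [Category.assoc]
    _ = (N'.X ≫ N.X) ◁ (κ.hom ≫ M.ξ M' ≫ M.ϑ M') ≫ N'.ϑ N ▷ (M.tensor M').X ≫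
          (N'.tensor N).ϑ (M.tensor M') ≫ (compCounitHom d d').hom ≫ E.counit := by
        rw [← h₃]; simp only [Category.assoc, whiskerLeft_comp]
    _ = _ := by rw [ξ_ϑ, Category.comp_id, whisker_exchange_assoc]

end DualPair
end CompPairs

lemma orb_dag_map {x y : OrbCompletion B} {M N : Bimodule x.alg y.alg} (φ : M ⟶ N) :
    conjugateEquiv (B := OrbCompletion B) (c := x) (d := y)
      (dualPairRight N y.symm).toAdj (dualPairRight M y.symm).toAdj φ =
      (conjugateEquiv (B := OrbCompletion B) (c := y) (d := x)
        (dualPairLeft M x.symm y.symm).toAdj (dualPairLeft N x.symm y.symm).toAdj).symm φ := by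
  have h₁ := DualPair.conj_hom (dualPairRight N y.symm) (dualPairRight M y.symm) φ _
    (conj_counit (B := OrbCompletion B) (a := x) (b := y)
      (dualPairRight N y.symm).toAdj (dualPairRight M y.symm).toAdj φ)
  have h₂ := DualPair.conj_hom (dualPairLeft M x.symm y.symm) (dualPairLeft N x.symm y.symm) _ φ
    (conj_symm_counit (B := OrbCompletion B) (a := y) (b := x)
      (dualPairLeft M x.symm y.symm).toAdj (dualPairLeft N x.symm y.symm).toAdj φ)
  apply Bimodule.hom_ext
  have h₃ := ext_counit_right (radj M.X) (h₁.trans (conj_counit (radj N.X) (radj M.X) φ.hom).symm)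
  have h₄ := ext_counit_left (ladj M.X) (h₂.symm.trans (conj_symm_counit (ladj M.X) (ladj N.X) φ.hom))
  exact h₃.trans ((dag_map φ.hom).trans h₄.symm)

lemma orb_dag_comp {x y z : OrbCompletion B} (M : Bimodule x.alg y.alg)
    (N : Bimodule y.alg z.alg) :
    conjugateEquiv (B := OrbCompletion B) (c := x) (d := z)
      (dualPairRight (M.tensor N) z.symm).toAdj
      ((dualPairRight M y.symm).toAdj.comp (dualPairRight N z.symm).toAdj) (𝟙 (M.tensor N)) =
    (conjugateEquiv (B := OrbCompletion B) (c := z) (d := x)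
      ((dualPairLeft N y.symm z.symm).toAdj.comp (dualPairLeft M x.symm y.symm).toAdj)
      (dualPairLeft (M.tensor N) x.symm z.symm).toAdj).symm (𝟙 (M.tensor N)) := by
  have h₁ := conj_comp_right (B := OrbCompletion B) (a := x) (b := y) (c := z) (f₁ := M) (f₂ := N)
      (dualPairRight (M.tensor N) z.symm).toAdj
      (dualPairRight M y.symm).toAdj (dualPairRight N z.symm).toAdj
  have h₂ := conj_comp_left (B := OrbCompletion B) (a := z) (b := y) (c := x) (g₂ := M) (g₁ := N)
      (dualPairLeft (M.tensor N) x.symm z.symm).toAdj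
      (dualPairLeft N y.symm z.symm).toAdj (dualPairLeft M x.symm y.symm).toAdj
  have k₁ := DualPair.comp_right (dualPairRight M y.symm) (dualPairRight N z.symm) _
    (dualPairRight (M.tensor N) z.symm) _ h₁
  have k₂ := DualPair.comp_left (dualPairLeft N y.symm z.symm) (dualPairLeft M x.symm y.symm) _
    (dualPairLeft (M.tensor N) x.symm z.symm) _ h₂
  have k₃ := ext_counit_right ((radj M.X).comp (radj N.X))
    (k₁.trans (conj_counit (radj (M.tensor N).X) ((radj M.X).comp (radj N.X)) (M.ϑ N)).symm)
  have k₄ := ext_counit_left ((ladj N.X).comp (ladj M.X))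
    (k₂.trans (conj_symm_counit ((ladj N.X).comp (ladj M.X)) (ladj (M.tensor N).X) (M.ϑ N)))
  have k₅ := k₃.trans ((dag_map_comp M.X N.X (M.ϑ N)).trans k₄.symm)
  apply Bimodule.hom_ext
  have hs : Mono (Bimodule.ξ (N.dual z.symm) (M.dual y.symm)) :=
    (SplitMono.mk (Bimodule.ϑ (N.dual z.symm) (M.dual y.symm)) (by simp)).mono
  exact hs.right_cancellation _ _ k₅

/-- The orbifold completion is pivotal: the adjoint of a bimodule `X` is `X†` with the dual actions,
and the adjunction maps are those of `B` combined with the (co)actions of the algebras. -/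
noncomputable instance : Pivotal (OrbCompletion B) where
  dag {_ y} M := Bimodule.dual M y.symm
  radj {_ y} M := (dualPairRight M y.symm).toAdj
  ladj {x y} M := (dualPairLeft M x.symm y.symm).toAdj
  dag_map φ := orb_dag_map φ
  dag_comp M N := orb_dag_comp M N

end Orb

section Biequivalence

/-- A pseudofunctor is an equivalence of bicategories if it is an equivalence on all categories of
1-morphisms (that is, it is a full embedding) and is essentially surjective: every object is
equivalent, by an adjoint equivalence in the target, to one in the image. -/
structure IsBiequivalence {B : Type*} [Bicategory B] {C : Type*} [Bicategory C]
    (F : B ⥤ᵖ C) : Prop where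
  local_equivalence (a b : B) : (F.mapFunctor a b).IsEquivalence
  essSurj (c : C) : ∃ a : B, Nonempty (Bicategory.Equivalence (F.obj a) c)

end Biequivalence

end OrbifoldCompletion

open OrbifoldCompletion

/-! Fullness is formal. The unit of a unit algebra is an identity 2-morphism, so the unit laws force
both actions on a bimodule over unit algebras to be unitors. Such a bimodule is no more than a
1-morphism, and every 2-morphism is linear (`isEquivalence_of_unitBimodule`).

For essential surjectivity, let `T` be a separable Frobenius algebra on `(a, A)` in the completion,
that is, one among `A`-`A`-bimodules. Forgetting `A` gives an algebra `T'` on `a` with the same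
underlying 1-morphism. Its multiplication is `T ≫ T → T ⊗_A T → T`, its unit `𝟙 → A → T`, its
comultiplication `T → T ⊗_A T → T ≫ T`, its counit `T → A → 𝟙`. Here the projection `ϑ` and its
section `ξ` pass between `T ≫ T` and `T ⊗_A T`. Since `ξ` followed by `ϑ` is the identity,
separability survives strictly. The coalgebra and Frobenius laws survive because `ξ` is compatible
with bimodule maps, associators and unitors (`ξ_whiskerRight`, `ϑ_associator_ξ`, `associator_ξ`,
`leftUnitor_inv_ξ_counit`). The result is `RelSepFrobAlg.alg`.

The object `((a, A), T)` is then equivalent to the image of `(a, T')`. Read `T` as a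
`T'`-`A`-bimodule `X` with a right action of `T`, and as an `A`-`T'`-bimodule `Y` with a left action
of `T`. The product of `Y` and `X` over `T'` is `T' ⊗_{T'} T'`, hence `T`. The product of `X` and
`Y` over `T` is `T'`: multiplication out of `X ⊗_A Y` is a split coequaliser of the two actions of
`T`, where separability provides the section and the Frobenius relation identifies the resulting
idempotent (`coev_ev`, `ev_coev`). The structure `SepFrobAlg.Splitting` isolates this situation in
an arbitrary bicategory, so that one argument serves both completions.

In the orbifold case it remains to see that `T'` is symmetric if `T` is
(`OrbCompletion.relAlg_alg_isSymmetric`). The counits of the adjunctions in the completion, followed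
by the counit of `A`, are the counits in `B`. Hence the two maps `T → T†` of the completion have as
underlying 2-morphisms the two maps `T' → T'†` of `B`. -/

namespace OrbifoldCompletion

/-! ### Bimodules over unit algebras are plain 1-morphisms. -/

section LocalEquivalence

variable {B : Type u} [Bicategory.{w, v} B]

/-- A bimodule over unit algebras has trivial actions. -/
def isoUnitBimodule {a b : B} (M : Bimodule (unitAlg a) (unitAlg b)) : unitBimodule M.X ≅ M :=
  -- The unit of `unitAlg a` is an identity, so the unit law already determines the action; likewise
  -- on the right.
  have hl : M.l = (λ_ M.X).hom := by
    have h := M.one_l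
    rwa [show (unitAlg a).one = 𝟙 _ from rfl, id_whiskerRight, Category.id_comp] at h
  have hr : M.r = (ρ_ M.X).hom := by
    have h := M.r_one
    rwa [show (unitAlg b).one = 𝟙 _ from rfl, whiskerLeft_id, Category.id_comp] at h
  Bimodule.isoOfHom
    { hom := 𝟙 M.X
      l_hom := by
        rw [hl, whiskerLeft_id, Category.id_comp, Category.comp_id]
      r_hom := by
        rw [hr, id_whiskerRight, Category.id_comp, Category.comp_id] } (𝟙 M.X)
    (Category.comp_id _) (Category.comp_id _)

/-- The functor sending 1-morphisms to bimodules over unit algebras is an equivalence. -/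
lemma isEquivalence_of_unitBimodule {a b : B}
    (F : (a ⟶ b) ⥤ Bimodule (unitAlg a) (unitAlg b)) (hobj : ∀ f, F.obj f = unitBimodule f)
    (hmap : ∀ {f g : a ⟶ b} (η : f ⟶ g), F.map η ≍ unitBimoduleMap η) : F.IsEquivalence where
  faithful := ⟨fun {f g} η θ h => by
    have h' : unitBimoduleMap η = unitBimoduleMap θ :=
      eq_of_heq ((hmap η).symm.trans ((heq_of_eq h).trans (hmap θ)))
    exact congrArg Bimodule.Hom.hom h'⟩
  full := ⟨fun {f g} φ => by
    -- The values of `F` are only propositionally unit bimodules. Transporting `φ` along these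
    -- equalities exposes an underlying 2-morphism `f ⟶ g`, which is the preimage; linearity imposes
    -- no condition on it.
    let φ' : unitBimodule f ⟶ unitBimodule g := eqToHom (hobj f).symm ≫ φ ≫ eqToHom (hobj g)
    refine ⟨φ'.hom, eq_of_heq ((hmap _).trans ?_)⟩
    change φ' ≍ φ
    simp [φ']⟩
  essSurj := ⟨fun M => ⟨M.X, ⟨eqToIso (hobj _) ≪≫ isoUnitBimodule M⟩⟩⟩

end LocalEquivalence

/-! ### Algebras that split as a composite of two modules are equivalent to unit algebras. -/

section Splitting

variable {D : Type u} [Bicategory.{w, v} D]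

/-- A presentation of the separable Frobenius algebra `T` on `d` as `Y ≫ X` for a right module
`X : e ⟶ d` and a left module `Y : d ⟶ e`, such that `ev : X ≫ Y ⟶ 𝟙 e` is a split coequaliser of
the two actions of `T`. -/
structure SepFrobAlg.Splitting {d : D} (T : SepFrobAlg d) (e : D) where
  X : e ⟶ d
  Y : d ⟶ e
  r : X ≫ T.X ⟶ X
  l : T.X ≫ Y ⟶ Y
  r_assoc : X ◁ T.mul ≫ r = (α_ X T.X T.X).inv ≫ r ▷ T.X ≫ r
  r_one : X ◁ T.one ≫ r = (ρ_ X).hom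
  l_assoc : T.mul ▷ Y ≫ l = (α_ T.X T.X Y).hom ≫ T.X ◁ l ≫ l
  one_l : T.one ▷ Y ≫ l = (λ_ Y).hom
  ev : X ≫ Y ⟶ 𝟙 e
  coev : 𝟙 e ⟶ X ≫ Y
  coact : X ⟶ X ≫ T.X
  coev_ev : coev ≫ ev = 𝟙 _
  ev_balanced : r ▷ Y ≫ ev = (α_ _ _ _).hom ≫ X ◁ l ≫ ev
  coact_r : coact ≫ r = 𝟙 X
  ev_coev : ev ≫ coev = coact ▷ Y ≫ (α_ _ _ _).hom ≫ X ◁ l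
  iso : Y ≫ X ≅ T.X
  l_iso : T.X ◁ iso.hom ≫ T.mul = (α_ _ _ _).inv ≫ l ▷ X ≫ iso.hom
  iso_r : iso.hom ▷ T.X ≫ T.mul = (α_ _ _ _).hom ≫ Y ◁ r ≫ iso.hom

namespace SepFrobAlg.Splitting

variable {d e : D} {T : SepFrobAlg d} (S : T.Splitting e)

/-- The right module `X` as a bimodule over a unit algebra and `T`. -/
@[reducible]
def bimoduleX : Bimodule (unitAlg e) T where
  X := S.X
  l := (λ_ _).hom
  r := S.r
  l_assoc := by bicategory
  one_l := by bicategory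
  r_assoc := S.r_assoc
  r_one := S.r_one
  l_r := by bicategory

/-- The left module `Y` as a bimodule over `T` and a unit algebra. -/
@[reducible]
def bimoduleY : Bimodule T (unitAlg e) where
  X := S.Y
  l := S.l
  r := (ρ_ _).hom
  l_assoc := S.l_assoc
  one_l := S.one_l
  r_assoc := by bicategory
  r_one := by bicategory
  l_r := by bicategory

variable [LocallyIdempotentComplete D]

/-- The tensor product of `X` and `Y` over `T` is trivial. -/
noncomputable def tensorIso : S.bimoduleX.tensor S.bimoduleY ≅ Bimodule.unit (unitAlg e) :=
  Bimodule.isoOfHom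
    (Bimodule.descHom (M := S.bimoduleX) (N := S.bimoduleY) (T := Bimodule.unit (unitAlg e))
      S.ev S.ev_balanced
      -- The outer actions are those of a unit algebra, hence unitors, and linearity of `S.ev` is
      -- coherence.
      (by change 𝟙 e ◁ S.ev ≫ (λ_ _).hom = (α_ _ _ _).inv ≫ (λ_ _).hom ▷ S.Y ≫ S.ev
          bicategory)
      (by change S.ev ▷ 𝟙 e ≫ (λ_ _).hom = (α_ _ _ _).hom ≫ S.X ◁ (ρ_ _).hom ≫ S.ev
          bicategory))
    (S.coev ≫ S.bimoduleX.ϑ S.bimoduleY)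
    (by
      rw [← cancel_epi (S.bimoduleX.ϑ S.bimoduleY), ← Category.assoc, Bimodule.ϑ_descHom]
      change S.ev ≫ S.coev ≫ _ = _
      -- After this rewriting the composite coacts on `X` and then acts on `Y`. In the tensor
      -- product over `T` the action may be moved from `Y` to `X`, where it cancels the coaction by
      -- `S.coact_r`.
      rw [reassoc_of% S.ev_coev]
      have h := S.bimoduleX.ϑ_balanced S.bimoduleY
      change S.r ▷ S.Y ≫ _ = (α_ S.X T.X S.Y).hom ≫ S.X ◁ S.l ≫ _ at h
      rw [← h, ← comp_whiskerRight_assoc, S.coact_r, id_whiskerRight, Category.id_comp,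
        Category.comp_id])
    (by
      rw [Category.assoc, Bimodule.ϑ_descHom]
      exact S.coev_ev)

/-- The composite of `Y` and `X` is `T`, as a bimodule over itself. -/
noncomputable def tensorIso' : S.bimoduleY.tensor S.bimoduleX ≅ Bimodule.unit T :=
  Bimodule.isoOfHom
    (Bimodule.descHom (M := S.bimoduleY) (N := S.bimoduleX) (T := Bimodule.unit T)
      S.iso.hom
      -- Balancedness over a unit algebra is the triangle identity; the content lies in `S.l_iso`
      -- and `S.iso_r`, which make the isomorphism linear over `T` on both sides.
      (by change (ρ_ S.Y).hom ▷ S.X ≫ S.iso.hom = (α_ _ _ _).hom ≫ S.Y ◁ (λ_ _).hom ≫ S.iso.hom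
          bicategory)
      S.l_iso S.iso_r)
    (S.iso.inv ≫ S.bimoduleY.ϑ S.bimoduleX)
    (by
      rw [← cancel_epi (S.bimoduleY.ϑ S.bimoduleX), ← Category.assoc, Bimodule.ϑ_descHom,
        Iso.hom_inv_id_assoc, Category.comp_id])
    (by
      rw [Category.assoc, Bimodule.ϑ_descHom, Iso.inv_hom_id])

/-- A split algebra is equivalent to a unit algebra in the equivariant completion. -/
noncomputable def eqEquivalence :
    Bicategory.Equivalence (B := EqCompletion D) ⟨e, unitAlg e⟩ ⟨d, T⟩ :=
  -- The two isomorphisms are not claimed to satisfy the triangle identities: the counit is replaced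
  -- by its adjointified version.
  Bicategory.Equivalence.mkOfAdjointifyCounit (B := EqCompletion D)
    (a := ⟨e, unitAlg e⟩) (b := ⟨d, T⟩) (f := S.bimoduleX) (g := S.bimoduleY)
    S.tensorIso.symm S.tensorIso'

/-- A split symmetric algebra is equivalent to a unit algebra in the orbifold completion. -/
noncomputable def orbEquivalence [Pivotal D] (hT : T.IsSymmetric) :
    Bicategory.Equivalence (B := OrbCompletion D) ⟨e, unitAlg e, unitAlg_isSymmetric e⟩
      ⟨d, T, hT⟩ :=
  Bicategory.Equivalence.mkOfAdjointifyCounit (B := OrbCompletion D)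
    (a := ⟨e, unitAlg e, unitAlg_isSymmetric e⟩) (b := ⟨d, T, hT⟩)
    (f := S.bimoduleX) (g := S.bimoduleY) S.tensorIso.symm S.tensorIso'

end SepFrobAlg.Splitting

end Splitting

/-! ### Fullness of the embeddings. -/

section LocalEquivalenceEmbedding

variable (B : Type u) [Bicategory.{w, v} B] [LocallyIdempotentComplete B]

/-- This holds for the embedding of any `B` with split idempotents. The iterated completion is the
case where `B` is itself a completion. -/
lemma EqCompletion.embedding_mapFunctor_isEquivalence (a b : B) :
    ((EqCompletion.embedding B).mapFunctor a b).IsEquivalence :=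
  isEquivalence_of_unitBimodule ((EqCompletion.embedding B).mapFunctor a b)
    (fun _ => rfl) (fun _ => HEq.rfl)

lemma OrbCompletion.embedding_mapFunctor_isEquivalence [Pivotal B] (a b : B) :
    ((OrbCompletion.embedding B).mapFunctor a b).IsEquivalence :=
  isEquivalence_of_unitBimodule ((OrbCompletion.embedding B).mapFunctor a b)
    (fun _ => rfl) (fun _ => HEq.rfl)

end LocalEquivalenceEmbedding

/-! ### How the section `ξ` of the relative tensor product interacts with maps, associators and
unitors. -/

section TensorSection

variable {B : Type u} [Bicategory.{w, v} B]

namespace Bimodule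

variable {a b c d : B} {A : SepFrobAlg a} {C : SepFrobAlg b} {E : SepFrobAlg c}
  {G : SepFrobAlg d}

/-- The idempotent is built from the coaction on the first factor and the action on the second.
Bimodule maps commute with both, so the idempotent is natural in each variable. -/
lemma proj_whiskerRight {M M' : Bimodule A C} (f : M ⟶ M') (N : Bimodule C E) :
    M.proj N ≫ f.hom ▷ N.X = f.hom ▷ N.X ≫ M'.proj N := by
  calc _ = M.coact ▷ N.X ⊗≫ (M.X ◁ N.l ≫ f.hom ▷ N.X) := by
        rw [proj]; bicategory
    _ = (M.coact ≫ f.hom ▷ C.X) ▷ N.X ⊗≫ M'.X ◁ N.l := by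
        rw [whisker_exchange]; bicategory
    _ = _ := by rw [coact_hom, proj]; bicategory

lemma proj_whiskerLeft (M : Bimodule A C) {N N' : Bimodule C E} (f : N ⟶ N') :
    M.proj N ≫ M.X ◁ f.hom = M.X ◁ f.hom ≫ M.proj N' := by
  calc _ = M.coact ▷ N.X ⊗≫ M.X ◁ (N.l ≫ f.hom) := by
        rw [proj]; bicategory
    _ = (M.coact ▷ N.X ≫ (M.X ≫ C.X) ◁ f.hom) ⊗≫ M.X ◁ N'.l := by
        rw [← f.l_hom]; bicategory
    _ = _ := by rw [← whisker_exchange, proj]; bicategory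

/-- For the regular bimodule the induced coaction multiplies by the copairing, which by the
Frobenius relation is comultiplication. -/
lemma unit_coact (A : SepFrobAlg a) : (unit A).coact = A.comul := by
  rw [← A.copairing_mul_right]; rfl

lemma unit_proj (M : Bimodule A C) :
    (unit A).proj M = A.comul ▷ M.X ≫ (α_ _ _ _).hom ≫ A.X ◁ M.l := by
  rw [proj, unit_coact]

lemma proj_unit (M : Bimodule A C) :
    M.proj (unit C) = M.coact ▷ C.X ≫ (α_ _ _ _).hom ≫ M.X ◁ C.mul := rfl

variable [LocallyIdempotentComplete B]

/-- Naturality of the section, inherited from that of the idempotent. Being a coequaliser gives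
naturality of `ϑ` only; comultiplications land in tensor products and need it for `ξ` too. -/
lemma ξ_whiskerRight {M M' : Bimodule A C} (f : M ⟶ M') (N : Bimodule C E) :
    M.ξ N ≫ f.hom ▷ N.X = (whiskerR f N).hom ≫ M'.ξ N := by
  rw [← cancel_epi (M.ϑ N), ϑ_whiskerR_assoc, reassoc_of% M.ϑ_ξ N, proj_whiskerRight, ϑ_ξ]

lemma ξ_whiskerLeft (M : Bimodule A C) {N N' : Bimodule C E} (f : N ⟶ N') :
    M.ξ N ≫ M.X ◁ f.hom = (M.whiskerL f).hom ≫ M.ξ N' := by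
  rw [← cancel_epi (M.ϑ N), ϑ_whiskerL_assoc, reassoc_of% M.ϑ_ξ N, proj_whiskerLeft, ϑ_ξ]

lemma ξ_r (M : Bimodule A C) (N : Bimodule C E) :
    M.ξ N ▷ E.X ≫ (α_ _ _ _).hom ≫ M.X ◁ N.r = (M.tensor N).r ≫ M.ξ N := by
  rw [← cancel_epi (M.ϑ N ▷ E.X), ← comp_whiskerRight_assoc, ϑ_ξ, reassoc_of% M.ϑ_r N, ϑ_ξ,
    r_proj]

/-- The right action on a tensor product comes from the second factor, and therefore so does the
induced coaction. -/
lemma ϑ_coact (M : Bimodule A C) (N : Bimodule C E) :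
    M.ϑ N ≫ (M.tensor N).coact = M.X ◁ N.coact ≫ (α_ _ _ _).inv ≫ M.ϑ N ▷ E.X := by
  calc _ = 𝟙 _ ⊗≫ (M.ϑ N ▷ 𝟙 c ≫ (M.tensor N).X ◁ (E.one ≫ E.comul)) ⊗≫
          (M.tensor N).r ▷ E.X := by rw [coact]; bicategory
    _ = 𝟙 _ ⊗≫ (M.X ≫ N.X) ◁ (E.one ≫ E.comul) ⊗≫ (M.ϑ N ▷ E.X ≫ (M.tensor N).r) ▷ E.X := by
        rw [← whisker_exchange]; bicategory
    _ = _ := by rw [ϑ_r, coact]; bicategory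

/-- The idempotent of the outer product only sees the factors adjacent to `E`, because the coaction
of `M.tensor N` is that of `N`. This allows iterated tensor products to be computed on the threefold
composite. -/
lemma ϑ_proj_tensor_left (M : Bimodule A C) (N : Bimodule C E) (P : Bimodule E G) :
    M.ϑ N ▷ P.X ≫ (M.tensor N).proj P =
      (α_ _ _ _).hom ≫ M.X ◁ N.proj P ≫ (α_ _ _ _).inv ≫ M.ϑ N ▷ P.X := by
  calc _ = (M.ϑ N ≫ (M.tensor N).coact) ▷ P.X ⊗≫ (M.tensor N).X ◁ P.l := by
        rw [proj]; bicategory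
    _ = 𝟙 _ ⊗≫ M.X ◁ N.coact ▷ P.X ⊗≫ (M.ϑ N ▷ (E.X ≫ P.X) ≫ (M.tensor N).X ◁ P.l) := by
        rw [ϑ_coact]; bicategory
    _ = _ := by rw [← whisker_exchange, proj]; bicategory

/-- The mirror image of `ϑ_proj_tensor_left`: here the left action of `N.tensor P` is that of `N`.
-/
lemma ϑ_proj_tensor_right (M : Bimodule A C) (N : Bimodule C E) (P : Bimodule E G) :
    M.X ◁ N.ϑ P ≫ M.proj (N.tensor P) =
      (α_ _ _ _).inv ≫ M.proj N ▷ P.X ≫ (α_ _ _ _).hom ≫ M.X ◁ N.ϑ P := by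
  calc _ = (M.X ◁ N.ϑ P ≫ M.coact ▷ (N.tensor P).X) ⊗≫ M.X ◁ (N.tensor P).l := by
        rw [proj]; bicategory
    _ = M.coact ▷ (N.X ≫ P.X) ⊗≫ M.X ◁ (C.X ◁ N.ϑ P ≫ (N.tensor P).l) := by
        rw [whisker_exchange]; bicategory
    _ = _ := by rw [ϑ_l, proj]; bicategory

/-- With a projection before and a section after it, rebracketing becomes a splitting of one pair
followed by a fusion of the other. This is the shape of the Frobenius relations, for which it is
used. -/
lemma ϑ_associator_inv_ξ (M : Bimodule A C) (N : Bimodule C E) (P : Bimodule E G) :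
    M.ϑ (N.tensor P) ≫ (associator M N P).inv.hom ≫ (M.tensor N).ξ P =
      M.X ◁ N.ξ P ≫ (α_ _ _ _).inv ≫ M.ϑ N ▷ P.X := by
  rw [← cancel_epi (M.X ◁ N.ϑ P), ϑ_associator_inv_assoc, ϑ_ξ, ϑ_proj_tensor_left,
    ← whiskerLeft_comp_assoc, ϑ_ξ, Iso.inv_hom_id_assoc]

lemma ϑ_associator_ξ (M : Bimodule A C) (N : Bimodule C E) (P : Bimodule E G) :
    (M.tensor N).ϑ P ≫ (associator M N P).hom.hom ≫ M.ξ (N.tensor P) =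
      M.ξ N ▷ P.X ≫ (α_ _ _ _).hom ≫ M.X ◁ N.ϑ P := by
  rw [← cancel_epi (M.ϑ N ▷ P.X), ϑ_associator_assoc, ϑ_ξ, ϑ_proj_tensor_right,
    ← comp_whiskerRight_assoc, ϑ_ξ, Iso.hom_inv_id_assoc]

/-- The two ways to include a triple tensor product into the threefold composite agree because the
idempotents belonging to `C` and to `E` commute: the coaction of `E` on `N` is linear for the action
of `C`. Coassociativity depends on this. -/
lemma associator_ξ (M : Bimodule A C) (N : Bimodule C E) (P : Bimodule E G) :
    (associator M N P).hom.hom ≫ M.ξ (N.tensor P) ≫ M.X ◁ N.ξ P =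
      (M.tensor N).ξ P ≫ M.ξ N ▷ P.X ≫ (α_ _ _ _).hom := by
  rw [← cancel_epi ((M.tensor N).ϑ P), reassoc_of% ϑ_associator_ξ M N P,
    ← whiskerLeft_comp, ϑ_ξ, ← cancel_epi (M.ϑ N ▷ P.X), reassoc_of% (M.tensor N).ϑ_ξ P,
    reassoc_of% ϑ_proj_tensor_left M N P, ← comp_whiskerRight_assoc (M.ϑ N), ϑ_ξ,
    ← comp_whiskerRight_assoc (M.ϑ N), ϑ_ξ]
  calc _ = 𝟙 _ ⊗≫ M.coact ▷ (N.X ≫ P.X) ⊗≫ M.X ◁ N.l ▷ P.X ⊗≫ M.X ◁ N.coact ▷ P.X ⊗≫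
        M.X ◁ N.X ◁ P.l := by
        rw [proj, proj]; bicategory
    _ = 𝟙 _ ⊗≫ M.coact ▷ (N.X ≫ P.X) ⊗≫ M.X ◁ (N.l ≫ N.coact) ▷ P.X ⊗≫
        M.X ◁ N.X ◁ P.l := by bicategory
    -- `l_coact` swaps the action of `C` on `N` with the coaction of `E`; everything else that must
    -- be permuted acts on different factors and is handled by interchange.
    _ = 𝟙 _ ⊗≫ (M.coact ▷ (N.X ≫ P.X) ≫ (M.X ≫ C.X) ◁ N.coact ▷ P.X) ⊗≫
        M.X ◁ (N.l ▷ (E.X ≫ P.X) ≫ N.X ◁ P.l) := by rw [l_coact]; bicategory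
    _ = 𝟙 _ ⊗≫ M.X ◁ N.coact ▷ P.X ⊗≫ (M.coact ▷ (N.X ≫ E.X ≫ P.X) ≫
        (M.X ≫ C.X) ◁ (N.X ◁ P.l)) ⊗≫ M.X ◁ N.l ▷ P.X := by
        rw [← whisker_exchange, ← whisker_exchange]; bicategory
    _ = _ := by rw [← whisker_exchange, proj, proj]; bicategory

/-- The counit of `A` undoes the comultiplication inside the idempotent, leaving the unit of `A`
acting on `M`. This turns counitality over `A` into counitality in `B`. -/
lemma leftUnitor_inv_ξ_counit (M : Bimodule A C) :
    (leftUnitor M).inv.hom ≫ (unit A).ξ M ≫ A.counit ▷ M.X = (λ_ M.X).inv := by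
  have h : (leftUnitor M).inv.hom = (λ_ M.X).inv ≫ A.one ▷ M.X ≫ (unit A).ϑ M := rfl
  rw [h, Category.assoc, Category.assoc, reassoc_of% (unit A).ϑ_ξ M, unit_proj]
  calc _ = 𝟙 _ ⊗≫ A.one ▷ M.X ⊗≫ A.comul ▷ M.X ⊗≫ (A.X ◁ M.l ≫ A.counit ▷ M.X) := by bicategory
    _ = 𝟙 _ ⊗≫ A.one ▷ M.X ⊗≫ (A.comul ≫ A.counit ▷ A.X) ▷ M.X ⊗≫ 𝟙 a ◁ M.l := by
        rw [whisker_exchange]; bicategory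
    _ = 𝟙 _ ⊗≫ (A.one ▷ M.X ≫ M.l) ≫ (λ_ M.X).inv := by rw [A.counit_comul]; bicategory
    _ = _ := by rw [M.one_l]; bicategory

/-- The section after the inverse unitor amounts to the coaction of `C` on `M`, whose counitality is
`coact_counit'`. -/
lemma rightUnitor_inv_ξ_counit (M : Bimodule A C) :
    (rightUnitor M).inv.hom ≫ M.ξ (unit C) ≫ M.X ◁ C.counit = (ρ_ M.X).inv := by
  have h : (rightUnitor M).inv.hom = (ρ_ M.X).inv ≫ M.X ◁ C.one ≫ M.ϑ (unit C) := rfl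
  rw [h, Category.assoc, Category.assoc, reassoc_of% M.ϑ_ξ (unit C), proj_unit]
  refine Eq.trans ?_ (coact_counit' M)
  calc _ = 𝟙 _ ⊗≫ (M.X ◁ C.one ≫ M.coact ▷ C.X) ⊗≫ M.X ◁ C.mul ⊗≫ M.X ◁ C.counit := by
        bicategory
    _ = M.coact ⊗≫ M.X ◁ (C.X ◁ C.one ≫ C.mul) ⊗≫ M.X ◁ C.counit := by
        rw [whisker_exchange]; bicategory
    _ = _ := by rw [C.mul_one]; bicategory

end Bimodule

end TensorSection

/-! ### From an algebra over `A` to an algebra in `B`, and the bimodules relating the two. -/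

section RelativeAlgebra

variable {B : Type u} [Bicategory.{w, v} B] [LocallyIdempotentComplete B]

open Bimodule

/-- A separable Frobenius algebra in the category of bimodules over `A`. -/
structure RelSepFrobAlg {a : B} (A : SepFrobAlg a) where
  M : Bimodule A A
  mul : M.tensor M ⟶ M
  one : unit A ⟶ M
  comul : M ⟶ M.tensor M
  counit : M ⟶ unit A
  mul_assoc : whiskerR mul M ≫ mul = (associator M M M).hom ≫ M.whiskerL mul ≫ mul
  one_mul : whiskerR one M ≫ mul = (leftUnitor M).hom
  mul_one : M.whiskerL one ≫ mul = (rightUnitor M).hom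
  comul_assoc : comul ≫ whiskerR comul M ≫ (associator M M M).hom = comul ≫ M.whiskerL comul
  counit_comul : comul ≫ whiskerR counit M = (leftUnitor M).inv
  comul_counit : comul ≫ M.whiskerL counit = (rightUnitor M).inv
  frob_left : M.whiskerL comul ≫ (associator M M M).inv ≫ whiskerR mul M = mul ≫ comul
  frob_right : whiskerR comul M ≫ (associator M M M).hom ≫ M.whiskerL mul = mul ≫ comul
  separable : comul ≫ mul = 𝟙 M

namespace RelSepFrobAlg

variable {a : B} {A : SepFrobAlg a} (T : RelSepFrobAlg A)

/-- The multiplication before passing to the tensor product over `A`. -/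
noncomputable def mulX : T.M.X ≫ T.M.X ⟶ T.M.X := T.M.ϑ T.M ≫ T.mul.hom

/-- The comultiplication followed by the inclusion of the tensor product over `A`. -/
noncomputable def comulX : T.M.X ⟶ T.M.X ≫ T.M.X := T.comul.hom ≫ T.M.ξ T.M

lemma ϑ_mul : T.M.ϑ T.M ≫ T.mul.hom = T.mulX := rfl

lemma comulX_ϑ : T.comulX ≫ T.M.ϑ T.M = T.comul.hom := by
  rw [comulX, Category.assoc, ξ_ϑ, Category.comp_id]

/-- Between the two maps `ξ` meets `ϑ` and cancels, so strict separability is inherited without a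
correction factor. -/
lemma comulX_mulX : T.comulX ≫ T.mulX = 𝟙 _ := by
  rw [mulX, reassoc_of% T.comulX_ϑ]
  exact congrArg Bimodule.Hom.hom T.separable

lemma mulX_balanced : T.M.Balanced T.M T.mulX := by
  rw [Bimodule.Balanced, mulX, reassoc_of% T.M.ϑ_balanced T.M]

lemma l_mulX : T.M.l ▷ T.M.X ≫ T.mulX = (α_ _ _ _).hom ≫ A.X ◁ T.mulX ≫ T.M.l := by
  rw [mulX, reassoc_of% T.M.ϑ_l' T.M, whiskerLeft_comp, Category.assoc, T.mul.l_hom]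

lemma mulX_r : T.mulX ▷ A.X ≫ T.M.r = (α_ _ _ _).hom ≫ T.M.X ◁ T.M.r ≫ T.mulX := by
  rw [mulX, comp_whiskerRight, Category.assoc, T.mul.r_hom, reassoc_of% T.M.ϑ_r T.M]

lemma comulX_r : T.comulX ▷ A.X ≫ (α_ _ _ _).hom ≫ T.M.X ◁ T.M.r = T.M.r ≫ T.comulX := by
  rw [comulX, comp_whiskerRight, Category.assoc, ξ_r, reassoc_of% T.comul.r_hom]

/-- Composing the unit law over `A` with the projection from `A.X ≫ T.M.X` replaces the unitor by
the action of `A`. Thus `A` acts on `T` through its unit map `A → T`. -/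
lemma one_mulX : T.one.hom ▷ T.M.X ≫ T.mulX = T.M.l := by
  have h := congrArg (fun k => (unit A).ϑ T.M ≫ Bimodule.Hom.hom k) T.one_mul
  simpa only [comp_hom', ϑ_whiskerR_assoc, ϑ_leftUnitor, ϑ_mul] using h

lemma mulX_one : T.M.X ◁ T.one.hom ≫ T.mulX = T.M.r := by
  have h := congrArg (fun k => T.M.ϑ (unit A) ≫ Bimodule.Hom.hom k) T.mul_one
  simpa only [comp_hom', ϑ_whiskerL_assoc, ϑ_rightUnitor, ϑ_mul] using h

lemma mulX_assoc : T.mulX ▷ T.M.X ≫ T.mulX = (α_ _ _ _).hom ≫ T.M.X ◁ T.mulX ≫ T.mulX := by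
  have h := congrArg (fun k => T.M.ϑ T.M ▷ T.M.X ≫ (T.M.tensor T.M).ϑ T.M ≫ Bimodule.Hom.hom k)
    T.mul_assoc
  simp only [comp_hom', ϑ_whiskerR_assoc, ϑ_associator_assoc, ϑ_whiskerL_assoc, ϑ_mul] at h
  rw [← comp_whiskerRight_assoc, ← whiskerLeft_comp_assoc, ϑ_mul] at h
  exact h

/-- The relation over `A`, preceded by `ϑ` and followed by `ξ`. Naturality moves `ξ` up to the
associator, which `ϑ_associator_inv_ξ` then dissolves, and what is left involves only `mulX` and
`comulX`. -/
lemma frobX_left : T.M.X ◁ T.comulX ≫ (α_ _ _ _).inv ≫ T.mulX ▷ T.M.X = T.mulX ≫ T.comulX := by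
  have h := congrArg (fun k => T.M.ϑ T.M ≫ Bimodule.Hom.hom k ≫ T.M.ξ T.M) T.frob_left
  simp only [comp_hom', Category.assoc, ϑ_whiskerL_assoc, ← ξ_whiskerRight,
    reassoc_of% ϑ_associator_inv_ξ] at h
  rw [← comp_whiskerRight, ← whiskerLeft_comp_assoc, ϑ_mul, reassoc_of% T.ϑ_mul] at h
  exact h

lemma frobX_right : T.comulX ▷ T.M.X ≫ (α_ _ _ _).hom ≫ T.M.X ◁ T.mulX = T.mulX ≫ T.comulX := by
  have h := congrArg (fun k => T.M.ϑ T.M ≫ Bimodule.Hom.hom k ≫ T.M.ξ T.M) T.frob_right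
  simp only [comp_hom', Category.assoc, ϑ_whiskerR_assoc, ← ξ_whiskerLeft,
    reassoc_of% ϑ_associator_ξ] at h
  rw [← comp_whiskerRight_assoc, ← whiskerLeft_comp, ϑ_mul, reassoc_of% T.ϑ_mul] at h
  exact h

/-- The separable Frobenius algebra underlying a separable Frobenius algebra over `A`. -/
@[reducible]
noncomputable def alg : SepFrobAlg a where
  X := T.M.X
  mul := T.mulX
  one := A.one ≫ T.one.hom
  comul := T.comulX
  counit := T.counit.hom ≫ A.counit
  mul_assoc := T.mulX_assoc
  one_mul := by
    rw [comp_whiskerRight, Category.assoc, one_mulX, T.M.one_l]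
  mul_one := by
    rw [whiskerLeft_comp, Category.assoc, mulX_one, T.M.r_one]
  comul_assoc := by
    -- The law over `A` is tested after including the triple tensor product into the threefold
    -- composite; `associator_ξ` turns the associator of bimodules into that of `B`.
    have h := congrArg (fun k => Bimodule.Hom.hom k ≫ T.M.ξ (T.M.tensor T.M) ≫
      T.M.X ◁ T.M.ξ T.M) T.comul_assoc
    simp only [comp_hom', Category.assoc, associator_ξ] at h
    rw [← reassoc_of% ξ_whiskerRight, ← reassoc_of% ξ_whiskerLeft, ← whiskerLeft_comp,
      ← comp_whiskerRight_assoc] at h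
    simpa only [comulX, Category.assoc] using h
  counit_comul := by
    have h := congrArg (fun k => Bimodule.Hom.hom k ≫ (unit A).ξ T.M ≫ A.counit ▷ T.M.X)
      T.counit_comul
    simp only [comp_hom', Category.assoc, leftUnitor_inv_ξ_counit] at h
    rw [← reassoc_of% ξ_whiskerRight, ← comp_whiskerRight] at h
    simpa only [comulX, Category.assoc] using h
  comul_counit := by
    have h := congrArg (fun k => Bimodule.Hom.hom k ≫ T.M.ξ (unit A) ≫ T.M.X ◁ A.counit)
      T.comul_counit
    simp only [comp_hom', Category.assoc, rightUnitor_inv_ξ_counit] at h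
    rw [← reassoc_of% ξ_whiskerLeft, ← whiskerLeft_comp] at h
    simpa only [comulX, Category.assoc] using h
  frob_left := T.frobX_left
  frob_right := T.frobX_right
  separable := T.comulX_mulX

lemma ϑ_pairing : T.M.ϑ T.M ≫ T.mul.hom ≫ T.counit.hom ≫ A.counit = T.alg.pairing :=
  (Category.assoc _ _ _).symm

/-! ### The modules `X` and `Y` that split the algebra. -/

/-- The algebra as a bimodule over itself and `A`. -/
noncomputable def bimoduleX : Bimodule T.alg A where
  X := T.M.X
  l := T.mulX
  r := T.M.r
  l_assoc := T.mulX_assoc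
  one_l := T.alg.one_mul
  r_assoc := T.M.r_assoc
  r_one := T.M.r_one
  l_r := T.mulX_r

/-- The algebra as a bimodule over `A` and itself. -/
noncomputable def bimoduleY : Bimodule A T.alg where
  X := T.M.X
  l := T.M.l
  r := T.mulX
  l_assoc := T.M.l_assoc
  one_l := T.M.one_l
  r_assoc := (unit T.alg).r_assoc
  r_one := T.alg.mul_one
  l_r := T.l_mulX

/-- Associativity in the orientation that `descHom` demands for linearity over the left algebra. -/
lemma inv_mulX_assoc :
    T.M.X ◁ T.mulX ≫ T.mulX = (α_ _ _ _).inv ≫ T.mulX ▷ T.M.X ≫ T.mulX := by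
  rw [mulX_assoc, Iso.inv_hom_id_assoc]

lemma inv_l_mulX : A.X ◁ T.mulX ≫ T.M.l = (α_ _ _ _).inv ≫ T.M.l ▷ T.M.X ≫ T.mulX := by
  rw [l_mulX, Iso.inv_hom_id_assoc]

/-- The multiplication as a right action on `bimoduleX`. -/
noncomputable def mulXM : T.bimoduleX.X ≫ T.M.X ⟶ T.bimoduleX.X := T.mulX

/-- The multiplication as a left action on `bimoduleY`. -/
noncomputable def mulMY : T.M.X ≫ T.bimoduleY.X ⟶ T.bimoduleY.X := T.mulX

/-- The multiplication as a map out of the composite of `bimoduleX` and `bimoduleY`. -/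
noncomputable def mulXY : T.bimoduleX.X ≫ T.bimoduleY.X ⟶ (unit T.alg).X := T.mulX

/-- The multiplication as a map out of the composite of `bimoduleY` and `bimoduleX`. -/
noncomputable def mulYX : T.bimoduleY.X ≫ T.bimoduleX.X ⟶ T.M.X := T.mulX

/-- The comultiplication as a right coaction on `bimoduleX`. -/
noncomputable def comulXM : T.bimoduleX.X ⟶ T.bimoduleX.X ≫ T.M.X := T.comulX

/-- The comultiplication as a map to the composite of `bimoduleX` and `bimoduleY`. -/
noncomputable def comulXY : (unit T.alg).X ⟶ T.bimoduleX.X ≫ T.bimoduleY.X := T.comulX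

/-- The right action of the algebra on `bimoduleX`. -/
noncomputable def actX : T.bimoduleX.tensor T.M ⟶ T.bimoduleX :=
  descHom T.mulXM T.mulX_balanced T.inv_mulX_assoc T.mulX_r

lemma ϑ_actX : T.bimoduleX.ϑ T.M ≫ T.actX.hom = T.mulXM := ϑ_descHom _ _ _ _

/-- The left action of the algebra on `bimoduleY`. -/
noncomputable def actY : T.M.tensor T.bimoduleY ⟶ T.bimoduleY :=
  descHom T.mulMY T.mulX_balanced T.inv_l_mulX T.mulX_assoc

lemma ϑ_actY : T.M.ϑ T.bimoduleY ≫ T.actY.hom = T.mulMY := ϑ_descHom _ _ _ _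

/-- The multiplication as a map from the tensor product of `bimoduleX` and `bimoduleY`. -/
noncomputable def ev : T.bimoduleX.tensor T.bimoduleY ⟶ unit T.alg :=
  descHom T.mulXY T.mulX_balanced T.inv_mulX_assoc T.mulX_assoc

lemma ϑ_ev : T.bimoduleX.ϑ T.bimoduleY ≫ T.ev.hom = T.mulXY := ϑ_descHom _ _ _ _

/-- The comultiplication as a map to the tensor product of `bimoduleX` and `bimoduleY`. -/
noncomputable def coev : unit T.alg ⟶ T.bimoduleX.tensor T.bimoduleY where
  hom := T.comulXY ≫ T.bimoduleX.ϑ T.bimoduleY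
  l_hom := by
    -- Linearity of the comultiplication on each side is one of the two Frobenius relations.
    rw [whiskerLeft_comp, Category.assoc, ϑ_l]
    exact (reassoc_of% T.frobX_left) _
  r_hom := by
    rw [comp_whiskerRight, Category.assoc, ϑ_r]
    exact (reassoc_of% T.frobX_right) _

/-- The comultiplication as a right coaction on `bimoduleX`. -/
noncomputable def coactX : T.bimoduleX ⟶ T.bimoduleX.tensor T.M where
  hom := T.comulXM ≫ T.bimoduleX.ϑ T.M
  l_hom := by
    rw [whiskerLeft_comp, Category.assoc, ϑ_l]
    exact (reassoc_of% T.frobX_left) _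
  r_hom := by
    rw [comp_whiskerRight, Category.assoc, ϑ_r]
    exact (reassoc_of% T.comulX_r) _

lemma coactX_hom : T.coactX.hom = T.comulXM ≫ T.bimoduleX.ϑ T.M := rfl

lemma coev_hom : T.coev.hom = T.comulXY ≫ T.bimoduleX.ϑ T.bimoduleY := rfl

/-- The tensor product of `bimoduleY` and `bimoduleX` is the algebra. -/
noncomputable def tensorIso : T.bimoduleY.tensor T.bimoduleX ≅ T.M :=
  isoOfHom
    (descHom T.mulYX T.mulX_assoc T.inv_l_mulX T.mulX_r)
    -- The idempotent defining this tensor product involves only the inner actions, which are both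
    -- multiplication. Its image is therefore definitionally that of `unit T.alg` tensored with
    -- itself, and the inverse of the left unitor can be reused; only the outer actions differ.
    (leftUnitor (unit T.alg)).inv.hom
    (congrArg Bimodule.Hom.hom (leftUnitor (unit T.alg)).hom_inv_id)
    (congrArg Bimodule.Hom.hom (leftUnitor (unit T.alg)).inv_hom_id)

lemma ϑ_tensorIso : T.bimoduleY.ϑ T.bimoduleX ≫ T.tensorIso.hom.hom = T.mulYX :=
  ϑ_descHom T.mulYX T.mulX_assoc T.inv_l_mulX T.mulX_r

/-- This law, the other module laws below, `ev_balanced` and the two linearity laws of `tensorIso`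
are tested after projecting from plain composites. There every map is `mulX`, and associativity or
unitality of `mulX` finishes. -/
lemma actX_assoc : T.bimoduleX.whiskerL T.mul ≫ T.actX =
    (associator T.bimoduleX T.M T.M).inv ≫ whiskerR T.actX T.M ≫ T.actX := by
  apply tensor_hom_ext₂
  simp only [comp_hom', ϑ_whiskerL_assoc, ϑ_associator_inv_assoc, ϑ_whiskerR_assoc]
  rw [← whiskerLeft_comp_assoc, ← comp_whiskerRight_assoc, ϑ_actX, ϑ_mul]
  exact T.inv_mulX_assoc

lemma actX_one : T.bimoduleX.whiskerL T.one ≫ T.actX = (rightUnitor T.bimoduleX).hom := by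
  apply tensor_hom_ext
  simp only [comp_hom', ϑ_whiskerL_assoc, ϑ_rightUnitor, ϑ_actX]
  exact T.mulX_one

lemma actY_assoc : whiskerR T.mul T.bimoduleY ≫ T.actY =
    (associator T.M T.M T.bimoduleY).hom ≫ T.M.whiskerL T.actY ≫ T.actY := by
  apply tensor_hom_ext₁
  simp only [comp_hom', ϑ_whiskerL_assoc, ϑ_associator_assoc, ϑ_whiskerR_assoc]
  rw [← whiskerLeft_comp_assoc, ← comp_whiskerRight_assoc, ϑ_actY, ϑ_mul]
  exact T.mulX_assoc

lemma actY_one : whiskerR T.one T.bimoduleY ≫ T.actY = (leftUnitor T.bimoduleY).hom := by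
  apply tensor_hom_ext
  simp only [comp_hom', ϑ_whiskerR_assoc, ϑ_leftUnitor, ϑ_actY]
  exact T.one_mulX

/-- Separability of the algebra, since `ϑ` followed by `T.ev` is the plain multiplication. -/
lemma coev_ev : T.coev ≫ T.ev = 𝟙 _ := by
  apply hom_ext
  rw [comp_hom', coev_hom, Category.assoc, ϑ_ev]
  exact T.comulX_mulX

lemma ev_balanced : whiskerR T.actX T.bimoduleY ≫ T.ev =
    (associator T.bimoduleX T.M T.bimoduleY).hom ≫ T.bimoduleX.whiskerL T.actY ≫ T.ev := by
  apply tensor_hom_ext₁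
  simp only [comp_hom', ϑ_whiskerL_assoc, ϑ_associator_assoc, ϑ_whiskerR_assoc, ϑ_ev]
  rw [← whiskerLeft_comp_assoc, ← comp_whiskerRight_assoc, ϑ_actY, ϑ_actX]
  exact T.mulX_assoc

lemma coactX_actX : T.coactX ≫ T.actX = 𝟙 _ := by
  apply hom_ext
  rw [comp_hom', coactX_hom, Category.assoc, ϑ_actX]
  exact T.comulX_mulX

/-- A Frobenius relation: multiplying and then comultiplying is the idempotent that coacts on `X`
and acts on `Y`. This makes the tensor product over `T` equal to the image of `ev`. -/
lemma ev_coev : T.ev ≫ T.coev = whiskerR T.coactX T.bimoduleY ≫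
    (associator T.bimoduleX T.M T.bimoduleY).hom ≫ T.bimoduleX.whiskerL T.actY := by
  apply tensor_hom_ext
  simp only [comp_hom', ϑ_whiskerR_assoc]
  rw [coactX_hom, comp_whiskerRight, Category.assoc, ϑ_associator_assoc, ϑ_whiskerL,
    ← whiskerLeft_comp_assoc, ϑ_actY, reassoc_of% T.ϑ_ev, coev_hom]
  exact ((reassoc_of% T.frobX_right) _).symm

lemma tensorIso_left : T.M.whiskerL T.tensorIso.hom ≫ T.mul =
    (associator T.M T.bimoduleY T.bimoduleX).inv ≫ whiskerR T.actY T.bimoduleX ≫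
      T.tensorIso.hom := by
  apply tensor_hom_ext₂
  simp only [comp_hom', ϑ_whiskerL_assoc, ϑ_associator_inv_assoc, ϑ_whiskerR_assoc, ϑ_mul,
    ϑ_tensorIso]
  rw [← whiskerLeft_comp_assoc, ← comp_whiskerRight_assoc, ϑ_actY, ϑ_tensorIso]
  exact T.inv_mulX_assoc

lemma tensorIso_right : whiskerR T.tensorIso.hom T.M ≫ T.mul =
    (associator T.bimoduleY T.bimoduleX T.M).hom ≫ T.bimoduleY.whiskerL T.actX ≫
      T.tensorIso.hom := by
  apply tensor_hom_ext₁
  simp only [comp_hom', ϑ_whiskerL_assoc, ϑ_associator_assoc, ϑ_whiskerR_assoc, ϑ_mul,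
    ϑ_tensorIso]
  rw [← whiskerLeft_comp_assoc, ← comp_whiskerRight_assoc, ϑ_actX, ϑ_tensorIso]
  exact T.mulX_assoc

end RelSepFrobAlg

end RelativeAlgebra

open Bimodule Pivotal

/-! ### Idempotence of the equivariant completion. -/

section EqCompletionOfEqCompletion

variable {B : Type u} [Bicategory.{w, v} B] [LocallyIdempotentComplete B]

/-- A separable Frobenius algebra in the equivariant completion, in terms of bimodules. -/
def EqCompletion.relAlg {x : EqCompletion B} (T : SepFrobAlg x) : RelSepFrobAlg x.alg where
  M := T.X
  mul := T.mul
  one := T.one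
  comul := T.comul
  counit := T.counit
  mul_assoc := T.mul_assoc
  one_mul := T.one_mul
  mul_one := T.mul_one
  comul_assoc := T.comul_assoc
  counit_comul := T.counit_comul
  comul_counit := T.comul_counit
  frob_left := T.frob_left
  frob_right := T.frob_right
  separable := T.separable

/-- Separable Frobenius algebras in the equivariant completion split. -/
noncomputable def EqCompletion.splitting {x : EqCompletion B} (T : SepFrobAlg x) :
    T.Splitting ⟨x.pt, (relAlg T).alg⟩ where
  X := (relAlg T).bimoduleX
  Y := (relAlg T).bimoduleY
  r := (relAlg T).actX
  l := (relAlg T).actY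
  r_assoc := (relAlg T).actX_assoc
  r_one := (relAlg T).actX_one
  l_assoc := (relAlg T).actY_assoc
  one_l := (relAlg T).actY_one
  ev := (relAlg T).ev
  coev := (relAlg T).coev
  coact := (relAlg T).coactX
  coev_ev := (relAlg T).coev_ev
  ev_balanced := (relAlg T).ev_balanced
  coact_r := (relAlg T).coactX_actX
  ev_coev := (relAlg T).ev_coev
  iso := (relAlg T).tensorIso
  l_iso := (relAlg T).tensorIso_left
  iso_r := (relAlg T).tensorIso_right

theorem EqCompletion.embedding_isBiequivalence (B : Type u) [Bicategory.{w, v} B]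
    [LocallyIdempotentComplete B] :
    IsBiequivalence (EqCompletion.embedding (EqCompletion B)) where
  local_equivalence := EqCompletion.embedding_mapFunctor_isEquivalence _
  -- The witness keeps the underlying object of `B` and absorbs both algebras into one.
  essSurj c := ⟨⟨c.pt.pt, (relAlg c.alg).alg⟩, ⟨(splitting c.alg).eqEquivalence⟩⟩

end EqCompletionOfEqCompletion

/-! ### Symmetry of the underlying algebra and idempotence of the orbifold completion. -/

section OrbCompletionOfOrbCompletion

variable {B : Type u} [Bicategory.{w, v} B] [LocallyIdempotentComplete B] [Pivotal B]

/-- A separable Frobenius algebra in the orbifold completion, in terms of bimodules. -/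
def OrbCompletion.relAlg {x : OrbCompletion B} (T : SepFrobAlg x) : RelSepFrobAlg x.alg where
  M := T.X
  mul := T.mul
  one := T.one
  comul := T.comul
  counit := T.counit
  mul_assoc := T.mul_assoc
  one_mul := T.one_mul
  mul_one := T.mul_one
  comul_assoc := T.comul_assoc
  counit_comul := T.counit_comul
  comul_counit := T.comul_counit
  frob_left := T.frob_left
  frob_right := T.frob_right
  separable := T.separable

/-- The algebra underlying a symmetric algebra in the orbifold completion is symmetric. -/
lemma OrbCompletion.relAlg_alg_isSymmetric {x : OrbCompletion B} (T : SepFrobAlg x)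
    (hT : T.IsSymmetric) : (relAlg T).alg.IsSymmetric := by
  -- The bridge between the two pivotal structures: an adjunction counit of the completion takes
  -- values in `A`, and the counit of `A` brings it back to the counit in `B`.
  have key {N : Bimodule x.alg x.alg} {M : Bimodule x.alg x.alg} (d : DualPair M N) :
      N.ϑ M ≫ d.counitHom.hom ≫ x.alg.counit = d.adj.counit := by
    rw [reassoc_of% d.ϑ_counitHom, d.ev_counit]
  let t := relAlg T
  -- The adjoint in the completion is by definition the dual bimodule, so both comparison maps are
  -- bimodule maps over 2-morphisms `T ⟶ T†` of `B`.
  let φ : t.M ⟶ t.M.dual x.symm := T.toDagRight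
  let ψ : t.M ⟶ t.M.dual x.symm := T.toDagLeft
  have h₁ : whiskerR φ t.M ≫ (dualPairRight t.M x.symm).counitHom = t.mul ≫ t.counit :=
    T.toDagRight_counit
  have h₂ : t.M.whiskerL ψ ≫ (dualPairLeft t.M x.symm x.symm).counitHom = t.mul ≫ t.counit :=
    T.toDagLeft_counit
  have k₁ := congrArg (fun k => t.M.ϑ t.M ≫ Bimodule.Hom.hom k ≫ x.alg.counit) h₁
  have k₂ := congrArg (fun k => t.M.ϑ t.M ≫ Bimodule.Hom.hom k ≫ x.alg.counit) h₂
  simp only [comp_hom', Category.assoc, ϑ_whiskerR_assoc, ϑ_whiskerL_assoc, key,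
    t.ϑ_pairing] at k₁ k₂
  -- A 2-morphism into an adjoint is determined by its composite with the counit, and both sides
  -- yield the pairing of `t.alg`.
  have e₁ : t.alg.toDagRight = φ.hom :=
    ext_counit_right (radj t.M.X) (t.alg.toDagRight_counit.trans k₁.symm)
  have e₂ : t.alg.toDagLeft = ψ.hom :=
    ext_counit_left (ladj t.M.X) (t.alg.toDagLeft_counit.trans k₂.symm)
  exact e₁.trans ((congrArg Bimodule.Hom.hom (show φ = ψ from hT)).trans e₂.symm)

/-- Symmetric separable Frobenius algebras in the orbifold completion split. -/
noncomputable def OrbCompletion.splitting {x : OrbCompletion B} (T : SepFrobAlg x)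
    (hT : T.IsSymmetric) :
    T.Splitting ⟨x.pt, (relAlg T).alg, relAlg_alg_isSymmetric T hT⟩ where
  X := (relAlg T).bimoduleX
  Y := (relAlg T).bimoduleY
  r := (relAlg T).actX
  l := (relAlg T).actY
  r_assoc := (relAlg T).actX_assoc
  r_one := (relAlg T).actX_one
  l_assoc := (relAlg T).actY_assoc
  one_l := (relAlg T).actY_one
  ev := (relAlg T).ev
  coev := (relAlg T).coev
  coact := (relAlg T).coactX
  coev_ev := (relAlg T).coev_ev
  ev_balanced := (relAlg T).ev_balanced
  coact_r := (relAlg T).coactX_actX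
  ev_coev := (relAlg T).ev_coev
  iso := (relAlg T).tensorIso
  l_iso := (relAlg T).tensorIso_left
  iso_r := (relAlg T).tensorIso_right

theorem OrbCompletion.embedding_isBiequivalence (B : Type u) [Bicategory.{w, v} B]
    [LocallyIdempotentComplete B] [Pivotal B] :
    IsBiequivalence (OrbCompletion.embedding (OrbCompletion B)) where
  local_equivalence := OrbCompletion.embedding_mapFunctor_isEquivalence _
  essSurj c := ⟨⟨c.pt.pt, (relAlg c.alg).alg, relAlg_alg_isSymmetric c.alg c.symm⟩,
    ⟨(splitting c.alg c.symm).orbEquivalence c.symm⟩⟩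

end OrbCompletionOfOrbCompletion

end OrbifoldCompletion

theorem proposition4p2 (B : Type u) [Bicategory.{w, v} B] [LocallyIdempotentComplete B] :
    IsBiequivalence (EqCompletion.embedding (EqCompletion B)) ∧
      ∀ [Pivotal B], IsBiequivalence (OrbCompletion.embedding (OrbCompletion B)) :=
  ⟨EqCompletion.embedding_isBiequivalence B, OrbCompletion.embedding_isBiequivalence B⟩
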